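/- **Conventions.** *Box category.* Let $\square$ be the category whose objects are the posets $[1]^n=\{0\le 1\}^n$ ($n\ge 0$) and whose morphisms are the maps generated under composition by the faces $\partial_{i,\varepsilon}$ (insert the constant $\varepsilon\in\{0,1\}$ as $i$-th coordinate), the degeneracies $\sigma_i$ (delete the $i$-th coordinate) and the connections $\gamma_{i,1},\gamma_{i,0}$ (replace the coordinates $x_i,x_{i+1}$ by $\max\{x_i,x_{i+1}\}$, resp. $\min\{x_i,x_{i+1}\}$). It is monoidal under $[1]^m\otimes[1]^n=[1]^{m+n}$. Put $\mathsf{cSet}=\mathsf{Set}^{\square^{\mathrm{op}}}$, with the geometric product $\otimes$, i.e. the Day convolution of this monoidal structure; its cubes are of the form $x\otimes y$, and a non-degenerate cube (one not of the form $w\sigma_i$ or $w\gamma_{i,\varepsilon}$) is $x\otimes y$ for exactly one pair $(x,y)$. *Marked cubical sets.* Let $\square^+$ be the category obtained from $\square$ by adjoining, for each $n\ge1$, an object $[1]^n_e$, an epimorphism $\varphi^n:[1]^n\to[1]^n_e$, and maps $\zeta_i,\xi_{i,\varepsilon}:[1]^n_e\to[1]^{n-1}$ with $\zeta_i\varphi=\sigma_i$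 ($1\le i\le n$) and $\xi_{i,\varepsilon}\varphi=\gamma_{i,\varepsilon}$ ($1\le i\le n-1$). A marked cubical set is a presheaf $X$ of sets on $\square^+$ for which all maps $\varphi^*:X([1]^n_e)\to X([1]^n)$ are injective; the cubes in the image of $\varphi^*$ are called marked. Thus $X$ is a cubical set $\upsilon X$ with a set of marked cubes that contains all degenerate cubes and no $0$-cubes. Let $\mathsf{cSet}^+$ be the full subcategory of $\mathsf{Set}^{(\square^+)^{\mathrm{op}}}$ on the marked cubical sets. *Pseudo Gray tensor product on $\mathsf{cSet}^+$.* $X\circledast Y$ is $\upsilon X\otimes\upsilon Y$ with the following marking: a non-degenerate cube $x\otimes y$ is unmarked if and only if $x$ is a $0$-cube and $y$ is unmarked, or $x$ is unmarked and $y$ is a $0$-cube; degenerate cubes are marked. With unit $\square^0$ and the structure isomorphisms of the geometric product, this is a monoidal structure on $\mathsf{cSet}^+$. *Pre-complicial sets.* A marked simplicial set is a simplicial set with a set of marked simplices containing all degenerate simplices and no $0$-simplices; maps are the simplicial maps that preserve marked simplices. For a marked simplicial set $X$ and an integer $m$, let $\mathrm{tr}_{m}X$ be $X$ with all simplices of dimension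 $\ge \max(m+1,1)$ marked in addition. For $n\ge1$, $0\le k\le n$, let $\Delta^k[n]$ be the simplex $\Delta^n$ in which a non-degenerate simplex is marked iff it contains $\{k-1,k,k+1\}\cap[n]$; let $\Delta^k[n]''=\mathrm{tr}_{n-2}\Delta^k[n]$, and let $\Delta^k[n]'$ be $\Delta^k[n]$ with, in addition, all simplices of the horn $\Lambda^k[n]$ of dimension $\ge\max(n-1,1)$ marked. A marked simplicial set is pre-complicial if it has the right lifting property with respect to the inclusions $\Delta^k[n]'\to\Delta^k[n]''$, for all $n\ge1$ and $0\le k\le n$. Let $\mathsf{PreComp}$ be the full subcategory of pre-complicial sets, with the cartesian product $\circledast$ (a pair of simplices is marked iff both of its components are). *Triangulation.* The Gray tensor product of marked simplicial sets $X,Y$ is $X\times Y$ where an $n$-simplex $(x,y)$ is marked iff for all $p+q=n$ the front $p$-face of $x$ or the back $q$-face of $y$ is marked. Let $(\Delta^1)^{\otimes n}$ be the $n$-th Gray tensor power of the minimally marked $\Delta^1$; its underlying simplicial set is the nerve of $[1]^n$. The assignments $[1]^n\mapsto(\Delta^1)^{\otimes n}$ and $[1]^n_e\mapsto \mathrm{tr}_{n-1}\bigl((\Delta^1)^{\otimes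 n}\bigr)$, with the maps given on underlying simplicial sets by the nerves of the maps of cubes, define a functor $\tau:\square^+\to\mathsf{PreComp}$. The triangulation functor $T:\mathsf{cSet}^+\to\mathsf{PreComp}$ is the restriction to $\mathsf{cSet}^+$ of the left Kan extension of $\tau$ along the Yoneda embedding $\square^+\to\mathsf{Set}^{(\square^+)^{\mathrm{op}}}$. It has the right adjoint $U:\mathsf{PreComp}\to\mathsf{cSet}^+$, $U(Y)=\mathsf{PreComp}(\tau(-),Y)$. **Theorem.** The adjunction $T\dashv U$ is a monoidal adjunction with respect to the pseudo Gray tensor products. That is, $T:(\mathsf{cSet}^+,\circledast)\to(\mathsf{PreComp},\circledast)$ admits the structure of a strong monoidal functor and $U$ that of a lax monoidal functor, such that the unit and counit of $T\dashv U$ are compatible with these structures. -/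

import Mathlib

universe u

namespace Comical

set_option linter.unusedVariables false

open CategoryTheory Opposite MonoidalCategory Limits

/-- The poset `[1]^n`, with `[1] = {false ≤ true}` and the product order. -/
abbrev Cube (n : ℕ) : Type := Fin n → Bool

/-- The face `∂_{i,ε}`, inserting `ε` at position `i`. -/
def face {n : ℕ} (i : Fin (n + 1)) (ε : Bool) (x : Cube n) : Cube (n + 1) := fun j =>
  if h : j.val < i.val then x ⟨j.val, by omega⟩
  else if h' : i.val < j.val then x ⟨j.val - 1, by omega⟩ else ε

/-- The degeneracy `σ_i`, deleting the coordinate at position `i`. -/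
def degen {n : ℕ} (i : Fin (n + 1)) (x : Cube (n + 1)) : Cube n := fun j =>
  if j.val < i.val then x j.castSucc else x j.succ

/-- The connection `γ_{i,ε}`, replacing the adjacent coordinates at positions `i`, `i + 1` by their
maximum (for `ε = true`) or their minimum (for `ε = false`). -/
def conn {n : ℕ} (i : Fin n) (ε : Bool) (x : Cube (n + 1)) : Cube n := fun j =>
  if j.val < i.val then x j.castSucc
  else if j.val = i.val then
    (if ε then max (x i.castSucc) (x i.succ) else min (x i.castSucc) (x i.succ))
  else x j.succ

/-- The maps `[1]^m → [1]^n` generated under composition by the cubical operators. -/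
inductive IsBoxMap : ∀ {m n : ℕ}, (Cube m → Cube n) → Prop
  | id (n : ℕ) : IsBoxMap (fun x : Cube n => x)
  | comp {m n p : ℕ} {f : Cube m → Cube n} {g : Cube n → Cube p} :
      IsBoxMap f → IsBoxMap g → IsBoxMap (fun x => g (f x))
  | face {n : ℕ} (i : Fin (n + 1)) (ε : Bool) : IsBoxMap (face i ε)
  | degen {n : ℕ} (i : Fin (n + 1)) : IsBoxMap (degen i)
  | conn {n : ℕ} (i : Fin n) (ε : Bool) : IsBoxMap (conn i ε)

theorem IsBoxMap.monotone {m n : ℕ} {f : Cube m → Cube n} (hf : IsBoxMap f) : Monotone f := by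
  induction hf with
  | id n => exact monotone_id
  | comp _ _ h1 h2 => exact h2.comp h1
  | face i ε =>
    intro x y h j
    unfold Comical.face
    split_ifs
    · exact h _
    · exact h _
    · exact le_rfl
  | degen i =>
    intro x y h j
    unfold Comical.degen
    split_ifs <;> exact h _
  | conn i ε =>
    intro x y h j
    unfold Comical.conn
    split_ifs
    · exact h _
    · exact max_le_max (h _) (h _)
    · exact min_le_min (h _) (h _)
    · exact h _

/-- Renaming coordinates along an equality of dimensions. -/
def recast {m n : ℕ} (h : m = n) (x : Cube m) : Cube n := fun j => x (Fin.cast h.symm j)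

theorem IsBoxMap.recast {m n : ℕ} (h : m = n) : IsBoxMap (recast h) := by
  subst h; exact IsBoxMap.id _

/-- The side-by-side product of two maps of cubes. -/
def tensorMap {k k' l l' : ℕ} (f : Cube k → Cube k') (g : Cube l → Cube l') :
    Cube (k + l) → Cube (k' + l') := fun x =>
  Fin.append (f fun i => x (Fin.castAdd l i)) (g fun j => x (Fin.natAdd k j))

@[simp] theorem tensorMap_castAdd {k k' l l' : ℕ} (f : Cube k → Cube k') (g : Cube l → Cube l')
    (x : Cube (k + l)) (i : Fin k') :
    tensorMap f g x (Fin.castAdd l' i) = f (fun i => x (Fin.castAdd l i)) i := by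
  simp [tensorMap]

@[simp] theorem tensorMap_natAdd {k k' l l' : ℕ} (f : Cube k → Cube k') (g : Cube l → Cube l')
    (x : Cube (k + l)) (i : Fin l') :
    tensorMap f g x (Fin.natAdd k' i) = g (fun j => x (Fin.natAdd k j)) i := by
  simp [tensorMap]

theorem cube_add_ext {k l : ℕ} {x y : Cube (k + l)}
    (h1 : ∀ i, x (Fin.castAdd l i) = y (Fin.castAdd l i))
    (h2 : ∀ i, x (Fin.natAdd k i) = y (Fin.natAdd k i)) : x = y := by
  funext j
  exact Fin.addCases h1 h2 j

/-- The maps `[1]^m → [1]^n` of the form `g ∘ σ_i` or `g ∘ γ_{i,ε}` for a map of cubes `g`. -/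
inductive IsDegenerate : ∀ {m n : ℕ}, (Cube m → Cube n) → Prop
  | degen {m n : ℕ} (i : Fin (m + 1)) {g : Cube m → Cube n} (hg : IsBoxMap g) :
      IsDegenerate (fun x => g (degen i x))
  | conn {m n : ℕ} (i : Fin m) (ε : Bool) {g : Cube m → Cube n} (hg : IsBoxMap g) :
      IsDegenerate (fun x => g (conn i ε x))

theorem IsDegenerate.comp {m n p : ℕ} {f : Cube m → Cube n} {g : Cube n → Cube p}
    (hf : IsDegenerate f) (hg : IsBoxMap g) : IsDegenerate (fun x => g (f x)) := by
  cases hf with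
  | degen i h => exact .degen i (h.comp hg)
  | conn i ε h => exact .conn i ε (h.comp hg)

theorem IsDegenerate.pos {m n : ℕ} {f : Cube m → Cube n} (hf : IsDegenerate f) : 1 ≤ m := by
  cases hf <;> omega

theorem IsDegenerate.recast_comp {m n p : ℕ} (h : m = n) {f : Cube n → Cube p}
    (hf : IsDegenerate f) : IsDegenerate (fun x => f (Comical.recast h x)) := by
  subst h; exact hf

theorem tensorMap_degen_id {n : ℕ} (i : Fin (n + 1)) (l : ℕ) :
    tensorMap (degen i) (fun x : Cube l => x) = fun x =>
      degen (n := n + l) ⟨i.val, by omega⟩ (recast (by omega : n + 1 + l = n + l + 1) x) := by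
  funext x
  refine cube_add_ext (fun j => ?_) (fun j => ?_)
  · simp [recast, degen]
    split_ifs <;> first | rfl | omega
  · simp [recast, degen]
    split_ifs <;> first | omega | (congr 1; ext; simp; omega)

theorem tensorMap_conn_id {n : ℕ} (i : Fin n) (ε : Bool) (l : ℕ) :
    tensorMap (conn i ε) (fun x : Cube l => x) = fun x =>
      conn (n := n + l) ⟨i.val, by omega⟩ ε (recast (by omega : n + 1 + l = n + l + 1) x) := by
  funext x
  refine cube_add_ext (fun j => ?_) (fun j => ?_)
  · simp [recast, conn]
    split_ifs <;> first | rfl | omega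
  · simp [recast, conn]
    split_ifs <;> first | omega | (congr 1; ext; simp; omega)

theorem tensorMap_id_degen {n : ℕ} (i : Fin (n + 1)) (l : ℕ) :
    tensorMap (fun x : Cube l => x) (degen i) =
      degen (n := l + n) ⟨l + i.val, by omega⟩ := by
  funext x
  refine cube_add_ext (fun j => ?_) (fun j => ?_)
  · simp [degen]
    split_ifs <;> first | omega | rfl
  · simp [degen]
    split_ifs <;> first | omega | rfl

theorem tensorMap_id_conn {n : ℕ} (i : Fin n) (ε : Bool) (l : ℕ) :
    tensorMap (fun x : Cube l => x) (conn i ε) =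
      conn (n := l + n) ⟨l + i.val, by omega⟩ ε := by
  funext x
  refine cube_add_ext (fun j => ?_) (fun j => ?_)
  · simp [conn]
    split_ifs <;> first | omega | rfl
  · simp [conn]
    split_ifs <;> first | omega | rfl

theorem IsBoxMap.tensor_id {k k' : ℕ} {f : Cube k → Cube k'} (hf : IsBoxMap f) (l : ℕ) :
    IsBoxMap (tensorMap f (fun x : Cube l => x)) := by
  induction hf with
  | id n =>
    convert IsBoxMap.id (n + l) using 2 with x
    exact cube_add_ext (by simp) (by simp)
  | @comp m n p f g _ _ h1 h2 =>
    convert h1.comp h2 using 2 with x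
    exact cube_add_ext (by simp) (by simp)
  | @face n i ε =>
    have e : n + l + 1 = n + 1 + l := by omega
    convert (IsBoxMap.face (n := n + l) ⟨i.val, by omega⟩ ε).comp (IsBoxMap.recast e) using 2 with x
    refine cube_add_ext (fun j => ?_) (fun j => ?_)
    · simp [Comical.recast, Comical.face]
      try (split_ifs <;> first | rfl | omega)
    · simp [Comical.recast, Comical.face]
      split_ifs <;> first | omega | (congr 1; done) | (congr 1; ext; simp; omega)
  | degen i =>
    rw [tensorMap_degen_id]
    exact (IsBoxMap.recast _).comp (.degen _)
  | conn i ε =>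
    rw [tensorMap_conn_id]
    exact (IsBoxMap.recast _).comp (.conn _ _)

theorem IsBoxMap.id_tensor {k k' : ℕ} {f : Cube k → Cube k'} (hf : IsBoxMap f) (l : ℕ) :
    IsBoxMap (tensorMap (fun x : Cube l => x) f) := by
  induction hf with
  | id n =>
    convert IsBoxMap.id (l + n) using 2 with x
    exact cube_add_ext (by simp) (by simp)
  | @comp m n p f g _ _ h1 h2 =>
    convert h1.comp h2 using 2 with x
    exact cube_add_ext (by simp) (by simp)
  | @face n i ε =>
    have e : tensorMap (fun x : Cube l => x) (Comical.face i ε) =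
        Comical.face (n := l + n) ⟨l + i.val, by omega⟩ ε := by
      funext x
      refine cube_add_ext (k := l) (l := n + 1) (fun j => ?_) (fun j => ?_)
      · simp [Comical.face]
        split_ifs <;> first | omega | rfl
      · simp [Comical.face]
        split_ifs <;> first | omega | (congr 1; done) | (congr 1; ext; simp; omega) | rfl
    rw [e]
    exact .face _ _
  | degen i =>
    rw [tensorMap_id_degen]
    exact .degen _
  | conn i ε =>
    rw [tensorMap_id_conn]
    exact .conn _ _

theorem IsBoxMap.tensor {k k' l l' : ℕ} {f : Cube k → Cube k'} {g : Cube l → Cube l'}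
    (hf : IsBoxMap f) (hg : IsBoxMap g) : IsBoxMap (tensorMap f g) := by
  convert (hf.tensor_id l).comp (hg.id_tensor k') using 2 with x
  exact cube_add_ext (by simp) (by simp)

theorem degen_split {n : ℕ} (i : Fin (n + 1)) (k l : ℕ)
    (h : n = k + l) : ∃ (k' l' : ℕ) (h' : n + 1 = k' + l') (f₁ : Cube k' → Cube k)
      (f₂ : Cube l' → Cube l), IsBoxMap f₁ ∧ IsBoxMap f₂ ∧ (IsDegenerate f₁ ∨ IsDegenerate f₂) ∧
        ∀ x, Comical.recast h (degen i x) = tensorMap f₁ f₂ (Comical.recast h' x) := by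
  by_cases hi : i.val ≤ k
  · refine ⟨k + 1, l, by omega, _, _, .degen ⟨i.val, by omega⟩, .id _,
      .inl (.degen ⟨i.val, by omega⟩ (.id _)), fun x => ?_⟩
    refine cube_add_ext (fun j => ?_) (fun j => ?_)
    · simp [Comical.recast, Comical.degen]
      try (split_ifs <;> first | omega | rfl)
    · simp [Comical.recast, Comical.degen]
      split_ifs <;> first | omega | (congr 1; done) | (congr 1; ext; simp; omega) | rfl
  · refine ⟨k, l + 1, by omega, _, _, .id _, .degen ⟨i.val - k, by omega⟩,
      .inr (.degen ⟨i.val - k, by omega⟩ (.id _)), fun x => ?_⟩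
    refine cube_add_ext (fun j => ?_) (fun j => ?_)
    · simp [Comical.recast, Comical.degen]
      split_ifs <;> first | omega | rfl
    · simp [Comical.recast, Comical.degen]
      split_ifs <;> first | omega | (congr 1; done) | (congr 1; ext; simp; omega) | rfl

theorem conn_split {n : ℕ} (i : Fin n) (ε : Bool) (k l : ℕ)
    (h : n = k + l) : ∃ (k' l' : ℕ) (h' : n + 1 = k' + l') (f₁ : Cube k' → Cube k)
      (f₂ : Cube l' → Cube l), IsBoxMap f₁ ∧ IsBoxMap f₂ ∧ (IsDegenerate f₁ ∨ IsDegenerate f₂) ∧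
        ∀ x, Comical.recast h (conn i ε x) = tensorMap f₁ f₂ (Comical.recast h' x) := by
  by_cases hi : i.val < k
  · refine ⟨k + 1, l, by omega, _, _, .conn ⟨i.val, by omega⟩ ε, .id _,
      .inl (.conn ⟨i.val, by omega⟩ ε (.id _)), fun x => ?_⟩
    refine cube_add_ext (fun j => ?_) (fun j => ?_)
    · simp [Comical.recast, Comical.conn]
      try (split_ifs <;> first | omega | rfl)
    · simp [Comical.recast, Comical.conn]
      split_ifs <;> first | omega | (congr 1; done) | (congr 1; ext; simp; omega) | rfl
  · refine ⟨k, l + 1, by omega, _, _, .id _, .conn ⟨i.val - k, by omega⟩ ε,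
      .inr (.conn ⟨i.val - k, by omega⟩ ε (.id _)), fun x => ?_⟩
    refine cube_add_ext (fun j => ?_) (fun j => ?_)
    · simp [Comical.recast, Comical.conn]
      split_ifs <;> first | omega | rfl
    · simp [Comical.recast, Comical.conn]
      split_ifs <;> first | omega | (congr 1 <;> first | (congr 1; ext; simp; omega) | skip) | rfl

/-- Every map of cubes into `[1]^(k + l)` splits as a side-by-side product. -/
theorem IsBoxMap.split {n p : ℕ} {f : Cube n → Cube p} (hf : IsBoxMap f) (k l : ℕ)
    (h : p = k + l) : ∃ (k' l' : ℕ) (h' : n = k' + l') (f₁ : Cube k' → Cube k)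
      (f₂ : Cube l' → Cube l), IsBoxMap f₁ ∧ IsBoxMap f₂ ∧
        ∀ x, Comical.recast h (f x) = tensorMap f₁ f₂ (Comical.recast h' x) := by
  induction hf generalizing k l with
  | id n =>
    exact ⟨k, l, h, _, _, .id _, .id _, fun x => cube_add_ext (by simp) (by simp)⟩
  | @comp m n p f g _ _ h1 h2 =>
    obtain ⟨k', l', h', g₁, g₂, hg₁, hg₂, hg⟩ := h2 k l h
    obtain ⟨k'', l'', h'', f₁, f₂, hf₁, hf₂, hf⟩ := h1 k' l' h'
    refine ⟨k'', l'', h'', _, _, hf₁.comp hg₁, hf₂.comp hg₂, fun x => ?_⟩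
    rw [hg, hf]
    exact cube_add_ext (by simp) (by simp)
  | @face n i ε =>
    by_cases hi : i.val < k
    · obtain ⟨k, rfl⟩ : ∃ k₀, k = k₀ + 1 := ⟨k - 1, by omega⟩
      refine ⟨k, l, by omega, _, _, .face ⟨i.val, by omega⟩ ε, .id _, fun x => ?_⟩
      refine cube_add_ext (fun j => ?_) (fun j => ?_)
      · simp [Comical.recast, Comical.face]
        try (split_ifs <;> first | omega | rfl)
      · simp [Comical.recast, Comical.face]
        split_ifs <;> first | omega | (congr 1; done) | (congr 1; ext; simp; omega) | rfl
    · obtain ⟨l, rfl⟩ : ∃ k₀, l = k₀ + 1 := ⟨l - 1, by omega⟩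
      refine ⟨k, l, by omega, _, _, .id _, .face ⟨i.val - k, by omega⟩ ε, fun x => ?_⟩
      refine cube_add_ext (fun j => ?_) (fun j => ?_)
      · simp [Comical.recast, Comical.face]
        split_ifs <;> first | omega | rfl
      · simp [Comical.recast, Comical.face]
        split_ifs <;> first | omega | (congr 1; done) | (congr 1; ext; simp; omega) | rfl
  | degen i =>
    obtain ⟨k', l', h', f₁, f₂, h₁, h₂, _, h₃⟩ := degen_split i k l h
    exact ⟨k', l', h', f₁, f₂, h₁, h₂, h₃⟩
  | conn i ε =>
    obtain ⟨k', l', h', f₁, f₂, h₁, h₂, _, h₃⟩ := conn_split i ε k l h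
    exact ⟨k', l', h', f₁, f₂, h₁, h₂, h₃⟩

theorem IsDegenerate.split {n p : ℕ} {f : Cube n → Cube p} (hf : IsDegenerate f) (k l : ℕ)
    (h : p = k + l) : ∃ (k' l' : ℕ) (h' : n = k' + l') (f₁ : Cube k' → Cube k)
      (f₂ : Cube l' → Cube l), IsBoxMap f₁ ∧ IsBoxMap f₂ ∧ (IsDegenerate f₁ ∨ IsDegenerate f₂) ∧
        ∀ x, Comical.recast h (f x) = tensorMap f₁ f₂ (Comical.recast h' x) := by
  cases hf with
  | degen i hg =>
    obtain ⟨k', l', h', g₁, g₂, hg₁, hg₂, hg⟩ := hg.split k l h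
    obtain ⟨k'', l'', h'', f₁, f₂, hf₁, hf₂, hd, hf⟩ := degen_split i k' l' h'
    refine ⟨k'', l'', h'', _, _, hf₁.comp hg₁, hf₂.comp hg₂,
      hd.imp (fun hd => hd.comp hg₁) (fun hd => hd.comp hg₂), fun x => ?_⟩
    rw [hg, hf]
    exact cube_add_ext (by simp) (by simp)
  | conn i ε hg =>
    obtain ⟨k', l', h', g₁, g₂, hg₁, hg₂, hg⟩ := hg.split k l h
    obtain ⟨k'', l'', h'', f₁, f₂, hf₁, hf₂, hd, hf⟩ := conn_split i ε k' l' h'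
    refine ⟨k'', l'', h'', _, _, hf₁.comp hg₁, hf₂.comp hg₂,
      hd.imp (fun hd => hd.comp hg₁) (fun hd => hd.comp hg₂), fun x => ?_⟩
    rw [hg, hf]
    exact cube_add_ext (by simp) (by simp)

theorem IsDegenerate.tensor_left {k k' l l' : ℕ} {f : Cube k → Cube k'} {g : Cube l → Cube l'}
    (hf : IsDegenerate f) (hg : IsBoxMap g) : IsDegenerate (tensorMap f g) := by
  cases hf with
  | @degen m n i f' hf' =>
    have e : tensorMap (fun x => f' (Comical.degen i x)) g = fun x =>
        tensorMap f' g (tensorMap (Comical.degen i) (fun x => x) x) := by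
      funext x
      exact cube_add_ext (by simp) (by simp)
    rw [e, tensorMap_degen_id]
    exact IsDegenerate.recast_comp (by omega) (.degen _ (hf'.tensor hg))
  | @conn m n i ε f' hf' =>
    have e : tensorMap (fun x => f' (Comical.conn i ε x)) g = fun x =>
        tensorMap f' g (tensorMap (Comical.conn i ε) (fun x => x) x) := by
      funext x
      exact cube_add_ext (by simp) (by simp)
    rw [e, tensorMap_conn_id]
    exact IsDegenerate.recast_comp (by omega) (.conn _ _ (hf'.tensor hg))

theorem IsDegenerate.tensor_right {k k' l l' : ℕ} {f : Cube k → Cube k'} {g : Cube l → Cube l'}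
    (hf : IsBoxMap f) (hg : IsDegenerate g) : IsDegenerate (tensorMap f g) := by
  cases hg with
  | @degen m n i f' hf' =>
    have e : tensorMap f (fun x => f' (Comical.degen i x)) = fun x =>
        tensorMap f f' (tensorMap (fun x => x) (Comical.degen i) x) := by
      funext x
      exact cube_add_ext (by simp) (by simp)
    rw [e, tensorMap_id_degen]
    exact .degen _ (hf.tensor hf')
  | @conn m n i ε f' hf' =>
    have e : tensorMap f (fun x => f' (Comical.conn i ε x)) = fun x =>
        tensorMap f f' (tensorMap (fun x => x) (Comical.conn i ε) x) := by
      funext x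
      exact cube_add_ext (by simp) (by simp)
    rw [e, tensorMap_id_conn]
    exact .conn _ _ (hf.tensor hf')

/-- The unique map of cubes `[1]^n → [1]^0`. -/
theorem IsBoxMap.const (n : ℕ) : IsBoxMap (fun _ : Cube n => (Fin.elim0 : Cube 0)) := by
  induction n with
  | zero =>
    convert IsBoxMap.id 0 using 2 with x
  | succ n ih =>
    exact (IsBoxMap.degen 0).comp ih

theorem IsDegenerate.const {n : ℕ} (f : Cube n → Cube 0) (hn : 1 ≤ n) : IsDegenerate f := by
  obtain ⟨n, rfl⟩ : ∃ m, n = m + 1 := ⟨n - 1, by omega⟩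
  have e : f = fun x => (fun _ => Fin.elim0) (Comical.degen 0 x) := by
    funext x
    exact Subsingleton.elim _ _
  rw [e]
  exact .degen 0 (.const n)

/-- The box category `□`: the object with `dim = n` is `[1]^n`. -/
structure Box : Type where
  dim : ℕ

/-- Morphisms of the box category. -/
@[ext]
structure Box.Hom (a b : Box) : Type where
  map : Cube a.dim → Cube b.dim
  isBoxMap : IsBoxMap map

instance Box.category : Category Box where
  Hom := Box.Hom
  id a := ⟨fun x => x, .id _⟩
  comp f g := ⟨fun x => g.map (f.map x), f.isBoxMap.comp g.isBoxMap⟩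

@[ext] theorem Box.hom_ext {a b : Box} {f g : a ⟶ b} (h : ∀ x, f.map x = g.map x) : f = g :=
  Box.Hom.ext (funext h)

@[simp] theorem Box.id_map (a : Box) (x : Cube a.dim) : (𝟙 a : a ⟶ a).map x = x := rfl

@[simp] theorem Box.comp_map {a b c : Box} (f : a ⟶ b) (g : b ⟶ c) (x : Cube a.dim) :
    (f ≫ g).map x = g.map (f.map x) := rfl

/-- The identification of `[1]^m` and `[1]^n` for `m = n`. -/
def Box.castIso {a b : Box} (h : a.dim = b.dim) : a ≅ b where
  hom := ⟨recast h, .recast h⟩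
  inv := ⟨recast h.symm, .recast h.symm⟩

theorem tensorMap_recast_left {m n : ℕ} (h : m = n) (l : ℕ) :
    tensorMap (recast h) (fun x : Cube l => x) = recast (congrArg (· + l) h) := by
  subst h
  funext x
  exact cube_add_ext (by simp [recast]) (by simp [recast])

theorem tensorMap_recast_right {m n : ℕ} (h : m = n) (l : ℕ) :
    tensorMap (fun x : Cube l => x) (recast h) = recast (congrArg (l + ·) h) := by
  subst h
  funext x
  exact cube_add_ext (by simp [recast]) (by simp [recast])

/-- The strict monoidal structure `[1]^m ⊗ [1]^n = [1]^(m + n)` of the box category. -/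
instance Box.monoidalCategory : MonoidalCategory Box where
  tensorObj a b := ⟨a.dim + b.dim⟩
  whiskerLeft a _ _ f := ⟨tensorMap (fun x => x) f.map, f.isBoxMap.id_tensor a.dim⟩
  whiskerRight f b := ⟨tensorMap f.map (fun x => x), f.isBoxMap.tensor_id b.dim⟩
  tensorHom f g := ⟨tensorMap f.map g.map, f.isBoxMap.tensor g.isBoxMap⟩
  tensorUnit := ⟨0⟩
  associator a b c := Box.castIso (Nat.add_assoc a.dim b.dim c.dim)
  leftUnitor a := Box.castIso (Nat.zero_add a.dim)
  rightUnitor a := Box.castIso (Nat.add_zero a.dim)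
  tensorHom_def f g := by
    ext x : 1
    exact cube_add_ext (by simp) (by simp)
  id_tensorHom_id a b := by
    ext x : 1
    exact cube_add_ext (by simp) (by simp)
  tensorHom_comp_tensorHom f g h k := by
    ext x : 1
    exact cube_add_ext (by simp) (by simp)
  whiskerLeft_id a b := by
    ext x : 1
    exact cube_add_ext (by simp) (by simp)
  id_whiskerRight a b := by
    ext x : 1
    exact cube_add_ext (by simp) (by simp)
  associator_naturality {a a' a'' b b' b''} f g h := by
    ext x : 1
    refine cube_add_ext (fun i => ?_) (fun j => Fin.addCases (fun j => ?_) (fun k => ?_) j)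
    · change tensorMap (tensorMap f.map g.map) h.map x (Fin.castAdd _ (Fin.castAdd _ i)) =
        tensorMap f.map (tensorMap g.map h.map) (recast (Nat.add_assoc _ _ _) x) (Fin.castAdd _ i)
      simp only [tensorMap_castAdd]
      rfl
    · change tensorMap (tensorMap f.map g.map) h.map x (Fin.castAdd _ (Fin.natAdd _ j)) =
        tensorMap f.map (tensorMap g.map h.map) (recast (Nat.add_assoc _ _ _) x)
          (Fin.natAdd _ (Fin.castAdd _ j))
      simp only [tensorMap_castAdd, tensorMap_natAdd]
      rfl
    · have e : Fin.cast (Nat.add_assoc _ _ _).symm (Fin.natAdd b.dim (Fin.natAdd b'.dim k)) =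
          Fin.natAdd (b.dim + b'.dim) k := by ext; simp; omega
      change tensorMap (tensorMap f.map g.map) h.map x
          (Fin.cast (Nat.add_assoc _ _ _).symm (Fin.natAdd _ (Fin.natAdd _ k))) =
        tensorMap f.map (tensorMap g.map h.map) (recast (Nat.add_assoc _ _ _) x)
          (Fin.natAdd _ (Fin.natAdd _ k))
      rw [e]
      simp only [tensorMap_natAdd]
      congr 1
      funext l
      refine congrArg x ?_
      ext; simp; omega
  leftUnitor_naturality {a b} f := by
    ext x j
    have e : Fin.cast (Nat.zero_add b.dim).symm j = Fin.natAdd 0 j := by ext; simp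
    change tensorMap (fun x : Cube 0 => x) f.map x (Fin.cast (Nat.zero_add b.dim).symm j) =
      f.map (recast (Nat.zero_add a.dim) x) j
    rw [e, tensorMap_natAdd]
    congr 1
    funext l
    refine congrArg x ?_
    ext; simp
  rightUnitor_naturality {a b} f := by
    ext x j
    change tensorMap f.map (fun x : Cube 0 => x) x (Fin.castAdd 0 j) =
      f.map (recast (Nat.add_zero a.dim) x) j
    rw [tensorMap_castAdd]
    rfl
  pentagon a b c d := by
    ext x j
    change tensorMap (fun x : Cube a.dim => x) (recast (Nat.add_assoc b.dim c.dim d.dim))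
      (recast (Nat.add_assoc a.dim (b.dim + c.dim) d.dim)
        (tensorMap (recast (Nat.add_assoc a.dim b.dim c.dim)) (fun x : Cube d.dim => x) x)) j =
      recast (Nat.add_assoc a.dim b.dim (c.dim + d.dim))
        (recast (Nat.add_assoc (a.dim + b.dim) c.dim d.dim) x) j
    rw [tensorMap_recast_left, tensorMap_recast_right]
    rfl
  triangle a b := by
    ext x j
    change tensorMap (fun x : Cube a.dim => x) (recast (Nat.zero_add b.dim))
      (recast (Nat.add_assoc a.dim 0 b.dim) x) j =
        tensorMap (recast (Nat.add_zero a.dim)) (fun x : Cube b.dim => x) x j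
    rw [tensorMap_recast_left, tensorMap_recast_right]
    rfl

theorem fmap_id {C : Type*} [Category* C] (F : C ⥤ Type u) (c : C) (x : F.obj c) :
    F.map (𝟙 c) x = x := by simp

theorem fmap_comp {C : Type*} [Category* C] (F : C ⥤ Type u) {a b c : C} (f : a ⟶ b) (g : b ⟶ c)
    (x : F.obj a) : F.map (f ≫ g) x = F.map g (F.map f x) := by simp

theorem fmap_square {C : Type*} [Category* C] (F : C ⥤ Type u) {a b b' c : C} {f : a ⟶ b}
    {g : b ⟶ c} {f' : a ⟶ b'} {g' : b' ⟶ c} (h : f ≫ g = f' ≫ g') (x : F.obj a) :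
    F.map g (F.map f x) = F.map g' (F.map f' x) := by
  rw [← fmap_comp, h, fmap_comp]

/-- The category `□⁺`: the object `⟨[1]^n, false⟩` is `[1]^n`, and the object `⟨[1]^n, true⟩`
is `[1]^n_e`, which exists for `n ≥ 1`. -/
@[ext]
structure BoxPlus : Type where
  box : Box
  marked : Bool
  pos : marked = true → 1 ≤ box.dim

/-- Morphisms of `□⁺`, represented by their underlying maps of cubes. A map into `[1]^n_e` with
source some `[1]^m` is `φ` after a map of cubes. A map with source `[1]^m_e` is either an identity
or begins with some `ζ_i` or `ξ_{i,ε}`, and so its underlying map of cubes (its composite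
with the epimorphism `φ`) is either an identity or begins with some `σ_i` or `γ_{i,ε}`. -/
@[ext]
structure BoxPlus.Hom (a b : BoxPlus) : Type where
  map : a.box ⟶ b.box
  cond : a.marked = true → IsDegenerate map.map ∨ ∃ h : a = b, map = eqToHom (congrArg box h)

instance BoxPlus.category : Category BoxPlus where
  Hom := BoxPlus.Hom
  id a := ⟨𝟙 a.box, fun _ => .inr ⟨rfl, rfl⟩⟩
  comp {a b c} f g := ⟨f.map ≫ g.map, fun ha => by
    rcases f.cond ha with h | ⟨rfl, h⟩
    · exact .inl (h.comp g.map.isBoxMap)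
    · rcases g.cond ha with h' | ⟨rfl, h'⟩
      · rw [h]; exact .inl (by simpa using h')
      · exact .inr ⟨rfl, by rw [h, h']; simp⟩⟩
  id_comp f := BoxPlus.Hom.ext (Category.id_comp f.map)
  comp_id f := BoxPlus.Hom.ext (Category.comp_id f.map)
  assoc f g h := BoxPlus.Hom.ext (Category.assoc f.map g.map h.map)

/-- The object `[1]^n` of `□⁺`. -/
def BoxPlus.cube (a : Box) : BoxPlus := ⟨a, false, nofun⟩

/-- The object `[1]^n_e` of `□⁺`, for `n ≥ 1`. -/
def BoxPlus.mcube (a : Box) (h : 1 ≤ a.dim) : BoxPlus := ⟨a, true, fun _ => h⟩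

/-- The map `φ : [1]^n → [1]^n_e`. -/
def BoxPlus.phi (a : Box) (h : 1 ≤ a.dim) : BoxPlus.cube a ⟶ BoxPlus.mcube a h :=
  ⟨𝟙 a, nofun⟩

/-- The inclusion of `□` into `□⁺`. -/
def BoxPlus.incl : Box ⥤ BoxPlus where
  obj := BoxPlus.cube
  map f := ⟨f, nofun⟩

/-- Cubical sets, with the geometric product (Day convolution) as monoidal structure. -/
abbrev CSet : Type (u + 1) := DayFunctor Boxᵒᵖ (Type u)

/-- The cube `x ⊗ y` of the geometric product. -/
noncomputable def tens {X Y : CSet.{u}} {a b : Box} (x : X.functor.obj (op a))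
    (y : Y.functor.obj (op b)) : (X ⊗ Y).functor.obj (op (a ⊗ b)) :=
  (DayFunctor.η X Y).app (op a, op b) (x, y)

/-- Degenerate cubes of a cubical set: those of the form `w σ_i` or `w γ_{i,ε}`. -/
def CSet.IsDegenerateCube (X : CSet.{u}) {a : Box} (z : X.functor.obj (op a)) : Prop :=
  ∃ (b : Box) (f : a ⟶ b) (w : X.functor.obj (op b)), IsDegenerate f.map ∧ z = X.functor.map f.op w

/-- A structurally marked cubical set is marked if all the maps `φ^* : eX_n → X_n` are injective. -/
def isMarkedCubical : ObjectProperty (BoxPlusᵒᵖ ⥤ Type u) := fun X =>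
  ∀ (a : Box) (h : 1 ≤ a.dim), Function.Injective (X.map (BoxPlus.phi a h).op)

/-- The category `cSet⁺` of marked cubical sets, a full subcategory of the category of
structurally marked cubical sets. -/
abbrev MCSet : Type (u + 1) := isMarkedCubical.{u}.FullSubcategory

/-- The underlying cubical set functor `υ : cSet⁺ ⥤ cSet`. -/
def MCSet.forget : MCSet.{u} ⥤ CSet.{u} where
  obj X := ⟨BoxPlus.incl.op ⋙ X.obj⟩
  map f := ⟨Functor.whiskerLeft BoxPlus.incl.op f.hom⟩

/-- A cube is marked if it lies in the image of `φ^*`. -/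
def MCSet.IsMarked (X : MCSet.{u}) {a : Box} (z : (MCSet.forget.obj X).functor.obj (op a)) : Prop :=
  ∃ (h : 1 ≤ a.dim), z ∈ Set.range (X.obj.map (BoxPlus.phi a h).op)

/-- A set of cubes which contains the degenerate cubes, but no `0`-cubes. -/
structure CSet.Marking (K : CSet.{u}) where
  mem : ∀ {a : Box}, K.functor.obj (op a) → Prop
  deg : ∀ {a : Box} {z : K.functor.obj (op a)}, K.IsDegenerateCube z → mem z
  pos : ∀ {a : Box} {z : K.functor.obj (op a)}, mem z → 1 ≤ a.dim

/-- The marked cubical set with a given underlying cubical set and a given set of marked cubes. -/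
def MCSet.ofMarking (K : CSet.{u}) (M : K.Marking) : MCSet.{u} where
  obj :=
    { obj p := {z : K.functor.obj (op p.unop.box) // p.unop.marked = true → M.mem z}
      map {p q} f := ↾fun z => ⟨K.functor.map f.unop.map.op z.1, fun hq => by
        rcases f.unop.cond hq with h | ⟨h, h'⟩
        · exact M.deg ⟨_, f.unop.map, z.1, h, rfl⟩
        · obtain ⟨p⟩ := p
          obtain ⟨q⟩ := q
          cases h
          simp only [unop_op] at h'
          rw [h']
          simpa using z.2 hq⟩
      map_id p := by
        ext z
        exact ConcreteCategory.congr_hom (K.functor.map_id (op p.unop.box)) z.1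
      map_comp f g := by
        ext z
        exact ConcreteCategory.congr_hom
          (K.functor.map_comp f.unop.map.op g.unop.map.op) z.1 }
  property a h x y hxy := by
    have h1 := congrArg Subtype.val hxy
    exact Subtype.ext ((fmap_id K.functor (op a) x.1).symm.trans
      (h1.trans (fmap_id K.functor (op a) y.1)))

theorem BoxPlus.hom_ext {a b : BoxPlus} {f g : a ⟶ b} (h : f.map = g.map) : f = g :=
  BoxPlus.Hom.ext h

/-- The map to an object of `□⁺` from its underlying cube: an identity or `φ`. -/
def BoxPlus.psi (p : BoxPlus) : BoxPlus.cube p.box ⟶ p := ⟨𝟙 p.box, nofun⟩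

theorem BoxPlus.psi_naturality {p q : BoxPlus} (f : p ⟶ q) :
    BoxPlus.incl.map f.map ≫ BoxPlus.psi q = BoxPlus.psi p ≫ f :=
  BoxPlus.hom_ext ((Category.comp_id f.map).trans (Category.id_comp f.map).symm)

theorem MCSet.psi_injective (X : MCSet.{u}) (p : BoxPlus) :
    Function.Injective (X.obj.map (BoxPlus.psi p).op) := by
  obtain ⟨a, m, h⟩ := p
  cases m with
  | false =>
    intro x y hxy
    exact (fmap_id X.obj (op (BoxPlus.cube a)) x).symm.trans
      (hxy.trans (fmap_id X.obj (op (BoxPlus.cube a)) y))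
  | true => exact X.property a (h rfl)

theorem MCSet.psi_mem_range (X : MCSet.{u}) (p : BoxPlus)
    (z : (MCSet.forget.obj X).functor.obj (op p.box)) (hz : p.marked = true → X.IsMarked z) :
    z ∈ Set.range (X.obj.map (BoxPlus.psi p).op) := by
  obtain ⟨a, m, h⟩ := p
  cases m with
  | false =>
    exact ⟨z, fmap_id X.obj (op (BoxPlus.cube a)) z⟩
  | true => exact (hz rfl).2

theorem MCSet.isMarked_psi (X : MCSet.{u}) (p : BoxPlus) (hp : p.marked = true)
    (x : X.obj.obj (op p)) :
    X.IsMarked (a := p.box) (X.obj.map (BoxPlus.psi p).op x) := by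
  obtain ⟨a, m, h⟩ := p
  cases hp
  exact ⟨h rfl, x, rfl⟩

theorem MCSet.IsMarked.map {X Y : MCSet.{u}} (f : X ⟶ Y) {a : Box}
    {z : (MCSet.forget.obj X).functor.obj (op a)} (hz : X.IsMarked z) :
    Y.IsMarked ((MCSet.forget.map f).natTrans.app (op a) z) := by
  obtain ⟨h, y, rfl⟩ := hz
  exact ⟨h, f.hom.app _ y, (NatTrans.naturality_apply f.hom (BoxPlus.phi a h).op y).symm⟩

theorem MCSet.IsMarked.deg {X : MCSet.{u}} {a : Box}
    {z : (MCSet.forget.obj X).functor.obj (op a)}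
    (hz : (MCSet.forget.obj X).IsDegenerateCube z) : X.IsMarked z := by
  obtain ⟨b, f, w, hf, rfl⟩ := hz
  let g : BoxPlus.mcube a hf.pos ⟶ BoxPlus.cube b := ⟨f, fun _ => .inl hf⟩
  refine ⟨hf.pos, X.obj.map g.op w, ?_⟩
  have e : BoxPlus.incl.map f = BoxPlus.phi a hf.pos ≫ g :=
    BoxPlus.hom_ext (Category.id_comp f).symm
  refine (fmap_comp X.obj g.op (BoxPlus.phi a hf.pos).op w).symm.trans ?_
  rw [← op_comp, ← e]
  rfl

instance MCSet.forget_faithful : MCSet.forget.{u}.Faithful where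
  map_injective {X Y f g} h := by
    ext p x
    apply Y.psi_injective p.unop
    have h1 := NatTrans.naturality_apply f.hom (BoxPlus.psi p.unop).op x
    have h2 := NatTrans.naturality_apply g.hom (BoxPlus.psi p.unop).op x
    have h3 : (MCSet.forget.map f).natTrans.app (op p.unop.box) =
        (MCSet.forget.map g).natTrans.app (op p.unop.box) := by rw [h]
    exact h1.symm.trans ((ConcreteCategory.congr_hom h3 _).trans h2)

/-- Maps of marked cubical sets are maps of cubical sets which preserve marked cubes. -/
theorem MCSet.exists_lift {X Y : MCSet.{u}} (f : MCSet.forget.obj X ⟶ MCSet.forget.obj Y)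
    (hf : ∀ (a : Box) (z : (MCSet.forget.obj X).functor.obj (op a)), X.IsMarked z →
      Y.IsMarked (f.natTrans.app (op a) z)) : ∃ g : X ⟶ Y, MCSet.forget.map g = f := by
  have key (p : BoxPlusᵒᵖ) (x : X.obj.obj p) : ∃ y : Y.obj.obj p,
      Y.obj.map (BoxPlus.psi p.unop).op y =
        f.natTrans.app (op p.unop.box) (X.obj.map (BoxPlus.psi p.unop).op x) :=
    Y.psi_mem_range p.unop _ fun hp => hf _ _ (X.isMarked_psi p.unop hp x)
  choose F hF using key
  refine ⟨ObjectProperty.homMk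
    { app p := ↾(F p)
      naturality p q g := ?_ }, ?_⟩
  · ext x
    apply Y.psi_injective q.unop
    have hY (y : Y.obj.obj p) : Y.obj.map (BoxPlus.psi q.unop).op (Y.obj.map g y) =
        Y.obj.map (BoxPlus.incl.map g.unop.map).op (Y.obj.map (BoxPlus.psi p.unop).op y) :=
      fmap_square Y.obj (congrArg Quiver.Hom.op (BoxPlus.psi_naturality g.unop).symm) y
    have hX (y : X.obj.obj p) : X.obj.map (BoxPlus.psi q.unop).op (X.obj.map g y) =
        X.obj.map (BoxPlus.incl.map g.unop.map).op (X.obj.map (BoxPlus.psi p.unop).op y) :=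
      fmap_square X.obj (congrArg Quiver.Hom.op (BoxPlus.psi_naturality g.unop).symm) y
    refine (hF q (X.obj.map g x)).trans ?_
    rw [hX]
    refine (NatTrans.naturality_apply f.natTrans g.unop.map.op _).trans ?_
    refine Eq.trans ?_ (hY (F p x)).symm
    rw [hF]
    rfl
  · apply DayFunctor.hom_ext
    ext a x
    have h1 := hF (op (BoxPlus.cube a.unop)) x
    exact (fmap_id Y.obj (op (BoxPlus.cube a.unop)) _).symm.trans
      (h1.trans (congrArg _ (fmap_id X.obj (op (BoxPlus.cube a.unop)) x)))

/-- A lift of a map of cubical sets which preserves marked cubes. -/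
noncomputable def MCSet.lift {X Y : MCSet.{u}} (f : MCSet.forget.obj X ⟶ MCSet.forget.obj Y)
    (hf : ∀ (a : Box) (z : (MCSet.forget.obj X).functor.obj (op a)), X.IsMarked z →
      Y.IsMarked (f.natTrans.app (op a) z)) : X ⟶ Y :=
  (MCSet.exists_lift f hf).choose

@[simp]
theorem MCSet.forget_map_lift {X Y : MCSet.{u}} (f : MCSet.forget.obj X ⟶ MCSet.forget.obj Y)
    (hf : ∀ (a : Box) (z : (MCSet.forget.obj X).functor.obj (op a)), X.IsMarked z →
      Y.IsMarked (f.natTrans.app (op a) z)) : MCSet.forget.map (MCSet.lift f hf) = f :=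
  (MCSet.exists_lift f hf).choose_spec

/-- The underlying cubical set of `MCSet.ofMarking K M` is `K`. -/
def MCSet.forgetOfMarking (K : CSet.{u}) (M : K.Marking) :
    MCSet.forget.obj (MCSet.ofMarking K M) ≅ K where
  hom := ⟨{ app a := ↾fun z => z.1 }⟩
  inv := ⟨{ app a := ↾fun z => ⟨z, nofun⟩ }⟩

theorem MCSet.isMarked_ofMarking (K : CSet.{u}) (M : K.Marking) {a : Box}
    (z : (MCSet.forget.obj (MCSet.ofMarking K M)).functor.obj (op a)) :
    (MCSet.ofMarking K M).IsMarked z ↔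
      M.mem ((MCSet.forgetOfMarking K M).hom.natTrans.app (op a) z) := by
  constructor
  · rintro ⟨h, y, rfl⟩
    have h1 : K.functor.map (𝟙 (op a)) y.1 = y.1 := fmap_id K.functor (op a) y.1
    change M.mem (K.functor.map (𝟙 (op a)) y.1)
    rw [h1]
    exact y.2 rfl
  · intro h
    refine ⟨M.pos h, ⟨z.1, fun _ => h⟩, Subtype.ext (fmap_id K.functor (op a) z.1)⟩

theorem tens_map {X Y : CSet.{u}} {a a' b b' : Box} (f : a' ⟶ a) (g : b' ⟶ b)
    (x : X.functor.obj (op a)) (y : Y.functor.obj (op b)) :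
    (X ⊗ Y).functor.map (f ⊗ₘ g).op (tens x y) =
      tens (X.functor.map f.op x) (Y.functor.map g.op y) := by
  have h := (DayFunctor.η X Y).naturality (X := (op a, op b)) (Y := (op a', op b'))
    (f.op, g.op)
  exact (ConcreteCategory.congr_hom h
    (@Prod.mk (X.functor.obj (op a)) (Y.functor.obj (op b)) x y)).symm

theorem tens_hom {X X' Y Y' : CSet.{u}} (f : X ⟶ X') (g : Y ⟶ Y') {a b : Box}
    (x : X.functor.obj (op a)) (y : Y.functor.obj (op b)) :
    (f ⊗ₘ g).natTrans.app (op (a ⊗ b)) (tens x y) =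
      tens (f.natTrans.app (op a) x) (g.natTrans.app (op b) y) := by
  have h := LawfulDayConvolutionMonoidalCategoryStruct.convolutionExtensionUnit_comp_ι_map_tensorHom_app
      Boxᵒᵖ (Type u) f g (op a) (op b)
  exact ConcreteCategory.congr_hom h (@Prod.mk (X.functor.obj (op a)) (Y.functor.obj (op b)) x y)

theorem tens_assoc {X Y Z : CSet.{u}} {a b c : Box} (x : X.functor.obj (op a))
    (y : Y.functor.obj (op b)) (z : Z.functor.obj (op c)) :
    (α_ X Y Z).hom.natTrans.app (op ((a ⊗ b) ⊗ c)) (tens (tens x y) z) =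
      (X ⊗ Y ⊗ Z).functor.map (α_ a b c).hom.op (tens x (tens y z)) := by
  have h := LawfulDayConvolutionMonoidalCategoryStruct.associator_hom_unit_unit
      (Type u) X Y Z (op a) (op b) (op c)
  exact ConcreteCategory.congr_hom h
    (@Prod.mk (X.functor.obj (op a) × Y.functor.obj (op b)) (Z.functor.obj (op c)) (x, y) z)

/-- The canonical `0`-cube of the unit of the geometric product. -/
noncomputable def CSet.pt : (𝟙_ CSet.{u}).functor.obj (op (𝟙_ Box)) :=
  DayFunctor.ν Boxᵒᵖ (Type u) PUnit.unit

theorem tens_pt_left {X : CSet.{u}} {a : Box} (x : X.functor.obj (op a)) :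
    (λ_ X).hom.natTrans.app (op (𝟙_ Box ⊗ a)) (tens CSet.pt x) =
      X.functor.map (λ_ a).hom.op x := by
  have h := LawfulDayConvolutionMonoidalCategoryStruct.leftUnitor_hom_unit_app
      (Type u) X (op a)
  exact ConcreteCategory.congr_hom h (@Prod.mk PUnit (X.functor.obj (op a)) PUnit.unit x)

theorem tens_pt_right {X : CSet.{u}} {a : Box} (x : X.functor.obj (op a)) :
    (ρ_ X).hom.natTrans.app (op (a ⊗ 𝟙_ Box)) (tens x CSet.pt) =
      X.functor.map (ρ_ a).hom.op x := by
  have h := LawfulDayConvolutionMonoidalCategoryStruct.rightUnitor_hom_unit_app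
      (Type u) X (op a)
  exact ConcreteCategory.congr_hom h (@Prod.mk (X.functor.obj (op a)) PUnit x PUnit.unit)

theorem pt_surj {a : Box} (z : (𝟙_ CSet.{u}).functor.obj (op a)) :
    ∃ p : a ⟶ 𝟙_ Box, z = (𝟙_ CSet.{u}).functor.map p.op CSet.pt := by
  obtain ⟨j, x, hx⟩ := Types.jointly_surjective_of_isColimit
    (LawfulDayConvolutionMonoidalCategoryStruct.isPointwiseLeftKanExtensionUnitUnit
      Boxᵒᵖ (Type u) CSet.{u} (op a)) z
  exact ⟨j.hom.unop, hx.symm⟩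

theorem tens_surj' {X Y : CSet.{u}} {a : Box} (z : (X ⊗ Y).functor.obj (op a)) :
    ∃ (b c : Box) (f : a ⟶ b ⊗ c) (x : X.functor.obj (op b)) (y : Y.functor.obj (op c)),
      z = (X ⊗ Y).functor.map f.op (tens x y) := by
  obtain ⟨j, x, hx⟩ := Types.jointly_surjective_of_isColimit
    (LawfulDayConvolutionMonoidalCategoryStruct.isPointwiseLeftKanExtensionConvolutionExtensionUnit
      (C := Boxᵒᵖ) (V := Type u) X Y (op a)) z
  exact ⟨j.left.1.unop, j.left.2.unop, j.hom.unop, x.1, x.2, hx.symm⟩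

/-- The identification of `[1]^n` with `[1]^k ⊗ [1]^l` for `n = k + l`. -/
def Box.addIso {a b c : Box} (h : a.dim = b.dim + c.dim) : a ≅ b ⊗ c :=
  Box.castIso (a := a) (b := b ⊗ c) h

theorem tens_surj {X Y : CSet.{u}} {a : Box} (z : (X ⊗ Y).functor.obj (op a)) :
    ∃ (b c : Box) (h : a.dim = b.dim + c.dim) (x : X.functor.obj (op b))
      (y : Y.functor.obj (op c)),
      z = (X ⊗ Y).functor.map (Box.addIso h).hom.op (tens x y) := by
  obtain ⟨b, c, f, x, y, rfl⟩ := tens_surj' z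
  obtain ⟨k, l, h, f₁, f₂, hf₁, hf₂, hf⟩ := f.isBoxMap.split b.dim c.dim rfl
  let g₁ : Box.mk k ⟶ b := ⟨f₁, hf₁⟩
  let g₂ : Box.mk l ⟶ c := ⟨f₂, hf₂⟩
  refine ⟨⟨k⟩, ⟨l⟩, h, X.functor.map g₁.op x, Y.functor.map g₂.op y, ?_⟩
  have e : f = (Box.addIso (b := ⟨k⟩) (c := ⟨l⟩) h).hom ≫ (g₁ ⊗ₘ g₂) := Box.hom_ext hf
  rw [← tens_map, ← fmap_comp, ← op_comp, ← e]

/-- The marking of the pseudo Gray tensor product `X ⊛ Y` of marked cubical sets: a cube is marked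
if it can be written as `x ⊗ y` with `x` marked, or `y` marked, or both `x` and `y` of positive
dimension. Every degenerate cube is of this form. As a non-degenerate cube is `x ⊗ y`
for exactly one pair of cubes, it is unmarked exactly when one of `x`, `y` is a `0`-cube and the
other one is unmarked. -/
def MCSet.PseudoMarked (X Y : MCSet.{u}) {a : Box}
    (z : (MCSet.forget.obj X ⊗ MCSet.forget.obj Y).functor.obj (op a)) : Prop :=
  ∃ (b c : Box) (h : a.dim = b.dim + c.dim) (x : (MCSet.forget.obj X).functor.obj (op b))
    (y : (MCSet.forget.obj Y).functor.obj (op c)),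
    z = (MCSet.forget.obj X ⊗ MCSet.forget.obj Y).functor.map (Box.addIso h).hom.op (tens x y) ∧
      (X.IsMarked x ∨ Y.IsMarked y ∨ (1 ≤ b.dim ∧ 1 ≤ c.dim))

/-- The marked cubes of the pseudo Gray tensor product. -/
def MCSet.pseudoMarking (X Y : MCSet.{u}) :
    (MCSet.forget.obj X ⊗ MCSet.forget.obj Y).Marking where
  mem := X.PseudoMarked Y
  deg {a z} := by
    rintro ⟨a', f, w, hf, rfl⟩
    obtain ⟨b, c, h, x, y, rfl⟩ := tens_surj w
    obtain ⟨k, l, h', f₁, f₂, hf₁, hf₂, hd, hf⟩ := hf.split b.dim c.dim h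
    let g₁ : Box.mk k ⟶ b := ⟨f₁, hf₁⟩
    let g₂ : Box.mk l ⟶ c := ⟨f₂, hf₂⟩
    refine ⟨⟨k⟩, ⟨l⟩, h', (MCSet.forget.obj X).functor.map g₁.op x,
      (MCSet.forget.obj Y).functor.map g₂.op y, ?_, ?_⟩
    · have e : f ≫ (Box.addIso h).hom =
        (Box.addIso (b := ⟨k⟩) (c := ⟨l⟩) h').hom ≫ (g₁ ⊗ₘ g₂) := Box.hom_ext hf
      rw [← tens_map, ← fmap_comp, ← fmap_comp, ← op_comp, ← op_comp, ← e]
    · rcases hd with hd | hd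
      · exact .inl (.deg ⟨b, g₁, x, hd, rfl⟩)
      · exact .inr (.inl (.deg ⟨c, g₂, y, hd, rfl⟩))
  pos {a z} := by
    rintro ⟨b, c, h, x, y, rfl, ⟨h', _⟩ | ⟨h', _⟩ | ⟨h', _⟩⟩ <;> omega

/-- The minimal marking of a cubical set. -/
def CSet.minMarking (K : CSet.{u}) : K.Marking where
  mem z := K.IsDegenerateCube z
  deg h := h
  pos h := by
    obtain ⟨b, f, w, hf, rfl⟩ := h
    exact hf.pos

/-- The pseudo Gray tensor product of marked cubical sets. -/
noncomputable def MCSet.pseudo (X Y : MCSet.{u}) : MCSet.{u} :=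
  MCSet.ofMarking (MCSet.forget.obj X ⊗ MCSet.forget.obj Y) (X.pseudoMarking Y)

/-- The unit of the pseudo Gray tensor product: `□^0` with its minimal marking. -/
noncomputable def MCSet.unit : MCSet.{u} :=
  MCSet.ofMarking (𝟙_ CSet.{u}) (CSet.minMarking _)

/-- The underlying cubical set of the pseudo Gray tensor product is the geometric product. -/
noncomputable def MCSet.pseudoIso (X Y : MCSet.{u}) :
    MCSet.forget.obj X ⊗ MCSet.forget.obj Y ≅ MCSet.forget.obj (X.pseudo Y) :=
  (MCSet.forgetOfMarking _ _).symm

/-- The underlying cubical set of the unit is the unit of the geometric product. -/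
noncomputable def MCSet.unitIso : 𝟙_ CSet.{u} ≅ MCSet.forget.obj MCSet.unit.{u} :=
  (MCSet.forgetOfMarking _ _).symm

/-- The cube `x ⊗ y` of the pseudo Gray tensor product. -/
noncomputable def MCSet.ptens {X Y : MCSet.{u}} {a b : Box}
    (x : (MCSet.forget.obj X).functor.obj (op a)) (y : (MCSet.forget.obj Y).functor.obj (op b)) :
    (MCSet.forget.obj (X.pseudo Y)).functor.obj (op (a ⊗ b)) :=
  (MCSet.pseudoIso X Y).hom.natTrans.app _ (tens x y)

theorem MCSet.pseudoIso_inv_ptens {X Y : MCSet.{u}} {a b : Box}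
    (x : (MCSet.forget.obj X).functor.obj (op a)) (y : (MCSet.forget.obj Y).functor.obj (op b)) :
    (MCSet.pseudoIso X Y).inv.natTrans.app _ (MCSet.ptens x y) = tens x y := rfl

theorem MCSet.ptens_surj {X Y : MCSet.{u}} {a : Box}
    (z : (MCSet.forget.obj (X.pseudo Y)).functor.obj (op a)) :
    ∃ (b c : Box) (h : a.dim = b.dim + c.dim) (x : (MCSet.forget.obj X).functor.obj (op b))
      (y : (MCSet.forget.obj Y).functor.obj (op c)),
      z = (MCSet.forget.obj (X.pseudo Y)).functor.map (Box.addIso h).hom.op (MCSet.ptens x y) := by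
  obtain ⟨b, c, h, x, y, e⟩ := tens_surj ((MCSet.pseudoIso X Y).inv.natTrans.app _ z)
  refine ⟨b, c, h, x, y, ?_⟩
  exact Subtype.ext e

theorem MCSet.isMarked_ptens {X Y : MCSet.{u}} {a b : Box}
    {x : (MCSet.forget.obj X).functor.obj (op a)} {y : (MCSet.forget.obj Y).functor.obj (op b)}
    (h : X.IsMarked x ∨ Y.IsMarked y ∨ (1 ≤ a.dim ∧ 1 ≤ b.dim)) :
    (X.pseudo Y).IsMarked (MCSet.ptens x y) := by
  refine (MCSet.isMarked_ofMarking _ _ _).2 ⟨a, b, rfl, x, y, ?_, h⟩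
  exact (fmap_id (MCSet.forget.obj X ⊗ MCSet.forget.obj Y).functor _ _).symm

theorem MCSet.IsMarked.exists_ptens {X Y : MCSet.{u}} {a : Box}
    {z : (MCSet.forget.obj (X.pseudo Y)).functor.obj (op a)} (hz : (X.pseudo Y).IsMarked z) :
    ∃ (b c : Box) (h : a.dim = b.dim + c.dim) (x : (MCSet.forget.obj X).functor.obj (op b))
      (y : (MCSet.forget.obj Y).functor.obj (op c)),
      z = (MCSet.forget.obj (X.pseudo Y)).functor.map (Box.addIso h).hom.op (MCSet.ptens x y) ∧
      (X.IsMarked x ∨ Y.IsMarked y ∨ (1 ≤ b.dim ∧ 1 ≤ c.dim)) := by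
  obtain ⟨b, c, h, x, y, e, hxy⟩ := (MCSet.isMarked_ofMarking _ _ _).1 hz
  exact ⟨b, c, h, x, y, Subtype.ext e, hxy⟩

theorem MCSet.IsMarked.cast {X : MCSet.{u}} {a b : Box} (h : a.dim = b.dim)
    {z : (MCSet.forget.obj X).functor.obj (op b)} (hz : X.IsMarked z) :
    X.IsMarked ((MCSet.forget.obj X).functor.map (Box.castIso h).hom.op z) := by
  obtain ⟨a⟩ := a
  obtain ⟨b⟩ := b
  cases h
  exact (fmap_id (MCSet.forget.obj X).functor _ z).symm ▸ hz

theorem MCSet.preserves_of_ptens {X Y W : MCSet.{u}}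
    (f : MCSet.forget.obj (X.pseudo Y) ⟶ MCSet.forget.obj W)
    (hf : ∀ (a b : Box) (x : (MCSet.forget.obj X).functor.obj (op a))
      (y : (MCSet.forget.obj Y).functor.obj (op b)),
      X.IsMarked x ∨ Y.IsMarked y ∨ (1 ≤ a.dim ∧ 1 ≤ b.dim) →
        W.IsMarked (f.natTrans.app _ (MCSet.ptens x y)))
    (a : Box) (z : (MCSet.forget.obj (X.pseudo Y)).functor.obj (op a))
    (hz : (X.pseudo Y).IsMarked z) : W.IsMarked (f.natTrans.app (op a) z) := by
  obtain ⟨b, c, h, x, y, rfl, hxy⟩ := hz.exists_ptens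
  rw [NatTrans.naturality_apply]
  exact (hf b c x y hxy).cast (b := b ⊗ c) h

/-- Lift of an isomorphism of cubical sets which preserves marked cubes in both directions. -/
noncomputable def MCSet.liftIso {X Y : MCSet.{u}} (e : MCSet.forget.obj X ≅ MCSet.forget.obj Y)
    (h : ∀ (a : Box) (z : (MCSet.forget.obj X).functor.obj (op a)), X.IsMarked z →
      Y.IsMarked (e.hom.natTrans.app (op a) z))
    (h' : ∀ (a : Box) (z : (MCSet.forget.obj Y).functor.obj (op a)), Y.IsMarked z →
      X.IsMarked (e.inv.natTrans.app (op a) z)) : X ≅ Y where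
  hom := MCSet.lift e.hom h
  inv := MCSet.lift e.inv h'
  hom_inv_id := MCSet.forget.map_injective (by simp)
  inv_hom_id := MCSet.forget.map_injective (by simp)

/-- The pseudo Gray tensor product of maps. -/
noncomputable def MCSet.pseudoMap {X X' Y Y' : MCSet.{u}} (f : X ⟶ X') (g : Y ⟶ Y') :
    X.pseudo Y ⟶ X'.pseudo Y' :=
  MCSet.lift ((MCSet.pseudoIso X Y).inv ≫ (MCSet.forget.map f ⊗ₘ MCSet.forget.map g) ≫
      (MCSet.pseudoIso X' Y').hom) (MCSet.preserves_of_ptens _ fun a b x y h => by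
    have e : ((MCSet.pseudoIso X Y).inv ≫ (MCSet.forget.map f ⊗ₘ MCSet.forget.map g) ≫
        (MCSet.pseudoIso X' Y').hom).natTrans.app _ (MCSet.ptens x y) =
        MCSet.ptens ((MCSet.forget.map f).natTrans.app _ x)
          ((MCSet.forget.map g).natTrans.app _ y) :=
      congrArg ((MCSet.pseudoIso X' Y').hom.natTrans.app _) (tens_hom _ _ x y)
    rw [e]
    exact MCSet.isMarked_ptens (h.imp (.map f) (.imp (.map g) id)))

theorem MCSet.forall_ptens {X Y : MCSet.{u}}
    {P : ∀ (a : Box) (_ : (MCSet.forget.obj (X.pseudo Y)).functor.obj (op a)), Prop}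
    (H : ∀ (b c : Box) (x : (MCSet.forget.obj X).functor.obj (op b))
      (y : (MCSet.forget.obj Y).functor.obj (op c)), P (b ⊗ c) (MCSet.ptens x y))
    (a : Box) (w : (MCSet.forget.obj (X.pseudo Y)).functor.obj (op a)) : P a w := by
  obtain ⟨b, c, h, x, y, rfl⟩ := MCSet.ptens_surj w
  obtain ⟨d⟩ := a
  cases h
  have e := fmap_id (MCSet.forget.obj (X.pseudo Y)).functor _ (MCSet.ptens x y)
  exact e.symm ▸ H b c x y

theorem MCSet.forall_marked_ptens {X Y : MCSet.{u}}
    {P : ∀ (a : Box) (_ : (MCSet.forget.obj (X.pseudo Y)).functor.obj (op a)), Prop}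
    (H : ∀ (b c : Box) (x : (MCSet.forget.obj X).functor.obj (op b))
      (y : (MCSet.forget.obj Y).functor.obj (op c)),
      (X.IsMarked x ∨ Y.IsMarked y ∨ (1 ≤ b.dim ∧ 1 ≤ c.dim)) → P (b ⊗ c) (MCSet.ptens x y))
    (a : Box) (w : (MCSet.forget.obj (X.pseudo Y)).functor.obj (op a))
    (hw : (X.pseudo Y).IsMarked w) : P a w := by
  obtain ⟨b, c, h, x, y, rfl, hxy⟩ := hw.exists_ptens
  obtain ⟨d⟩ := a
  cases h
  have e := fmap_id (MCSet.forget.obj (X.pseudo Y)).functor _ (MCSet.ptens x y)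
  exact e.symm ▸ H b c x y hxy

theorem MCSet.ptens_map {X Y : MCSet.{u}} {a a' b b' : Box} (f : a' ⟶ a) (g : b' ⟶ b)
    (x : (MCSet.forget.obj X).functor.obj (op a)) (y : (MCSet.forget.obj Y).functor.obj (op b)) :
    (MCSet.forget.obj (X.pseudo Y)).functor.map (f ⊗ₘ g).op (MCSet.ptens x y) =
      MCSet.ptens ((MCSet.forget.obj X).functor.map f.op x)
        ((MCSet.forget.obj Y).functor.map g.op y) := by
  have h := NatTrans.naturality_apply (MCSet.pseudoIso X Y).hom.natTrans (f ⊗ₘ g).op (tens x y)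
  rw [tens_map] at h
  exact h.symm

theorem MCSet.inv_of_hom {X Y : MCSet.{u}} (e : MCSet.forget.obj X ≅ MCSet.forget.obj Y)
    {p q : Box} (i : p ≅ q) (s : (MCSet.forget.obj X).functor.obj (op p))
    (t : (MCSet.forget.obj Y).functor.obj (op q))
    (h : e.hom.natTrans.app _ s = (MCSet.forget.obj Y).functor.map i.hom.op t) :
    e.inv.natTrans.app _ t = (MCSet.forget.obj X).functor.map i.inv.op s := by
  have h1 : (MCSet.forget.obj Y).functor.map i.inv.op (e.hom.natTrans.app _ s) = t := by
    rw [h, ← fmap_comp, ← op_comp, Iso.inv_hom_id]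
    exact fmap_id (MCSet.forget.obj Y).functor _ _
  rw [← h1, ← NatTrans.naturality_apply]
  have := congrArg (fun k => k.natTrans.app (op q)) e.hom_inv_id
  exact ConcreteCategory.congr_hom this _

/-- The underlying isomorphism of the associator. -/
noncomputable def MCSet.assocIso (X Y Z : MCSet.{u}) :
    MCSet.forget.obj ((X.pseudo Y).pseudo Z) ≅ MCSet.forget.obj (X.pseudo (Y.pseudo Z)) :=
  ((MCSet.pseudoIso _ _).symm ≪≫ ((MCSet.pseudoIso _ _).symm ⊗ᵢ .refl _))
        ≪≫ α_ (MCSet.forget.obj X) (MCSet.forget.obj Y) (MCSet.forget.obj Z)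
        ≪≫ ((.refl _ ⊗ᵢ MCSet.pseudoIso _ _) ≪≫ MCSet.pseudoIso _ _)

theorem MCSet.assocIso_hom_ptens {X Y Z : MCSet.{u}} {a b c : Box}
    (x : (MCSet.forget.obj X).functor.obj (op a)) (y : (MCSet.forget.obj Y).functor.obj (op b))
    (z : (MCSet.forget.obj Z).functor.obj (op c)) :
    (MCSet.assocIso X Y Z).hom.natTrans.app _ (MCSet.ptens (MCSet.ptens x y) z) =
      (MCSet.forget.obj (X.pseudo (Y.pseudo Z))).functor.map (α_ a b c).hom.op
        (MCSet.ptens x (MCSet.ptens y z)) := by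
  have e1 := tens_hom (MCSet.pseudoIso X Y).inv (𝟙 (MCSet.forget.obj Z)) (MCSet.ptens x y) z
  have e2 := tens_assoc x y z
  have e3 := tens_hom (𝟙 (MCSet.forget.obj X)) (MCSet.pseudoIso Y Z).hom x (tens y z)
  have e4 := NatTrans.naturality_apply ((𝟙 (MCSet.forget.obj X)) ⊗ₘ
    (MCSet.pseudoIso Y Z).hom).natTrans (α_ a b c).hom.op (tens x (tens y z))
  have e5 := NatTrans.naturality_apply (MCSet.pseudoIso X (Y.pseudo Z)).hom.natTrans
    (α_ a b c).hom.op (tens x (MCSet.ptens y z))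
  refine Eq.trans ?_ e5
  refine congrArg ((MCSet.pseudoIso X (Y.pseudo Z)).hom.natTrans.app _) ?_
  refine Eq.trans ?_ (e4.trans (congrArg _ e3))
  refine congrArg (((𝟙 (MCSet.forget.obj X)) ⊗ₘ (MCSet.pseudoIso Y Z).hom).natTrans.app _) ?_
  refine Eq.trans ?_ e2
  exact congrArg ((α_ (MCSet.forget.obj X) (MCSet.forget.obj Y)
    (MCSet.forget.obj Z)).hom.natTrans.app _) e1

theorem MCSet.assocIso_inv_ptens {X Y Z : MCSet.{u}} {a b c : Box}
    (x : (MCSet.forget.obj X).functor.obj (op a)) (y : (MCSet.forget.obj Y).functor.obj (op b))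
    (z : (MCSet.forget.obj Z).functor.obj (op c)) :
    (MCSet.assocIso X Y Z).inv.natTrans.app _ (MCSet.ptens x (MCSet.ptens y z)) =
      (MCSet.forget.obj ((X.pseudo Y).pseudo Z)).functor.map (α_ a b c).inv.op
        (MCSet.ptens (MCSet.ptens x y) z) := by
  exact MCSet.inv_of_hom (MCSet.assocIso X Y Z) (α_ a b c) _ _ (MCSet.assocIso_hom_ptens x y z)

theorem MCSet.isMarked_ptens_right {X Y Z : MCSet.{u}} {a b c : Box}
    {x : (MCSet.forget.obj X).functor.obj (op a)} {y : (MCSet.forget.obj Y).functor.obj (op b)}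
    {z : (MCSet.forget.obj Z).functor.obj (op c)}
    (h : X.IsMarked x ∨ Y.IsMarked y ∨ Z.IsMarked z ∨ (1 ≤ a.dim ∧ 1 ≤ b.dim) ∨
      (1 ≤ a.dim ∧ 1 ≤ c.dim) ∨ (1 ≤ b.dim ∧ 1 ≤ c.dim)) :
    (X.pseudo (Y.pseudo Z)).IsMarked (MCSet.ptens x (MCSet.ptens y z)) := by
  have hd : (b ⊗ c).dim = b.dim + c.dim := rfl
  rcases h with h | h | h | h | h | h
  · exact MCSet.isMarked_ptens (.inl h)
  · exact MCSet.isMarked_ptens (.inr (.inl (MCSet.isMarked_ptens (.inl h))))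
  · exact MCSet.isMarked_ptens (.inr (.inl (MCSet.isMarked_ptens (.inr (.inl h)))))
  · exact MCSet.isMarked_ptens (.inr (.inr ⟨h.1, by omega⟩))
  · exact MCSet.isMarked_ptens (.inr (.inr ⟨h.1, by omega⟩))
  · exact MCSet.isMarked_ptens (.inr (.inl (MCSet.isMarked_ptens (.inr (.inr h)))))

theorem MCSet.isMarked_ptens_left {X Y Z : MCSet.{u}} {a b c : Box}
    {x : (MCSet.forget.obj X).functor.obj (op a)} {y : (MCSet.forget.obj Y).functor.obj (op b)}
    {z : (MCSet.forget.obj Z).functor.obj (op c)}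
    (h : X.IsMarked x ∨ Y.IsMarked y ∨ Z.IsMarked z ∨ (1 ≤ a.dim ∧ 1 ≤ b.dim) ∨
      (1 ≤ a.dim ∧ 1 ≤ c.dim) ∨ (1 ≤ b.dim ∧ 1 ≤ c.dim)) :
    ((X.pseudo Y).pseudo Z).IsMarked (MCSet.ptens (MCSet.ptens x y) z) := by
  have hd : (a ⊗ b).dim = a.dim + b.dim := rfl
  rcases h with h | h | h | h | h | h
  · exact MCSet.isMarked_ptens (.inl (MCSet.isMarked_ptens (.inl h)))
  · exact MCSet.isMarked_ptens (.inl (MCSet.isMarked_ptens (.inr (.inl h))))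
  · exact MCSet.isMarked_ptens (.inr (.inl h))
  · exact MCSet.isMarked_ptens (.inl (MCSet.isMarked_ptens (.inr (.inr h))))
  · exact MCSet.isMarked_ptens (.inr (.inr ⟨by omega, h.2⟩))
  · exact MCSet.isMarked_ptens (.inr (.inr ⟨by omega, h.2⟩))

/-- The associator of the pseudo Gray tensor product. -/
noncomputable def MCSet.assoc (X Y Z : MCSet.{u}) :
    (X.pseudo Y).pseudo Z ≅ X.pseudo (Y.pseudo Z) :=
  MCSet.liftIso (MCSet.assocIso X Y Z)
    (MCSet.preserves_of_ptens _ fun d c w z h => by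
      rcases h with h | h | h
      · revert d w
        refine MCSet.forall_marked_ptens fun a b x y h => ?_
        rw [MCSet.assocIso_hom_ptens]
        refine MCSet.IsMarked.cast (Nat.add_assoc a.dim b.dim c.dim)
          (MCSet.isMarked_ptens_right ?_)
        tauto
      · revert d w
        refine MCSet.forall_ptens fun a b x y => ?_
        rw [MCSet.assocIso_hom_ptens]
        refine MCSet.IsMarked.cast (Nat.add_assoc a.dim b.dim c.dim)
          (MCSet.isMarked_ptens_right ?_)
        tauto
      · revert d w
        refine MCSet.forall_ptens fun a b x y h => ?_
        rw [MCSet.assocIso_hom_ptens]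
        refine MCSet.IsMarked.cast (Nat.add_assoc a.dim b.dim c.dim)
          (MCSet.isMarked_ptens_right ?_)
        have hd : (a ⊗ b).dim = a.dim + b.dim := rfl
        have : 1 ≤ a.dim ∨ 1 ≤ b.dim := by omega
        tauto)
    (MCSet.preserves_of_ptens _ fun a d x w h => by
      rcases h with h | h | h
      · revert d w
        refine MCSet.forall_ptens fun b c y z => ?_
        rw [MCSet.assocIso_inv_ptens]
        refine MCSet.IsMarked.cast (Nat.add_assoc a.dim b.dim c.dim).symm
          (MCSet.isMarked_ptens_left ?_)
        tauto
      · revert d w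
        refine MCSet.forall_marked_ptens fun b c y z h => ?_
        rw [MCSet.assocIso_inv_ptens]
        refine MCSet.IsMarked.cast (Nat.add_assoc a.dim b.dim c.dim).symm
          (MCSet.isMarked_ptens_left ?_)
        tauto
      · revert d w
        refine MCSet.forall_ptens fun b c y z h => ?_
        rw [MCSet.assocIso_inv_ptens]
        refine MCSet.IsMarked.cast (Nat.add_assoc a.dim b.dim c.dim).symm
          (MCSet.isMarked_ptens_left ?_)
        have hd : (b ⊗ c).dim = b.dim + c.dim := rfl
        have : 1 ≤ b.dim ∨ 1 ≤ c.dim := by omega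
        tauto)

/-- The `0`-cube of the unit. -/
noncomputable def MCSet.pt : (MCSet.forget.obj MCSet.unit.{u}).functor.obj (op (𝟙_ Box)) :=
  MCSet.unitIso.hom.natTrans.app _ CSet.pt

theorem MCSet.exists_pt {a : Box} (w : (MCSet.forget.obj MCSet.unit.{u}).functor.obj (op a)) :
    ∃ p : a ⟶ 𝟙_ Box, w = (MCSet.forget.obj MCSet.unit).functor.map p.op MCSet.pt := by
  obtain ⟨p, hp⟩ := pt_surj (MCSet.unitIso.inv.natTrans.app _ w)
  refine ⟨p, ?_⟩
  have h := NatTrans.naturality_apply MCSet.unitIso.hom.natTrans p.op CSet.pt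
  rw [← hp] at h
  exact h

theorem MCSet.IsMarked.pos {X : MCSet.{u}} {a : Box}
    {z : (MCSet.forget.obj X).functor.obj (op a)} (h : X.IsMarked z) : 1 ≤ a.dim := h.1

/-- The underlying isomorphism of the left unitor. -/
noncomputable def MCSet.leftIso (X : MCSet.{u}) :
    MCSet.forget.obj (MCSet.unit.pseudo X) ≅ MCSet.forget.obj X :=
  ((MCSet.pseudoIso _ _).symm ≪≫ (MCSet.unitIso.symm ⊗ᵢ .refl _)) ≪≫ λ_ (MCSet.forget.obj X)

/-- The underlying isomorphism of the right unitor. -/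
noncomputable def MCSet.rightIso (X : MCSet.{u}) :
    MCSet.forget.obj (X.pseudo MCSet.unit) ≅ MCSet.forget.obj X :=
  ((MCSet.pseudoIso _ _).symm ≪≫ (.refl _ ⊗ᵢ MCSet.unitIso.symm)) ≪≫ ρ_ (MCSet.forget.obj X)

theorem MCSet.leftIso_hom_pt {X : MCSet.{u}} {a : Box}
    (x : (MCSet.forget.obj X).functor.obj (op a)) :
    (MCSet.leftIso X).hom.natTrans.app _ (MCSet.ptens MCSet.pt x) =
      (MCSet.forget.obj X).functor.map (λ_ a).hom.op x := by
  have e1 := tens_hom MCSet.unitIso.inv (𝟙 (MCSet.forget.obj X)) MCSet.pt x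
  exact (congrArg ((λ_ (MCSet.forget.obj X)).hom.natTrans.app _) e1).trans (tens_pt_left x)

theorem MCSet.rightIso_hom_pt {X : MCSet.{u}} {a : Box}
    (x : (MCSet.forget.obj X).functor.obj (op a)) :
    (MCSet.rightIso X).hom.natTrans.app _ (MCSet.ptens x MCSet.pt) =
      (MCSet.forget.obj X).functor.map (ρ_ a).hom.op x := by
  have e1 := tens_hom (𝟙 (MCSet.forget.obj X)) MCSet.unitIso.inv x MCSet.pt
  exact (congrArg ((ρ_ (MCSet.forget.obj X)).hom.natTrans.app _) e1).trans (tens_pt_right x)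

theorem MCSet.leftIso_inv {X : MCSet.{u}} {a : Box}
    (x : (MCSet.forget.obj X).functor.obj (op a)) :
    (MCSet.leftIso X).inv.natTrans.app _ x =
      (MCSet.forget.obj (MCSet.unit.pseudo X)).functor.map (λ_ a).inv.op
        (MCSet.ptens MCSet.pt x) := by
  exact MCSet.inv_of_hom (MCSet.leftIso X) (λ_ a) _ _ (MCSet.leftIso_hom_pt x)

theorem MCSet.rightIso_inv {X : MCSet.{u}} {a : Box}
    (x : (MCSet.forget.obj X).functor.obj (op a)) :
    (MCSet.rightIso X).inv.natTrans.app _ x =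
      (MCSet.forget.obj (X.pseudo MCSet.unit)).functor.map (ρ_ a).inv.op
        (MCSet.ptens x MCSet.pt) := by
  exact MCSet.inv_of_hom (MCSet.rightIso X) (ρ_ a) _ _ (MCSet.rightIso_hom_pt x)

theorem MCSet.leftIso_hom {X : MCSet.{u}} {a b : Box} (p : b ⟶ 𝟙_ Box)
    (x : (MCSet.forget.obj X).functor.obj (op a)) :
    (MCSet.leftIso X).hom.natTrans.app _
        (MCSet.ptens ((MCSet.forget.obj MCSet.unit).functor.map p.op MCSet.pt) x) =
      (MCSet.forget.obj X).functor.map ((p ⊗ₘ 𝟙 a) ≫ (λ_ a).hom).op x := by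
  have h := MCSet.ptens_map p (𝟙 a) MCSet.pt x
  rw [show (MCSet.forget.obj X).functor.map (𝟙 a).op x = x from fmap_id _ _ x] at h
  rw [← h, NatTrans.naturality_apply, MCSet.leftIso_hom_pt, ← fmap_comp, op_comp]

theorem MCSet.rightIso_hom {X : MCSet.{u}} {a b : Box} (p : b ⟶ 𝟙_ Box)
    (x : (MCSet.forget.obj X).functor.obj (op a)) :
    (MCSet.rightIso X).hom.natTrans.app _
        (MCSet.ptens x ((MCSet.forget.obj MCSet.unit).functor.map p.op MCSet.pt)) =
      (MCSet.forget.obj X).functor.map ((𝟙 a ⊗ₘ p) ≫ (ρ_ a).hom).op x := by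
  have h := MCSet.ptens_map (𝟙 a) p x MCSet.pt
  rw [show (MCSet.forget.obj X).functor.map (𝟙 a).op x = x from fmap_id _ _ x] at h
  rw [← h, NatTrans.naturality_apply, MCSet.rightIso_hom_pt, ← fmap_comp, op_comp]

theorem Box.end_unit (p : 𝟙_ Box ⟶ 𝟙_ Box) : p = 𝟙 (𝟙_ Box) := by
  ext x i
  exact i.elim0

/-- The left unitor of the pseudo Gray tensor product. -/
noncomputable def MCSet.left (X : MCSet.{u}) : MCSet.unit.pseudo X ≅ X :=
  MCSet.liftIso (MCSet.leftIso X)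
    (MCSet.preserves_of_ptens _ fun b a w x h => by
      obtain ⟨p, hp⟩ := MCSet.exists_pt w
      rw [hp, MCSet.leftIso_hom]
      by_cases hb : 1 ≤ b.dim
      · refine .deg ⟨_, _, x, ?_, rfl⟩
        exact ((IsDegenerate.const p.map hb).tensor_left (𝟙 a : a ⟶ a).isBoxMap).comp
          (λ_ a).hom.isBoxMap
      · have hx : X.IsMarked x := by
          rcases h with h | h | h
          · exact absurd h.pos hb
          · exact h
          · exact absurd h.1 hb
        obtain ⟨b⟩ := b
        obtain rfl : b = 0 := by simpa using hb
        have e : ((p : 𝟙_ Box ⟶ 𝟙_ Box) ⊗ₘ 𝟙 a) = 𝟙 (𝟙_ Box ⊗ a) := by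
          rw [Box.end_unit p]
          exact id_tensorHom_id _ _
        refine (congrArg (fun k : 𝟙_ Box ⊗ a ⟶ 𝟙_ Box ⊗ a => X.IsMarked
          ((MCSet.forget.obj X).functor.map (k ≫ (λ_ a).hom).op x)) e).mpr ?_
        rw [Category.id_comp]
        exact hx.cast (Nat.zero_add a.dim))
    fun a x hx => by
      rw [MCSet.leftIso_inv]
      exact MCSet.IsMarked.cast (Nat.zero_add a.dim).symm (MCSet.isMarked_ptens (.inr (.inl hx)))

/-- The right unitor of the pseudo Gray tensor product. -/
noncomputable def MCSet.right (X : MCSet.{u}) : X.pseudo MCSet.unit ≅ X :=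
  MCSet.liftIso (MCSet.rightIso X)
    (MCSet.preserves_of_ptens _ fun a b x w h => by
      obtain ⟨p, hp⟩ := MCSet.exists_pt w
      rw [hp, MCSet.rightIso_hom]
      by_cases hb : 1 ≤ b.dim
      · refine .deg ⟨_, _, x, ?_, rfl⟩
        exact (IsDegenerate.tensor_right (𝟙 a : a ⟶ a).isBoxMap
          (IsDegenerate.const p.map hb)).comp (ρ_ a).hom.isBoxMap
      · have hx : X.IsMarked x := by
          rcases h with h | h | h
          · exact h
          · exact absurd h.pos hb
          · exact absurd h.2 hb
        obtain ⟨b⟩ := b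
        obtain rfl : b = 0 := by simpa using hb
        have e : (𝟙 a ⊗ₘ (p : 𝟙_ Box ⟶ 𝟙_ Box)) = 𝟙 (a ⊗ 𝟙_ Box) := by
          rw [Box.end_unit p]
          exact id_tensorHom_id _ _
        refine (congrArg (fun k : a ⊗ 𝟙_ Box ⟶ a ⊗ 𝟙_ Box => X.IsMarked
          ((MCSet.forget.obj X).functor.map (k ≫ (ρ_ a).hom).op x)) e).mpr ?_
        rw [Category.id_comp]
        exact hx.cast (Nat.add_zero a.dim))
    fun a x hx => by
      rw [MCSet.rightIso_inv]
      exact MCSet.IsMarked.cast (Nat.add_zero a.dim).symm (MCSet.isMarked_ptens (.inl hx))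

theorem MCSet.forget_map_pseudoMap {X X' Y Y' : MCSet.{u}} (f : X ⟶ X') (g : Y ⟶ Y') :
    MCSet.forget.map (MCSet.pseudoMap f g) = (MCSet.pseudoIso X Y).inv ≫
      (MCSet.forget.map f ⊗ₘ MCSet.forget.map g) ≫ (MCSet.pseudoIso X' Y').hom :=
  MCSet.forget_map_lift _ _

theorem MCSet.forget_map_liftIso {X Y : MCSet.{u}} (e : MCSet.forget.obj X ≅ MCSet.forget.obj Y)
    (h) (h') : MCSet.forget.map (MCSet.liftIso e h h').hom = e.hom :=
  MCSet.forget_map_lift e.hom h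

noncomputable instance MCSet.monoidalCategoryStruct : MonoidalCategoryStruct MCSet.{u} where
  tensorObj := MCSet.pseudo
  tensorHom f g := MCSet.pseudoMap f g
  whiskerLeft X _ _ f := MCSet.pseudoMap (𝟙 X) f
  whiskerRight f Y := MCSet.pseudoMap f (𝟙 Y)
  tensorUnit := MCSet.unit
  associator := MCSet.assoc
  leftUnitor := MCSet.left
  rightUnitor := MCSet.right

/-- The pseudo Gray monoidal structure lifts the geometric product along `υ`. -/
noncomputable def MCSet.inducing : Monoidal.InducingFunctorData MCSet.forget.{u} where
  μIso := MCSet.pseudoIso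
  εIso := MCSet.unitIso
  whiskerLeft_eq X _ _ f := (MCSet.forget_map_pseudoMap (𝟙 X) f).trans (by simp)
  whiskerRight_eq f Y := (MCSet.forget_map_pseudoMap f (𝟙 Y)).trans (by simp)
  tensorHom_eq f g := MCSet.forget_map_pseudoMap f g
  associator_eq X Y Z := MCSet.forget_map_liftIso (MCSet.assocIso X Y Z) _ _
  leftUnitor_eq X := MCSet.forget_map_liftIso (MCSet.leftIso X) _ _
  rightUnitor_eq X := MCSet.forget_map_liftIso (MCSet.rightIso X) _ _

/-- The pseudo Gray monoidal structure on marked cubical sets. -/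
noncomputable instance MCSet.monoidalCategory : MonoidalCategory MCSet.{u} :=
  Monoidal.induced MCSet.forget MCSet.inducing

section Simplicial

open scoped Simplicial

/-- A marked simplicial set: a simplicial set with a set of marked simplices, which contains all
degenerate simplices and no `0`-simplices. -/
structure MSSet : Type (u + 1) where
  toSSet : SSet.{u}
  marked (n : ℕ) : Set (toSSet _⦋n⦌)
  zero (x : toSSet _⦋0⦌) : x ∉ marked 0
  degenerate_le (n : ℕ) : toSSet.degenerate n ⊆ marked n

/-- A map of marked simplicial sets. -/
@[ext]
structure MSSet.Hom (X Y : MSSet.{u}) : Type u where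
  map : X.toSSet ⟶ Y.toSSet
  preserves (n : ℕ) (x : X.toSSet _⦋n⦌) : x ∈ X.marked n → map.app (op ⦋n⦌) x ∈ Y.marked n

instance MSSet.category : Category MSSet.{u} where
  Hom := MSSet.Hom
  id X := ⟨𝟙 _, fun _ _ h => h⟩
  comp f g := ⟨f.map ≫ g.map, fun n x h => g.preserves n _ (f.preserves n x h)⟩
  id_comp f := MSSet.Hom.ext (Category.id_comp f.map)
  comp_id f := MSSet.Hom.ext (Category.comp_id f.map)
  assoc f g h := MSSet.Hom.ext (Category.assoc f.map g.map h.map)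

theorem MSSet.hom_ext {X Y : MSSet.{u}} {f g : X ⟶ Y} (h : f.map = g.map) : f = g :=
  MSSet.Hom.ext h

/-- The functor which forgets the marking. -/
def MSSet.forget : MSSet.{u} ⥤ SSet.{u} where
  obj X := X.toSSet
  map f := f.map

/-- A simplicial set with its minimal marking. -/
def MSSet.flat (K : SSet.{u}) : MSSet.{u} where
  toSSet := K
  marked n := K.degenerate n
  zero x := by simp
  degenerate_le n := le_rfl

/-- The marked simplicial set obtained from `X` by marking all simplices of dimension at
least `d` (and at least `1`). This is `tr_{d - 1} X`. -/
def MSSet.markFrom (d : ℕ) (X : MSSet.{u}) : MSSet.{u} where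
  toSSet := X.toSSet
  marked n := {x | x ∈ X.marked n ∨ (1 ≤ n ∧ d ≤ n)}
  zero x := by
    rintro (h | h)
    · exact X.zero x h
    · exact absurd h.1 (by omega)
  degenerate_le n x hx := .inl (X.degenerate_le n hx)

/-- The `k`-complicial `n`-simplex `Δ^k[n]`: a non-degenerate simplex is marked if it contains
all the points of `{k - 1, k, k + 1} ∩ [n]`. -/
def MSSet.complicialSimplex (n : ℕ) (k : Fin (n + 1)) : MSSet.{u} where
  toSSet := Δ[n]
  marked m := {x | x ∈ Δ[n].degenerate m ∨
    (1 ≤ m ∧ ∀ i : Fin (n + 1), i.val + 1 = k.val ∨ i.val = k.val ∨ i.val = k.val + 1 →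
      i ∈ Set.range x)}
  zero x := by
    rintro (h | h)
    · simp at h
    · exact absurd h.1 (by omega)
  degenerate_le n x hx := .inl hx

/-- The marked simplicial set `Δ^k[n]′`, obtained from `Δ^k[n]` by replacing the marking of the
horn `Λ^k[n]` by that of `tr_{n - 2} Λ^k[n]`. -/
def MSSet.complicialSimplexPrime (n : ℕ) (k : Fin (n + 1)) : MSSet.{u} where
  toSSet := Δ[n]
  marked m := {x | x ∈ (MSSet.complicialSimplex n k).marked m ∨
    (x ∈ (SSet.horn n k).obj (op ⦋m⦌) ∧ 1 ≤ m ∧ n ≤ m + 1)}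
  zero x := by
    rintro (h | h)
    · exact (MSSet.complicialSimplex n k).zero x h
    · exact absurd h.2.1 (by omega)
  degenerate_le n x hx := .inl (.inl hx)

/-- The marked simplicial set `Δ^k[n]″ = tr_{n - 2} Δ^k[n]`. -/
def MSSet.complicialSimplexDoublePrime (n : ℕ) (k : Fin (n + 1)) : MSSet.{u} :=
  (MSSet.complicialSimplex n k).markFrom (n - 1)

/-- The elementary `k`-complicial marking extension `Δ^k[n]′ → Δ^k[n]″`. -/
def MSSet.markingExtension (n : ℕ) (k : Fin (n + 1)) :
    MSSet.complicialSimplexPrime.{u} n k ⟶ MSSet.complicialSimplexDoublePrime.{u} n k where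
  map := 𝟙 Δ[n]
  preserves m x := by
    rintro (h | h)
    · exact .inl h
    · exact .inr ⟨h.2.1, by omega⟩

/-- A marked simplicial set is pre-complicial if it has the right lifting property with respect to
the elementary complicial marking extensions. (Equivalently, with respect to all complicial marking
extensions, as these form the cellular closure of the elementary ones.) -/
def isPreComp : ObjectProperty MSSet.{u} := fun X =>
  ∀ (n : ℕ) (k : Fin (n + 1)), 1 ≤ n → ∀ f : MSSet.complicialSimplexPrime n k ⟶ X,
    ∃ g : MSSet.complicialSimplexDoublePrime n k ⟶ X, MSSet.markingExtension n k ≫ g = f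

/-- The category of pre-complicial sets. -/
abbrev PreComp : Type (u + 1) := isPreComp.{u}.FullSubcategory

/-- The lifting property against the elementary marking extensions, in terms of simplices. -/
def Forced {K : SSet.{u}} (M : ∀ n, Set (K _⦋n⦌)) : Prop :=
  ∀ (n : ℕ) (k : Fin (n + 1)), 1 ≤ n → ∀ z : K _⦋n⦌,
    (∀ (m : ℕ) (α : ⦋m⦌ ⟶ ⦋n⦌),
      SSet.stdSimplex.objEquiv.{u}.symm α ∈ (MSSet.complicialSimplexPrime n k).marked m →
        K.map α.op z ∈ M m) →
    ∀ (m : ℕ) (α : ⦋m⦌ ⟶ ⦋n⦌),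
      SSet.stdSimplex.objEquiv.{u}.symm α ∈ (MSSet.complicialSimplexDoublePrime n k).marked m →
        K.map α.op z ∈ M m

theorem isPreComp_iff (X : MSSet.{u}) : isPreComp X ↔ Forced X.marked := by
  constructor
  · intro h n k hn z hz m α hα
    obtain ⟨g, hg⟩ := h n k hn ⟨SSet.yonedaEquiv.symm z,
      fun m x hx => hz m (SSet.stdSimplex.objEquiv x) hx⟩
    have h1 := g.preserves m _ hα
    have h2 : g.map = SSet.yonedaEquiv.symm z :=
      (Category.id_comp g.map).symm.trans (congrArg MSSet.Hom.map hg)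
    rw [h2] at h1
    exact h1
  · intro h n k hn f
    have key := h n k hn (SSet.yonedaEquiv f.map) (fun m α hα => by
      have := f.preserves m _ hα
      obtain ⟨z, hz⟩ := SSet.yonedaEquiv.symm.surjective f.map
      rw [← hz, Equiv.apply_symm_apply]
      rw [← hz] at this
      exact this)
    refine ⟨⟨f.map, fun m x hx => ?_⟩, MSSet.hom_ext (Category.id_comp f.map)⟩
    have := key m (SSet.stdSimplex.objEquiv x) hx
    obtain ⟨z, hz⟩ := SSet.yonedaEquiv.symm.surjective f.map
    rw [← hz]
    rw [← hz, Equiv.apply_symm_apply] at this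
    exact this

theorem Forced.preimage {K L : SSet.{u}} (f : K ⟶ L) {M : ∀ n, Set (L _⦋n⦌)} (h : Forced M) :
    Forced (K := K) fun n => {x | f.app (op ⦋n⦌) x ∈ M n} := by
  intro n k hn z hz m α hα
  have e (m : ℕ) (α : ⦋m⦌ ⟶ ⦋n⦌) : f.app (op ⦋m⦌) (K.map α.op z) =
      L.map α.op (f.app (op ⦋n⦌) z) := NatTrans.naturality_apply f α.op z
  change f.app (op ⦋m⦌) (K.map α.op z) ∈ M m
  rw [e]
  refine h n k hn _ (fun m α hα => ?_) m α hα
  rw [← e]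
  exact hz m α hα

theorem Forced.inter {K : SSet.{u}} {M N : ∀ n, Set (K _⦋n⦌)} (h : Forced M) (h' : Forced N) :
    Forced (K := K) fun n => M n ∩ N n := by
  intro n k hn z hz m α hα
  exact ⟨h n k hn z (fun m α hα => (hz m α hα).1) m α hα,
    h' n k hn z (fun m α hα => (hz m α hα).2) m α hα⟩

theorem SSet_degenerate_map {K L : SSet.{u}} (f : K ⟶ L) {n : ℕ} {x : K _⦋n⦌}
    (h : x ∈ K.degenerate n) : f.app (op ⦋n⦌) x ∈ L.degenerate n := by
  obtain ⟨m, hm, g, y, rfl⟩ := h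
  exact ⟨m, hm, g, f.app _ y, (NatTrans.naturality_apply f g.op y).symm⟩

/-- The maximal marking of a simplicial set. -/
def maxMarking (K : SSet.{u}) (n : ℕ) : Set (K _⦋n⦌) := {_x | 1 ≤ n}

theorem degenerate_pos {K : SSet.{u}} {n : ℕ} {x : K _⦋n⦌} (h : x ∈ K.degenerate n) : 1 ≤ n := by
  obtain ⟨m, hm, _⟩ := h
  omega

theorem MSSet.pos {X : MSSet.{u}} {n : ℕ} {x : X.toSSet _⦋n⦌} (h : x ∈ X.marked n) : 1 ≤ n := by
  rcases n with _ | n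
  · exact absurd h (X.zero x)
  · omega

theorem forced_maxMarking (K : SSet.{u}) : Forced (maxMarking K) := by
  intro n k hn z hz m α hα
  exact MSSet.pos hα

/-- Markings which make a simplicial set a pre-complicial set. -/
structure IsPreMarking {K : SSet.{u}} (M : ∀ n, Set (K _⦋n⦌)) : Prop where
  zero (x : K _⦋0⦌) : x ∉ M 0
  degenerate_le (n : ℕ) : K.degenerate n ⊆ M n
  forced : Forced M

/-- The pre-complicial set with given marking. -/
def PreComp.mk' {K : SSet.{u}} (M : ∀ n, Set (K _⦋n⦌)) (h : IsPreMarking M) : PreComp.{u} where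
  obj := ⟨K, M, h.zero, h.degenerate_le⟩
  property := (isPreComp_iff _).2 h.forced

theorem IsPreMarking.of (X : PreComp.{u}) : IsPreMarking X.obj.marked :=
  ⟨X.obj.zero, X.obj.degenerate_le, (isPreComp_iff _).1 X.property⟩

theorem IsPreMarking.max (K : SSet.{u}) : IsPreMarking (maxMarking K) :=
  ⟨fun _ h => absurd h (by simp [maxMarking]), fun _ _ h => degenerate_pos h, forced_maxMarking K⟩

theorem IsPreMarking.preimage {K L : SSet.{u}} (f : K ⟶ L) {M : ∀ n, Set (L _⦋n⦌)}
    (h : IsPreMarking M) : IsPreMarking (K := K) fun n => {x | f.app (op ⦋n⦌) x ∈ M n} :=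
  ⟨fun _ => h.zero _, fun _ _ hx => h.degenerate_le _ (SSet_degenerate_map f hx),
    h.forced.preimage f⟩

theorem IsPreMarking.inter {K : SSet.{u}} {M N : ∀ n, Set (K _⦋n⦌)} (h : IsPreMarking M)
    (h' : IsPreMarking N) : IsPreMarking (K := K) fun n => M n ∩ N n :=
  ⟨fun _ hx => h.zero _ hx.1, fun _ _ hx => ⟨h.degenerate_le _ hx, h'.degenerate_le _ hx⟩,
    h.forced.inter h'.forced⟩

/-- The smallest pre-complicial marking which contains given simplices of positive dimension. -/
def generatedMarking {K : SSet.{u}} (S : ∀ n, Set (K _⦋n⦌)) (n : ℕ) : Set (K _⦋n⦌) :=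
  {x | ∀ M : ∀ n, Set (K _⦋n⦌), IsPreMarking M → (∀ n, S n ⊆ M n) → x ∈ M n}

theorem IsPreMarking.generated {K : SSet.{u}} (S : ∀ n, Set (K _⦋n⦌))
    (hS : ∀ n, S n ⊆ maxMarking K n) : IsPreMarking (generatedMarking S) :=
  ⟨fun x hx => (IsPreMarking.max K).zero x (hx _ (IsPreMarking.max K) hS),
    fun _ _ hx _ hM _ => hM.degenerate_le _ hx,
    fun n k hn z hz m α hα M hM hS => hM.forced n k hn z (fun m α hα => hz m α hα M hM hS) m α hα⟩

/-- The functor which forgets the marking. -/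
abbrev PreComp.forget : PreComp.{u} ⥤ SSet.{u} := isPreComp.ι ⋙ MSSet.forget

/-- A map of pre-complicial sets from a map of simplicial sets. -/
def PreComp.homMk {X Y : PreComp.{u}} (f : X.obj.toSSet ⟶ Y.obj.toSSet)
    (hf : ∀ (n : ℕ) (x : X.obj.toSSet _⦋n⦌), x ∈ X.obj.marked n →
      f.app (op ⦋n⦌) x ∈ Y.obj.marked n) : X ⟶ Y :=
  ObjectProperty.homMk ⟨f, hf⟩

theorem PreComp.hom_ext {X Y : PreComp.{u}} {f g : X ⟶ Y} (h : f.hom.map = g.hom.map) : f = g :=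
  ObjectProperty.hom_ext _ (MSSet.hom_ext h)

section Colimits

variable {J : Type*} [Category* J] (F : J ⥤ PreComp.{u})

/-- The images of the marked simplices in a cocone. -/
def coconeImage (c : Cocone (F ⋙ PreComp.forget)) (n : ℕ) : Set (c.pt _⦋n⦌) :=
  {x | ∃ (j : J) (y : (F.obj j).obj.toSSet _⦋n⦌), y ∈ (F.obj j).obj.marked n ∧
    (c.ι.app j).app (op ⦋n⦌) y = x}

/-- A cocone of simplicial sets, with the smallest marking which makes it a cocone of pre-complicial
sets. -/
def markedCocone (c : Cocone (F ⋙ PreComp.forget)) : Cocone F where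
  pt := PreComp.mk' (generatedMarking (coconeImage F c)) (.generated _ (by
    rintro n x ⟨j, y, hy, rfl⟩
    exact MSSet.pos hy))
  ι :=
    { app j := PreComp.homMk (c.ι.app j) fun n y hy M _ hS => hS n ⟨j, y, hy, rfl⟩
      naturality j j' f := PreComp.hom_ext (c.ι.naturality f) }

/-- The marked cocone of a colimit cocone is a colimit. -/
def isColimitMarkedCocone (c : Cocone (F ⋙ PreComp.forget)) (hc : IsColimit c) :
    IsColimit (markedCocone F c) where
  desc s := PreComp.homMk (hc.desc (PreComp.forget.mapCocone s)) fun n x hx => by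
    refine hx _ ((IsPreMarking.of s.pt).preimage (hc.desc (PreComp.forget.mapCocone s))) ?_
    rintro n x ⟨j, y, hy, rfl⟩
    have h := (s.ι.app j).hom.preserves n y hy
    have e := congrArg (fun k => k.app (op ⦋n⦌)) (hc.fac (PreComp.forget.mapCocone s) j)
    have e' := ConcreteCategory.congr_hom e y
    have h' : (c.ι.app j ≫ hc.desc (PreComp.forget.mapCocone s)).app (op ⦋n⦌) y ∈
      s.pt.obj.marked n := Set.mem_of_eq_of_mem e' h
    exact h'
  fac s j := PreComp.hom_ext (hc.fac (PreComp.forget.mapCocone s) j)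
  uniq s m hm := PreComp.hom_ext (hc.uniq (PreComp.forget.mapCocone s) m.hom.map
    fun j => congrArg (fun k => k.hom.map) (hm j))

instance PreComp.hasColimitsOfShape [HasColimitsOfShape J (Type u)] :
    HasColimitsOfShape J PreComp.{u} where
  has_colimit F := ⟨⟨⟨_, isColimitMarkedCocone F _ (colimit.isColimit _)⟩⟩⟩

end Colimits

instance PreComp.hasColimitsOfSize : HasColimitsOfSize.{0, u} PreComp.{u} where
  has_colimits_of_shape J := inferInstance

/-- The cartesian product of pre-complicial sets: a simplex `(x, y)` is marked if `x` and `y` both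
are. -/
def PreComp.prod (X Y : PreComp.{u}) : PreComp.{u} :=
  PreComp.mk' (K := X.obj.toSSet ⊗ Y.obj.toSSet)
    (fun n => {z | z.1 ∈ X.obj.marked n} ∩ {z | z.2 ∈ Y.obj.marked n})
    (((IsPreMarking.of X).preimage (CartesianMonoidalCategory.fst _ _)).inter
      ((IsPreMarking.of Y).preimage (CartesianMonoidalCategory.snd _ _)))

/-- The terminal pre-complicial set: a point, with all simplices of positive dimension marked. -/
def PreComp.point : PreComp.{u} := PreComp.mk' (maxMarking (𝟙_ SSet.{u})) (.max _)

/-- The first projection. -/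
def PreComp.fst (X Y : PreComp.{u}) : X.prod Y ⟶ X :=
  PreComp.homMk (CartesianMonoidalCategory.fst _ _) fun _ _ h => h.1

/-- The second projection. -/
def PreComp.snd (X Y : PreComp.{u}) : X.prod Y ⟶ Y :=
  PreComp.homMk (CartesianMonoidalCategory.snd _ _) fun _ _ h => h.2

/-- The pre-complicial set `PreComp.point` is terminal. -/
def PreComp.isTerminalPoint : IsTerminal PreComp.point.{u} :=
  IsTerminal.ofUniqueHom
    (fun X => PreComp.homMk (SemiCartesianMonoidalCategory.toUnit _) fun _ _ h => MSSet.pos h)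
    fun X f => PreComp.hom_ext (SemiCartesianMonoidalCategory.toUnit_unique _ _)

/-- The product of pre-complicial sets is a categorical product. -/
def PreComp.isLimitProd (X Y : PreComp.{u}) :
    IsLimit (BinaryFan.mk (PreComp.fst X Y) (PreComp.snd X Y)) :=
  BinaryFan.isLimitMk
    (fun s => PreComp.homMk (CartesianMonoidalCategory.lift s.fst.hom.map s.snd.hom.map)
      fun n x h => ⟨s.fst.hom.preserves n x h, s.snd.hom.preserves n x h⟩)
    (fun s => PreComp.hom_ext (CartesianMonoidalCategory.lift_fst _ _))
    (fun s => PreComp.hom_ext (CartesianMonoidalCategory.lift_snd _ _))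
    fun s m h₁ h₂ => PreComp.hom_ext (CartesianMonoidalCategory.hom_ext _ _
      ((congrArg (fun k => k.hom.map) h₁).trans (CartesianMonoidalCategory.lift_fst _ _).symm)
      ((congrArg (fun k => k.hom.map) h₂).trans (CartesianMonoidalCategory.lift_snd _ _).symm))

/-- The cartesian (pseudo Gray) monoidal structure on pre-complicial sets. -/
instance PreComp.cartesianMonoidalCategory : CartesianMonoidalCategory PreComp.{u} :=
  .ofChosenFiniteProducts ⟨_, PreComp.isTerminalPoint⟩ fun X Y => ⟨_, PreComp.isLimitProd X Y⟩

end Simplicial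

section Gray

open scoped Simplicial

/-- The front face `[p] → [n]`, for `p + q = n`. -/
def front {p q n : ℕ} (h : p + q = n) : ⦋p⦌ ⟶ ⦋n⦌ :=
  SimplexCategory.Hom.mk
    { toFun i := ⟨i.val, by have : i.val < p + 1 := i.isLt; simp; omega⟩
      monotone' i j hij := hij }

/-- The back face `[q] → [n]`, for `p + q = n`. -/
def back {p q n : ℕ} (h : p + q = n) : ⦋q⦌ ⟶ ⦋n⦌ :=
  SimplexCategory.Hom.mk
    { toFun i := ⟨p + i.val, by have : i.val < q + 1 := i.isLt; simp; omega⟩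
      monotone' i j hij := Nat.add_le_add_left hij p }

theorem degenerate_of_not_injective {K : SSet.{u}} {m n : ℕ} (α : ⦋m⦌ ⟶ ⦋n⦌) (z : K _⦋n⦌)
    (h : ¬ Function.Injective α.toOrderHom) : K.map α.op z ∈ K.degenerate m := by
  rcases m with _ | m
  · exact absurd (fun a b _ => Subsingleton.elim (α := Fin 1) a b) h
  · obtain ⟨i, β, rfl⟩ := SimplexCategory.eq_σ_comp_of_not_injective α h
    rw [op_comp, fmap_comp]
    exact SSet.σ_mem_degenerate _ i _

/-- The Gray tensor product of marked simplicial sets: a simplex `(x, y)` is marked if, for every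
`p + q = n`, the front `p`-face of `x` or the back `q`-face of `y` is marked. -/
def MSSet.gray (X Y : MSSet.{u}) : MSSet.{u} where
  toSSet := X.toSSet ⊗ Y.toSSet
  marked n := {z | ∀ (p q : ℕ) (h : p + q = n),
    X.toSSet.map (front h).op z.1 ∈ X.marked p ∨ Y.toSSet.map (back h).op z.2 ∈ Y.marked q}
  zero z h := by
    rcases h 0 0 rfl with h | h
    · exact X.zero _ h
    · exact Y.zero _ h
  degenerate_le n z hz p q h := by
    obtain ⟨m, hm, f, w, rfl⟩ := hz
    rcases n with _ | n
    · omega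
    have hf : ¬ Function.Injective f.toOrderHom := fun hf => by
      have := Fintype.card_le_of_injective _ hf
      simp at this
      omega
    obtain ⟨i, g, rfl⟩ := SimplexCategory.eq_σ_comp_of_not_injective f hf
    have e₁ : ((X.toSSet ⊗ Y.toSSet).map (SimplexCategory.σ i ≫ g).op w).1 =
        X.toSSet.map (SimplexCategory.σ i ≫ g).op w.1 := rfl
    have e₂ : ((X.toSSet ⊗ Y.toSSet).map (SimplexCategory.σ i ≫ g).op w).2 =
        Y.toSSet.map (SimplexCategory.σ i ≫ g).op w.2 := rfl
    rw [e₁, e₂, ← fmap_comp, ← fmap_comp, ← op_comp, ← op_comp]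
    have hi := i.isLt
    have hσ : (SimplexCategory.σ i).toOrderHom i.castSucc =
        (SimplexCategory.σ i).toOrderHom i.succ := by
      simp [SimplexCategory.σ, SimplexCategory.mkHom]
    by_cases hp : i.val < p
    · refine .inl (X.degenerate_le p (degenerate_of_not_injective _ _ fun hinj => ?_))
      have := @hinj ⟨i.val, by simp; omega⟩ ⟨i.val + 1, by simp; omega⟩
        (congrArg g.toOrderHom hσ)
      simp at this
    · refine .inr (Y.degenerate_le q (degenerate_of_not_injective _ _ fun hinj => ?_))
      have h1 : (back h).toOrderHom ⟨i.val - p, by simp; omega⟩ = i.castSucc :=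
        Fin.ext (by change p + (i.val - p) = i.val; omega)
      have h2 : (back h).toOrderHom ⟨i.val + 1 - p, by simp; omega⟩ = i.succ :=
        Fin.ext (by change p + (i.val + 1 - p) = i.val + 1; omega)
      have := @hinj ⟨i.val - p, by simp; omega⟩ ⟨i.val + 1 - p, by simp; omega⟩ (by
        refine congrArg g.toOrderHom ?_
        refine (congrArg (SimplexCategory.σ i).toOrderHom h1).trans (hσ.trans ?_)
        exact (congrArg (SimplexCategory.σ i).toOrderHom h2).symm)
      simp at this
      omega

end Gray

/-- The Gray tensor powers `(Δ^1)^{⊗ n}`. -/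
def grayPow : ℕ → MSSet.{u}
  | 0 => MSSet.flat (SSet.stdSimplex.obj (.mk 0))
  | n + 1 => (grayPow n).gray (MSSet.flat (SSet.stdSimplex.obj (.mk 1)))

/-- The nerve of the poset `[1]^n`, which is `(Δ^1)^n`. -/
def cubeNerve (n : ℕ) : SSet.{u} where
  obj r := ULift.{u} (Fin (r.unop.len + 1) →o Cube n)
  map α := ↾fun φ => ⟨φ.down.comp α.unop.toOrderHom⟩

/-- Functoriality of the nerve of `[1]^n`. -/
def cubeNerveMap {m n : ℕ} (f : Cube m → Cube n) (hf : Monotone f) :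
    cubeNerve.{u} m ⟶ cubeNerve.{u} n where
  app r := ↾fun φ => ⟨(⟨f, hf⟩ : Cube m →o Cube n).comp φ.down⟩

/-- The order isomorphism `{false ≤ true} ≅ {0 ≤ 1}`, as a monotone map. -/
def boolFin : Bool →o Fin 2 where
  toFun b := if b then 1 else 0
  monotone' := by decide

/-- The inverse of `boolFin`. -/
def finBool : Fin 2 →o Bool where
  toFun i := decide (i = 1)
  monotone' := by decide

/-- The last coordinate of `[1]^{n+1}`, as a map `[1]^{n+1} → [1]`. -/
def lastHom {n : ℕ} : Cube (n + 1) →o Bool where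
  toFun x := x (Fin.last n)
  monotone' x y h := h (Fin.last n)

/-- The first coordinates of `[1]^{n+1}`. -/
def initHom {n : ℕ} : Cube (n + 1) →o Cube n where
  toFun x i := x i.castSucc
  monotone' x y h i := h i.castSucc

/-- A simplex of `[1]^{n+1}` from its first coordinates and its last coordinate. -/
def snocHom {r n : ℕ} (φ : Fin (r + 1) →o Cube n) (y : Fin (r + 1) →o Bool) :
    Fin (r + 1) →o Cube (n + 1) where
  toFun p := Fin.snoc (φ p) (y p)
  monotone' p q h := by
    intro i
    refine Fin.lastCases ?_ (fun i => ?_) i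
    · simpa using y.monotone h
    · simpa using φ.monotone h i

/-- The decomposition `[1]^{n+1} = [1]^n × [1]`, on nerves. -/
def cubeNerveSucc (n : ℕ) :
    cubeNerve.{u} (n + 1) ≅ cubeNerve.{u} n ⊗ SSet.stdSimplex.obj (.mk 1) where
  hom :=
    { app r := ↾fun φ => (⟨initHom.comp φ.down⟩,
        SSet.stdSimplex.objMk ((boolFin.comp lastHom).comp φ.down)) }
  inv :=
    { app r := ↾fun z => ⟨snocHom z.1.down (finBool.comp (SSet.stdSimplex.asOrderHom z.2))⟩
      naturality r r' α := by
        ext z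
        refine ULift.ext _ _ (OrderHom.ext _ _ (funext fun p => rfl)) }
  hom_inv_id := by
    ext r φ
    refine ULift.ext _ _ (OrderHom.ext _ _ (funext fun p => funext fun i => ?_))
    refine Fin.lastCases ?_ (fun i => ?_) i
    · change Fin.snoc (α := fun _ => Bool) _ (finBool (boolFin (φ.down p (Fin.last n))))
        (Fin.last n) = φ.down p (Fin.last n)
      rw [Fin.snoc_last]
      cases φ.down p (Fin.last n) <;> rfl
    · change Fin.snoc (α := fun _ => Bool) (fun i => φ.down p i.castSucc) _ (Fin.castSucc i) =
        φ.down p i.castSucc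
      rw [Fin.snoc_castSucc]
  inv_hom_id := by
    ext r z
    · refine ULift.ext _ _ (OrderHom.ext _ _ (funext fun p => funext fun i => ?_))
      change Fin.snoc (α := fun _ => Bool) (z.1.down p) _ (Fin.castSucc i) = z.1.down p i
      rw [Fin.snoc_castSucc]
    · refine SSet.stdSimplex.objEquiv.injective ?_
      refine SimplexCategory.Hom.ext _ _ (OrderHom.ext _ _ (funext fun p => ?_))
      change boolFin (Fin.snoc (α := fun _ => Bool) _
        (finBool (SSet.stdSimplex.asOrderHom z.2 p)) (Fin.last n)) =
          SSet.stdSimplex.asOrderHom z.2 p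
      rw [Fin.snoc_last]
      generalize SSet.stdSimplex.asOrderHom z.2 p = t
      revert t
      decide

/-- The nerve of a point is `Δ^0`. -/
def cubeNerveZero : cubeNerve.{u} 0 ≅ SSet.stdSimplex.obj (.mk 0) where
  hom := { app r := ↾fun φ => SSet.stdSimplex.objMk (OrderHom.const _ 0) }
  inv := { app r := ↾fun z => ⟨OrderHom.const _ Fin.elim0⟩ }
  hom_inv_id := by
    ext r φ
    exact ULift.ext _ _ (OrderHom.ext _ _ (funext fun p => Subsingleton.elim _ _))
  inv_hom_id := by ext

/-- The underlying simplicial set of `(Δ^1)^{⊗ n}` is the nerve of `[1]^n`. -/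
def cubeIso : ∀ n : ℕ, cubeNerve.{u} n ≅ (grayPow.{u} n).toSSet
  | 0 => cubeNerveZero
  | n + 1 => cubeNerveSucc n ≪≫ whiskerRightIso (cubeIso n) (SSet.stdSimplex.obj (.mk 1))

/-- The condition that there are coordinates `s 0 < ⋯ < s (r - 1)` such that the coordinate `s p`
jumps from `false` to `true` between `p` and `p + 1`. -/
def Jumps {r n : ℕ} (φ : Fin (r + 1) → Cube n) : Prop :=
  ∃ s : Fin r → Fin n, StrictMono s ∧
    ∀ p : Fin r, φ p.castSucc (s p) = false ∧ φ p.succ (s p) = true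

theorem Jumps.le {r n : ℕ} {φ : Fin (r + 1) → Cube n} (h : Jumps φ) : r ≤ n := by
  obtain ⟨s, hs, -⟩ := h
  simpa using Fintype.card_le_of_injective s hs.injective

theorem jumps_succ_iff {r n : ℕ} (φ : Fin (r + 1) →o Cube (n + 1)) :
    Jumps φ ↔ ∃ (p q : ℕ) (h : p + q = r),
      Jumps (fun i : Fin (p + 1) => initHom (φ ((front h).toOrderHom i))) ∧
      StrictMono (fun i : Fin (q + 1) => lastHom (φ ((back h).toOrderHom i))) := by
  constructor
  · rintro ⟨s, hs, hφ⟩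
    by_cases hr : ∃ r', r = r' + 1 ∧ ∃ h : r - 1 < r, s ⟨r - 1, h⟩ = Fin.last n
    · obtain ⟨r, rfl, h, hl⟩ := hr
      have hlt (p : Fin r) : (s p.castSucc).val < n := by
        have h1 : s p.castSucc < s ⟨r + 1 - 1, h⟩ := hs (by
          rw [Fin.lt_def]; simp)
        rw [hl] at h1
        exact h1
      refine ⟨r, 1, rfl, ⟨fun p => ⟨(s p.castSucc).val, hlt p⟩,
        fun p q hpq => hs (by simpa using hpq),
        fun p => hφ p.castSucc⟩, ?_⟩
      have h2 := hφ ⟨r, by omega⟩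
      have e : s ⟨r, by omega⟩ = Fin.last n := hl
      rw [e] at h2
      intro a b hab
      obtain ⟨a, ha⟩ := a
      obtain ⟨b, hb⟩ := b
      obtain rfl : a = 0 := by have : a < b := hab; omega
      obtain rfl : b = 1 := by have : 0 < b := hab; omega
      change φ ⟨r + 0, _⟩ (Fin.last n) < φ ⟨r + 1, _⟩ (Fin.last n)
      have e1 : φ ⟨r + 0, by omega⟩ (Fin.last n) = false := h2.1
      have e2 : φ ⟨r + 1, by omega⟩ (Fin.last n) = true := h2.2
      rw [e1, e2]
      decide
    · have hlt (p : Fin r) : (s p).val < n := by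
        by_contra hp
        have hp' : s p = Fin.last n := Fin.ext (by have := (s p).isLt; simp; omega)
        have hpr := p.isLt
        refine hr ⟨r - 1, by omega, by omega, ?_⟩
        have h1 : s p ≤ s ⟨r - 1, by omega⟩ := hs.monotone (by rw [Fin.le_def]; simp; omega)
        rw [hp'] at h1
        exact le_antisymm (Fin.le_last _) h1
      refine ⟨r, 0, rfl, ⟨fun p => ⟨(s p).val, hlt p⟩, fun p q hpq => hs hpq, fun p => hφ p⟩, ?_⟩
      intro a b hab
      have h1 : a.val < b.val := hab
      have := b.isLt
      omega
  · rintro ⟨p, q, rfl, ⟨s, hs, hφ⟩, hq⟩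
    have hq1 : q ≤ 1 := by
      have := Fintype.card_le_of_injective _ hq.injective
      simpa using this
    obtain rfl | rfl : q = 0 ∨ q = 1 := by omega
    · exact ⟨fun i => (s i).castSucc, fun i j hij => hs hij, fun i => hφ i⟩
    · refine ⟨Fin.snoc (fun i => (s i).castSucc) (Fin.last n), ?_, ?_⟩
      · intro i j hij
        revert hij
        refine Fin.lastCases (fun hij => ?_) (fun i => ?_) i
        · exact absurd hij (not_lt.2 (Fin.le_last _))
        · refine Fin.lastCases (fun _ => ?_) (fun j hij => ?_) j
          · simp [Fin.castSucc_lt_last]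
          · simp only [Fin.snoc_castSucc]
            exact hs (by simpa using hij)
      · intro i
        refine Fin.lastCases ?_ (fun i => ?_) i
        · have h := hq (show (0 : Fin 2) < 1 by decide)
          simp only [Fin.snoc_last]
          have e1 : φ (Fin.last p).castSucc (Fin.last n) < φ (Fin.last p).succ (Fin.last n) := h
          generalize φ (Fin.last p).castSucc (Fin.last n) = a at *
          generalize φ (Fin.last p).succ (Fin.last n) = b at *
          revert a b
          decide
        · simp only [Fin.snoc_castSucc]
          exact hφ i

/-- The unmarked simplices of `(Δ^1)^{⊗ n}`. -/
theorem notMem_marked_iff (n r : ℕ) (φ : Fin (r + 1) →o Cube n) :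
    (cubeIso.{u} n).hom.app (op (.mk r)) ⟨φ⟩ ∉ (grayPow.{u} n).marked r ↔ Jumps φ := by
  induction n generalizing r with
  | zero =>
    refine (SSet.stdSimplex.mem_nonDegenerate_iff_strictMono _).trans ?_
    constructor
    · intro h
      have : r = 0 := by
        have := Fintype.card_le_of_injective _ h.injective
        simpa using this
      subst this
      exact ⟨fun i => i.elim0, fun i => i.elim0, fun i => i.elim0⟩
    · intro h
      obtain rfl : r = 0 := by have := h.le; omega
      intro a b hab
      have h1 : a.val < b.val := hab
      have := b.isLt
      omega
  | succ n ih =>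
    rw [jumps_succ_iff]
    have key (p q : ℕ) (h : p + q = r) :
        (¬ ((grayPow.{u} n).toSSet.map (front h).op
            ((cubeIso.{u} n).hom.app (op (.mk r)) ⟨initHom.comp φ⟩) ∈ (grayPow n).marked p ∨
          (SSet.stdSimplex.{u}.obj (.mk 1)).map (back h).op
            (SSet.stdSimplex.objMk ((boolFin.comp lastHom).comp φ)) ∈
              (SSet.stdSimplex.{u}.obj (.mk 1)).degenerate q)) ↔
        Jumps (fun i : Fin (p + 1) => initHom (φ ((front h).toOrderHom i))) ∧
          StrictMono (fun i : Fin (q + 1) => lastHom (φ ((back h).toOrderHom i))) := by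
      rw [not_or]
      refine and_congr ?_ ?_
      · have e : (grayPow.{u} n).toSSet.map (front h).op
            ((cubeIso.{u} n).hom.app (op (.mk r)) ⟨initHom.comp φ⟩) =
            (cubeIso.{u} n).hom.app (op (.mk p))
              ⟨(initHom.comp φ).comp (front h).toOrderHom⟩ :=
          (NatTrans.naturality_apply (cubeIso.{u} n).hom (front h).op _).symm
        rw [e, ih]
        rfl
      · refine (SSet.stdSimplex.mem_nonDegenerate_iff_strictMono _).trans ?_
        have hb : ∀ a b : Bool, boolFin a < boolFin b ↔ a < b := by decide
        exact forall₃_congr fun a b _ => hb _ _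
    constructor
    · intro h
      by_contra hc
      refine h fun p q hpq => ?_
      by_contra h'
      exact hc ⟨p, q, hpq, (key p q hpq).1 h'⟩
    · rintro ⟨p, q, hpq, h⟩ hm
      exact (key p q hpq).2 h (hm p q hpq)

theorem Jumps.of_face {r n : ℕ} (i : Fin (n + 1)) (ε : Bool) {φ : Fin (r + 1) → Cube n}
    (h : Jumps fun p => face i ε (φ p)) : Jumps φ := by
  obtain ⟨s, hs, h⟩ := h
  have hne (p : Fin r) : (s p).val ≠ i.val := by
    intro e
    obtain ⟨h1, h2⟩ := h p
    simp [face, e] at h1 h2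
    simp [h1] at h2
  have hi := i.isLt
  let t (p : Fin r) : Fin n := if h : (s p).val < i.val then ⟨(s p).val, by omega⟩ else
    ⟨(s p).val - 1, by have := (s p).isLt; have := hne p; omega⟩
  have ht (p : Fin r) (x : Cube n) : face i ε x (s p) = x (t p) := by
    have := hne p
    by_cases h : (s p).val < i.val
    · simp only [face, t, dif_pos h]
    · have h' : i.val < (s p).val := by omega
      simp only [face, t, dif_neg h, dif_pos h']
  refine ⟨t, fun p q hpq => ?_, fun p => ?_⟩
  · have h1 : (s p).val < (s q).val := hs hpq
    have := hne p
    have := hne q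
    rw [Fin.lt_def]
    simp only [t]
    split_ifs <;> simp <;> omega
  · have h1 := h p
    simp only [ht] at h1
    exact h1

theorem Jumps.of_degen {r n : ℕ} (i : Fin (n + 1)) {φ : Fin (r + 1) → Cube (n + 1)}
    (h : Jumps fun p => degen i (φ p)) : Jumps φ := by
  obtain ⟨s, hs, h⟩ := h
  let t (p : Fin r) : Fin (n + 1) := if (s p).val < i.val then (s p).castSucc else (s p).succ
  have ht (p : Fin r) (x : Cube (n + 1)) : degen i x (s p) = x (t p) := by
    by_cases h : (s p).val < i.val <;> simp [degen, t, h]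
  refine ⟨t, fun p q hpq => ?_, fun p => ?_⟩
  · have h1 : (s p).val < (s q).val := hs hpq
    rw [Fin.lt_def]
    simp only [t]
    split_ifs <;> simp <;> omega
  · have h1 := h p
    simp only [ht] at h1
    exact h1

theorem Jumps.of_conn {r n : ℕ} (i : Fin n) (ε : Bool) {φ : Fin (r + 1) → Cube (n + 1)}
    (h : Jumps fun p => conn i ε (φ p)) : Jumps φ := by
  obtain ⟨s, hs, h⟩ := h
  have key (p : Fin r) : ∃ t : Fin (n + 1), (φ p.castSucc t = false ∧ φ p.succ t = true) ∧
      (((s p).val < i.val ∧ t.val = (s p).val) ∨ ((s p).val = i.val ∧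
        (t.val = i.val ∨ t.val = i.val + 1)) ∨ (i.val < (s p).val ∧ t.val = (s p).val + 1)) := by
    obtain ⟨h1, h2⟩ := h p
    by_cases hlt : (s p).val < i.val
    · simp only [conn, hlt, if_true] at h1 h2
      exact ⟨(s p).castSucc, ⟨h1, h2⟩, .inl ⟨hlt, rfl⟩⟩
    · by_cases heq : (s p).val = i.val
      · simp only [conn, heq, lt_irrefl, if_true, if_false] at h1 h2
        have : (φ p.castSucc i.castSucc = false ∧ φ p.succ i.castSucc = true) ∨
            (φ p.castSucc i.succ = false ∧ φ p.succ i.succ = true) := by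
          generalize φ p.castSucc i.castSucc = a at *
          generalize φ p.succ i.castSucc = b at *
          generalize φ p.castSucc i.succ = c at *
          generalize φ p.succ i.succ = d at *
          have key : ∀ ε a b c d : Bool, (if ε = true then max a c else min a c) = false →
              (if ε = true then max b d else min b d) = true →
              (a = false ∧ b = true ∨ c = false ∧ d = true) := by decide
          exact key ε a b c d h1 h2
        rcases this with h' | h'
        · exact ⟨i.castSucc, h', .inr (.inl ⟨heq, .inl rfl⟩)⟩
        · exact ⟨i.succ, h', .inr (.inl ⟨heq, .inr rfl⟩)⟩
      · simp only [conn, hlt, heq, if_false] at h1 h2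
        exact ⟨(s p).succ, ⟨h1, h2⟩, .inr (.inr ⟨by omega, rfl⟩)⟩
  choose t ht ht' using key
  refine ⟨t, fun p q hpq => ?_, ht⟩
  have h1 : (s p).val < (s q).val := hs hpq
  have := ht' p
  have := ht' q
  rw [Fin.lt_def]
  omega

theorem Jumps.of_map {m n : ℕ} {f : Cube m → Cube n} (hf : IsBoxMap f) {r : ℕ}
    {φ : Fin (r + 1) → Cube m} (h : Jumps fun p => f (φ p)) : Jumps φ := by
  induction hf with
  | id n => exact h
  | comp _ _ h1 h2 => exact h1 (h2 h)
  | face i ε => exact h.of_face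
  | degen i => exact h.of_degen
  | conn i ε => exact h.of_conn

theorem not_jumps_of_degenerate {m n : ℕ} {f : Cube m → Cube n} (hf : IsDegenerate f) {r : ℕ}
    (hr : m ≤ r) (φ : Fin (r + 1) → Cube m) : ¬ Jumps fun p => f (φ p) := by
  intro h
  cases hf with
  | degen i hg =>
    have := (Jumps.of_map (φ := fun p => Comical.degen i (φ p)) hg h).le
    omega
  | conn i ε hg =>
    have := (Jumps.of_map (φ := fun p => Comical.conn i ε (φ p)) hg h).le
    omega

theorem val_succAbove {n : ℕ} (j : Fin (n + 1)) (a : Fin n) :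
    (j.succAbove a).val = if a.val < j.val then a.val else a.val + 1 := by
  by_cases h : a.val < j.val
  · rw [if_pos h, Fin.succAbove_of_castSucc_lt _ _ h]; rfl
  · rw [if_neg h, Fin.succAbove_of_le_castSucc _ _ (not_lt.1 h)]; rfl

/-- If the `k`-th face of a simplex is unmarked, then so is the face opposite to a neighbour
of `k`. -/
theorem Jumps.neighbour {r n : ℕ} (hr : 1 ≤ r) (φ : Fin (r + 2) →o Cube n) (k : Fin (r + 2))
    (h : Jumps fun p : Fin (r + 1) => φ (k.succAbove p)) :
    ∃ j : Fin (r + 2), (j.val + 1 = k.val ∨ j.val = k.val + 1) ∧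
      Jumps fun p : Fin (r + 1) => φ (j.succAbove p) := by
  obtain ⟨s, hs, h⟩ := h
  have hk := k.isLt
  have up (h0 : k.val + 1 < r + 2) (h1 : ∀ p : Fin r, p.val + 1 = k.val → φ k (s p) = true) :
      Jumps fun p : Fin (r + 1) => φ ((⟨k.val + 1, h0⟩ : Fin (r + 2)).succAbove p) := by
    refine ⟨s, hs, fun p => ⟨?_, ?_⟩⟩
    · have hle : (⟨k.val + 1, h0⟩ : Fin (r + 2)).succAbove p.castSucc ≤
          k.succAbove p.castSucc := by
        rw [Fin.le_def, val_succAbove, val_succAbove]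
        simp only
        split_ifs <;> omega
      have := φ.monotone hle (s p)
      exact le_antisymm (this.trans_eq (h p).1) (Bool.false_le _)
    · by_cases hp : p.val + 1 = k.val
      · have e : (⟨k.val + 1, h0⟩ : Fin (r + 2)).succAbove p.succ = k := by
          ext
          rw [val_succAbove, if_pos (by simp; omega)]
          simpa using hp
        simp only [e]
        exact h1 p hp
      · have e : (⟨k.val + 1, h0⟩ : Fin (r + 2)).succAbove p.succ = k.succAbove p.succ := by
          ext
          rw [val_succAbove, val_succAbove]
          simp only [Fin.val_succ]
          split_ifs <;> omega
        simp only [e]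
        exact (h p).2
  have down (h0 : 1 ≤ k.val) (h1 : ∀ p : Fin r, p.val + 1 = k.val → φ k (s p) = false) :
      Jumps fun p : Fin (r + 1) => φ ((⟨k.val - 1, by omega⟩ : Fin (r + 2)).succAbove p) := by
    refine ⟨s, hs, fun p => ⟨?_, ?_⟩⟩
    · by_cases hp : p.val + 1 = k.val
      · have e : (⟨k.val - 1, by omega⟩ : Fin (r + 2)).succAbove p.castSucc = k := by
          ext
          rw [val_succAbove, if_neg (by simp; omega)]
          simpa using hp
        simp only [e]
        exact h1 p hp
      · have e : (⟨k.val - 1, by omega⟩ : Fin (r + 2)).succAbove p.castSucc =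
            k.succAbove p.castSucc := by
          ext
          rw [val_succAbove, val_succAbove]
          simp only [Fin.val_castSucc]
          split_ifs <;> omega
        simp only [e]
        exact (h p).1
    · have hle : k.succAbove p.succ ≤ (⟨k.val - 1, by omega⟩ : Fin (r + 2)).succAbove p.succ := by
        rw [Fin.le_def, val_succAbove, val_succAbove]
        simp only
        split_ifs <;> omega
      have := φ.monotone hle (s p)
      exact le_antisymm (Bool.le_true _) ((h p).2.symm.trans_le this)
  by_cases h0 : k.val = 0
  · exact ⟨_, .inr rfl, up (by omega) fun p hp => by omega⟩
  by_cases h1 : k.val = r + 1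
  · refine ⟨⟨k.val - 1, by omega⟩, .inl (by simp; omega), down (by omega) fun p hp => ?_⟩
    have := p.isLt
    omega
  by_cases h2 : φ k (s ⟨k.val - 1, by omega⟩) = true
  · refine ⟨_, .inr rfl, up (by omega) fun p hp => ?_⟩
    have e : p = ⟨k.val - 1, by omega⟩ := Fin.ext (by simp; omega)
    rw [e]
    exact h2
  · refine ⟨⟨k.val - 1, by omega⟩, .inl (by simp; omega), down (by omega) fun p hp => ?_⟩
    have e : p = ⟨k.val - 1, by omega⟩ := Fin.ext (by simp; omega)
    rw [e]
    simpa using h2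

theorem Forced.of_face {K : SSet.{u}} {M : ∀ n : ℕ, Set (K.obj (op (.mk n)))}
    (hdeg : ∀ n, K.degenerate n ⊆ M n)
    (h : ∀ (r : ℕ) (k : Fin (r + 2)), 1 ≤ r → ∀ z : K.obj (op (.mk (r + 1))),
      (∀ j : Fin (r + 2), j.val + 1 = k.val ∨ j.val = k.val + 1 →
        K.map (SimplexCategory.δ j).op z ∈ M r) →
      K.map (SimplexCategory.δ k).op z ∈ M r) : Forced M := by
  intro n k hn z hz m α hα
  by_cases hinj : Function.Injective α.toOrderHom
  · have hm : 1 ≤ m := MSSet.pos hα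
    have hnm : n ≤ m + 1 ∨ SSet.stdSimplex.objEquiv.{u}.symm α ∈
        (MSSet.complicialSimplexPrime n k).marked m := by
      rcases hα with hα | hα
      · exact .inr (.inl hα)
      · exact .inl (by omega)
    rcases hnm with hnm | hα'
    · by_cases hhorn : ∃ j : Fin (n + 1), j ≠ k ∧ j ∉ Set.range α.toOrderHom
      · obtain ⟨j, hj, hj'⟩ := hhorn
        exact hz m α (.inr ⟨(SSet.mem_horn_iff_notMem_range _ k).2 ⟨j, hj, hj'⟩, hm, hnm⟩)
      · have hall (j : Fin (n + 1)) (hj : j ≠ k) : j ∈ Set.range α.toOrderHom := by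
          by_contra hj'
          exact hhorn ⟨j, hj, hj'⟩
        by_cases hk : k ∈ Set.range α.toOrderHom
        · refine hz m α (.inl (.inr ⟨hm, fun j _ => ?_⟩))
          by_cases hj : j = k
          · rw [hj]; exact hk
          · exact hall j hj
        · obtain ⟨r, rfl⟩ : ∃ r, n = r + 1 := ⟨n - 1, by omega⟩
          have hle : m ≤ r := by
            have h1 := Fintype.card_lt_of_injective_of_notMem _ hinj hk
            simp at h1
            omega
          obtain rfl : m = r := by omega
          have : Mono α := SimplexCategory.mono_iff_injective.2 hinj
          obtain ⟨i, rfl⟩ := SimplexCategory.eq_δ_of_mono α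
          have hδ (i : Fin (m + 2)) : i ∉ Set.range (SimplexCategory.δ i).toOrderHom := by
            rintro ⟨a, ha⟩
            exact Fin.succAbove_ne i a ha
          obtain rfl : i = k := by
            by_contra hik
            exact hδ i (hall i hik)
          refine h m i hm z fun j hj => ?_
          refine hz m (SimplexCategory.δ j) (.inr ⟨(SSet.mem_horn_iff_notMem_range _ i).2
            ⟨j, ?_, hδ j⟩, hm, le_rfl⟩)
          rintro rfl
          omega
    · exact hz m α hα'
  · exact hdeg m (degenerate_of_not_injective α z hinj)

theorem face_mem_grayPow {n r : ℕ} (hr : 1 ≤ r) (k : Fin (r + 2))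
    (z : (grayPow.{u} n).toSSet.obj (op (.mk (r + 1))))
    (hz : ∀ j : Fin (r + 2), j.val + 1 = k.val ∨ j.val = k.val + 1 →
      (grayPow n).toSSet.map (SimplexCategory.δ j).op z ∈ (grayPow n).marked r) :
    (grayPow n).toSSet.map (SimplexCategory.δ k).op z ∈ (grayPow n).marked r := by
  obtain ⟨φ, rfl⟩ : ∃ φ, (cubeIso.{u} n).hom.app (op (.mk (r + 1))) φ = z :=
    ⟨(cubeIso n).inv.app _ z, by
      have h := congrArg (fun k => k.app (op (.mk (r + 1)))) (cubeIso.{u} n).inv_hom_id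
      exact ConcreteCategory.congr_hom h z⟩
  have e (j : Fin (r + 2)) : (grayPow n).toSSet.map (SimplexCategory.δ j).op
      ((cubeIso.{u} n).hom.app (op (.mk (r + 1))) φ) =
      (cubeIso.{u} n).hom.app (op (.mk r)) ⟨φ.down.comp (SimplexCategory.δ j).toOrderHom⟩ :=
    (NatTrans.naturality_apply (cubeIso.{u} n).hom (SimplexCategory.δ j).op φ).symm
  by_contra hk
  rw [e, notMem_marked_iff] at hk
  obtain ⟨j, hj, hj'⟩ := Jumps.neighbour hr φ.down k hk
  have h1 := hz j hj
  rw [e] at h1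
  exact (notMem_marked_iff.{u} _ _ (φ.down.comp (SimplexCategory.δ j).toOrderHom)).2 hj' h1

theorem isPreComp_grayPow (n : ℕ) : isPreComp (grayPow.{u} n) := by
  rw [isPreComp_iff]
  exact Forced.of_face (grayPow n).degenerate_le fun r k hr z hz => face_mem_grayPow hr k z hz

theorem isPreComp_markFrom_grayPow (d n : ℕ) : isPreComp ((grayPow.{u} n).markFrom d) := by
  rw [isPreComp_iff]
  refine Forced.of_face ((grayPow n).markFrom d).degenerate_le fun r k hr z hz => ?_
  by_cases hd : d ≤ r
  · exact .inr ⟨hr, hd⟩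
  · refine .inl (face_mem_grayPow hr k z fun j hj => ?_)
    rcases hz j hj with h | h
    · exact h
    · exact absurd h.2 hd

/-- The pre-complicial set `(Δ^1)^{⊗ n}` for `[1]^n`, and `tr_{n - 1} (Δ^1)^{⊗ n}` for
`[1]^n_e`. -/
def triangObj (a : BoxPlus) : PreComp.{u} :=
  match a with
  | ⟨b, false, _⟩ => ⟨grayPow b.dim, isPreComp_grayPow b.dim⟩
  | ⟨b, true, _⟩ => ⟨(grayPow b.dim).markFrom b.dim, isPreComp_markFrom_grayPow b.dim b.dim⟩

/-- The underlying simplicial set of `triangObj a` is the nerve of the cube `a`. -/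
def triangIso (a : BoxPlus) : cubeNerve.{u} a.box.dim ≅ (triangObj.{u} a).obj.toSSet :=
  match a with
  | ⟨b, false, _⟩ => cubeIso b.dim
  | ⟨b, true, _⟩ => cubeIso b.dim

theorem triang_mem_marked_iff (a : BoxPlus) {r : ℕ} (φ : Fin (r + 1) →o Cube a.box.dim) :
    (triangIso.{u} a).hom.app (op (.mk r)) ⟨φ⟩ ∈ (triangObj.{u} a).obj.marked r ↔
      (¬ Jumps φ ∨ (a.marked = true ∧ a.box.dim ≤ r)) := by
  obtain ⟨b, m, hm⟩ := a
  have h0 := (notMem_marked_iff.{u} _ _ φ).not_right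
  cases m with
  | false =>
    change (cubeIso.{u} b.dim).hom.app (op (.mk r)) ⟨φ⟩ ∈ (grayPow.{u} b.dim).marked r ↔ _
    rw [← notMem_marked_iff.{u}, not_not]
    simp
  | true =>
    change ((cubeIso.{u} b.dim).hom.app (op (.mk r)) ⟨φ⟩ ∈ (grayPow.{u} b.dim).marked r ∨ _) ↔ _
    rw [← notMem_marked_iff.{u}, not_not]
    have := hm rfl
    simp only [true_and]
    refine or_congr Iff.rfl ⟨fun h => h.2, fun h => ⟨le_trans this h, h⟩⟩

/-- The underlying map of simplicial sets of the map induced by a map of cubes. -/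
def triangMap {a b : BoxPlus} (f : a ⟶ b) :
    (triangObj.{u} a).obj.toSSet ⟶ (triangObj.{u} b).obj.toSSet :=
  (triangIso a).inv ≫ cubeNerveMap f.map.map f.map.isBoxMap.monotone ≫ (triangIso b).hom

theorem triangMap_preserves {a b : BoxPlus} (f : a ⟶ b) (r : ℕ)
    (z : (triangObj.{u} a).obj.toSSet.obj (op (.mk r)))
    (hz : z ∈ (triangObj.{u} a).obj.marked r) :
    (triangMap f).app (op (.mk r)) z ∈ (triangObj.{u} b).obj.marked r := by
  obtain ⟨φ, rfl⟩ : ∃ φ, (triangIso.{u} a).hom.app (op (.mk r)) φ = z :=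
    ⟨(triangIso a).inv.app _ z, by
      have h := congrArg (fun k => k.app (op (.mk r))) (triangIso.{u} a).inv_hom_id
      exact ConcreteCategory.congr_hom h z⟩
  have e : (triangMap f).app (op (.mk r)) ((triangIso.{u} a).hom.app (op (.mk r)) φ) =
      (triangIso.{u} b).hom.app (op (.mk r))
        ⟨(⟨f.map.map, f.map.isBoxMap.monotone⟩ : Cube _ →o Cube _).comp φ.down⟩ := by
    have h1 : (triangIso.{u} a).hom ≫ triangMap f =
        cubeNerveMap f.map.map f.map.isBoxMap.monotone ≫ (triangIso b).hom := by
      simp [triangMap]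
    have h2 := congrArg (fun k => k.app (op (.mk r))) h1
    exact ConcreteCategory.congr_hom h2 φ
  rw [e, triang_mem_marked_iff]
  have hz' := (triang_mem_marked_iff.{u} a φ.down).1 hz
  rcases hz' with h | ⟨ha, hr⟩
  · exact .inl fun h' => h (h'.of_map f.map.isBoxMap)
  · rcases f.cond ha with hf | ⟨rfl, -⟩
    · exact .inl (not_jumps_of_degenerate hf hr φ.down)
    · exact .inr ⟨ha, hr⟩

/-- The functor `□⁺ ⥤ PreComp` sending `[1]^n` to `(Δ^1)^{⊗ n}` and `[1]^n_e` to
`tr_{n - 1} (Δ^1)^{⊗ n}`. -/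
def triang : BoxPlus ⥤ PreComp.{u} where
  obj := triangObj
  map f := PreComp.homMk (triangMap f) (triangMap_preserves f)
  map_id a := PreComp.hom_ext (by
    change (triangIso a).inv ≫ 𝟙 _ ≫ (triangIso a).hom = 𝟙 _
    simp)
  map_comp {a b c} f g := PreComp.hom_ext (by
    change (triangIso a).inv ≫ (cubeNerveMap f.map.map f.map.isBoxMap.monotone ≫
        cubeNerveMap g.map.map g.map.isBoxMap.monotone) ≫ (triangIso c).hom =
      ((triangIso a).inv ≫ cubeNerveMap f.map.map f.map.isBoxMap.monotone ≫ (triangIso b).hom) ≫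
      (triangIso b).inv ≫ cubeNerveMap g.map.map g.map.isBoxMap.monotone ≫ (triangIso c).hom
    simp)

/-- The Yoneda embedding of `□⁺` into structurally marked cubical sets. -/
abbrev boxYoneda : BoxPlus ⥤ BoxPlusᵒᵖ ⥤ Type u := uliftYoneda.{u}

instance boxYoneda_hasPointwiseLeftKanExtension :
    boxYoneda.{u}.HasPointwiseLeftKanExtension triang.{u} := inferInstance

/-- The triangulation functor `T : cSet⁺ ⥤ PreComp`, the restriction to marked cubical sets of the
left Kan extension of `triang` along the Yoneda embedding. -/
noncomputable def triangulation : MCSet.{u} ⥤ PreComp.{u} :=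
  isMarkedCubical.ι ⋙ boxYoneda.{u}.leftKanExtension triang.{u}

theorem triang_phi_epi (a : Box) (h : 1 ≤ a.dim) (Y : PreComp.{u})
    {f g : triang.obj (BoxPlus.mcube a h) ⟶ Y}
    (hfg : triang.map (BoxPlus.phi a h) ≫ f = triang.map (BoxPlus.phi a h) ≫ g) : f = g := by
  have e : (triang.{u}.map (BoxPlus.phi a h)).hom.map = 𝟙 _ := by
    change (cubeIso.{u} a.dim).inv ≫ 𝟙 _ ≫ (cubeIso.{u} a.dim).hom = 𝟙 _
    simp
  have h1 := congrArg (fun k => k.hom.map) hfg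
  change (triang.{u}.map (BoxPlus.phi a h)).hom.map ≫ f.hom.map =
    (triang.{u}.map (BoxPlus.phi a h)).hom.map ≫ g.hom.map at h1
  rw [e] at h1
  exact PreComp.hom_ext h1

/-- The right adjoint `U : PreComp ⥤ cSet⁺` of the triangulation functor, with
`U(Y)_n = Hom(T[1]^n, Y)` and `e U(Y)_n = Hom(T[1]^n_e, Y)`. -/
def triangulationRight : PreComp.{u} ⥤ MCSet.{u} :=
  isMarkedCubical.lift (Presheaf.restrictedULiftYoneda.{0} triang.{u}) fun Y a h f g hfg =>
    ULift.ext _ _ (triang_phi_epi a h Y (congrArg ULift.down hfg))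

/-- The adjunction `T ⊣ U`. -/
noncomputable def triangulationAdjunction : triangulation.{u} ⊣ triangulationRight.{u} :=
  (Presheaf.uliftYonedaAdjunction (boxYoneda.{u}.leftKanExtension triang.{u})
    (boxYoneda.{u}.leftKanExtensionUnit triang.{u})).restrictFullyFaithful
    isMarkedCubical.fullyFaithfulι (Functor.FullyFaithful.id _)
    (Iso.refl _) (Iso.refl _)

end Comical

/-! The unit of the pseudo Gray product on marked cubical sets is terminal and the target is
cartesian, so the two projections of `X ⊗ Y` make any functor between these categories oplax
monoidal. The right adjoint of a strong monoidal functor is lax monoidal, compatibly with unit and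
counit. Hence it suffices that the oplax structure maps of `T` are isomorphisms:
`isIso_unit_comparison` and `isIso_comparison`. Of `T` only the adjunction with `triangulationRight`
is used.

On simplices: an `r`-simplex of `T X` is represented by a cube `x` of `X` and an `r`-simplex `φ` of
the nerve of that cube, modulo maps of cubes (`exists_gen`, `exists_gen_desc`). The nerve of a
product of cubes is the product of the nerves, and each cube of `X ⊗ Y` comes from some `x ⊗ y`. So
sending `(x, φ), (y, ψ)` to `(x ⊗ y, (φ, ψ))` is inverse to the comparison map
(`comparison_bijective`).

On markings: the marking of `T X` is the smallest pre-complicial one containing the generators, that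
is the `(x, φ)` for which `φ` has no jump sequence, or `x` is marked of dimension at most `r`
(`marked_triangulation_le`). It must be shown that a simplex of `T (X ⊗ Y)` is marked if both its
components are. Slices of a pre-complicial marking of a product are again pre-complicial
(`IsPreMarking.slice`), which reduces this to components that are generators
(`IsPreMarking.mem_of_generatingMarked`).

The remaining case is `gen_ptens_mem_marked`, and its core is an argument inside one cube
(`IsPreMarking.mem_of_subfaceChain`). A simplex of a cube assigns to each coordinate the time at
which it jumps. If several coordinates jump at once, insert a vertex that lets the higher ones jump
before the lower ones. As jump sequences increase, faces through the new vertex and its neighbours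
have none, so they are marked. The original simplex is therefore forced to be marked as soon as the
two neighbouring faces are. In these the lower group jumps one step later, resp. the upper group one
step earlier. A weight along the surviving jump sequences drops, and the process ends at simplices
that jump along a sequence `s` and are constant in all other coordinates, i.e. at longest simplices
of `r`-dimensional faces of `x ⊗ y`. Such a face splits as a tensor product. If both parts have
positive dimension, it is marked by the definition of the pseudo Gray product. Otherwise `s` lies in
one factor, say that of `x`; then `φ` has a jump sequence, so `x` is marked of dimension `r` and is
itself the nontrivial part of the face (`isMarked_subface`). -/

namespace Comical

open CategoryTheory Opposite MonoidalCategory Limits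

/-! ### Consequences of the lifting property for pre-complicial markings. -/

section Forcing

/-- The set of the neighbours `k - 1`, `k`, `k + 1` of `k` lies in the image of `α`. -/
def HitsNeighbours {m n : ℕ} (k : Fin (n + 1)) (α : SimplexCategory.mk m ⟶ .mk n) : Prop :=
  ∀ i : Fin (n + 1), i.val + 1 = k.val ∨ i.val = k.val ∨ i.val = k.val + 1 →
    i ∈ Set.range α.toOrderHom

theorem not_injective_of_degenerate {m n : ℕ} {α : SimplexCategory.mk m ⟶ .mk n}
    (h : SSet.stdSimplex.objEquiv.{u}.symm α ∈ (SSet.stdSimplex.{u}.obj (.mk n)).degenerate m) :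
    ¬ Function.Injective α.toOrderHom := by
  intro hinj
  refine (SSet.mem_nonDegenerate_iff_notMem_degenerate _ _).1
    ((SSet.stdSimplex.mem_nonDegenerate_iff_mono _).2 ?_) h
  rw [Equiv.apply_symm_apply]
  exact SimplexCategory.mono_iff_injective.2 hinj

theorem marked_prime_cases {m n : ℕ} {k : Fin (n + 1)} {α : SimplexCategory.mk m ⟶ .mk n}
    (h : SSet.stdSimplex.objEquiv.{u}.symm α ∈ (MSSet.complicialSimplexPrime n k).marked m) :
    ¬ Function.Injective α.toOrderHom ∨ (1 ≤ m ∧ HitsNeighbours k α) ∨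
      ((∃ j, j ≠ k ∧ j ∉ Set.range α.toOrderHom) ∧ 1 ≤ m ∧ n ≤ m + 1) := by
  rcases h with (h | h) | h
  · exact .inl (not_injective_of_degenerate h)
  · exact .inr (.inl h)
  · obtain ⟨j, hj, hj'⟩ := (SSet.mem_horn_iff_notMem_range _ k).1 h.1
    exact .inr (.inr ⟨⟨j, hj, hj'⟩, h.2⟩)

theorem δ_notMem_range {n : ℕ} (i : Fin (n + 2)) :
    i ∉ Set.range (SimplexCategory.δ i).toOrderHom := by
  rintro ⟨a, ha⟩
  exact Fin.succAbove_ne i a ha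

/-- The markings of `Δ^k[n]′` and `Δ^k[n]″` differ only in the face opposite to `k`: an injective
face of dimension at least `n - 1` misses some `j ≠ k` and lies in the horn, or contains every
vertex, or is that face. In contrast to `Forced.of_face`, all marked simplices of `Δ^k[n]′` may be
used, not just the two neighbouring faces. -/
theorem Forced.of_opposite_face {K : SSet.{u}} {M : ∀ n : ℕ, Set (K.obj (op (.mk n)))}
    (hdeg : ∀ n, K.degenerate n ⊆ M n)
    (h : ∀ (r : ℕ) (k : Fin (r + 2)), 1 ≤ r → ∀ z : K.obj (op (.mk (r + 1))),
      (∀ (m : ℕ) (α : SimplexCategory.mk m ⟶ .mk (r + 1)), SSet.stdSimplex.objEquiv.{u}.symm α ∈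
        (MSSet.complicialSimplexPrime (r + 1) k).marked m → K.map α.op z ∈ M m) →
      K.map (SimplexCategory.δ k).op z ∈ M r) : Forced M := by
  intro n k hn z hz m α hα
  by_cases hinj : Function.Injective α.toOrderHom
  · have hm : 1 ≤ m := MSSet.pos hα
    have hnm : n ≤ m + 1 ∨ SSet.stdSimplex.objEquiv.{u}.symm α ∈
        (MSSet.complicialSimplexPrime n k).marked m := by
      rcases hα with hα | hα
      · exact .inr (.inl hα)
      · exact .inl (by omega)
    rcases hnm with hnm | hα'
    · by_cases hhorn : ∃ j : Fin (n + 1), j ≠ k ∧ j ∉ Set.range α.toOrderHom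
      · obtain ⟨j, hj, hj'⟩ := hhorn
        exact hz m α (.inr ⟨(SSet.mem_horn_iff_notMem_range _ k).2 ⟨j, hj, hj'⟩, hm, hnm⟩)
      · have hall (j : Fin (n + 1)) (hj : j ≠ k) : j ∈ Set.range α.toOrderHom := by
          by_contra hj'
          exact hhorn ⟨j, hj, hj'⟩
        by_cases hk : k ∈ Set.range α.toOrderHom
        · refine hz m α (.inl (.inr ⟨hm, fun j _ => ?_⟩))
          by_cases hj : j = k
          · rw [hj]; exact hk
          · exact hall j hj
        · obtain ⟨r, rfl⟩ : ∃ r, n = r + 1 := ⟨n - 1, by omega⟩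
          have hle : m ≤ r := by
            have h1 := Fintype.card_lt_of_injective_of_notMem _ hinj hk
            simp at h1
            omega
          obtain rfl : m = r := by omega
          have : Mono α := SimplexCategory.mono_iff_injective.2 hinj
          obtain ⟨i, rfl⟩ := SimplexCategory.eq_δ_of_mono α
          obtain rfl : i = k := by
            by_contra hik
            exact δ_notMem_range i (hall i hik)
          exact h m i hm z hz
    · exact hz m α hα'
  · exact hdeg m (degenerate_of_not_injective α z hinj)

/-- If all faces containing `k - 1`, `k`, `k + 1` and the faces opposite to `k - 1` and `k + 1` are
marked, then so is the face opposite to `k`. -/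
theorem IsPreMarking.face_mem {K : SSet.{u}} {M : ∀ n : ℕ, Set (K.obj (op (.mk n)))}
    (hM : IsPreMarking M) {r : ℕ} (hr : 1 ≤ r) (k : Fin (r + 2)) (z : K.obj (op (.mk (r + 1))))
    (h : ∀ (m : ℕ) (α : SimplexCategory.mk m ⟶ .mk (r + 1)), 1 ≤ m →
      Function.Injective α.toOrderHom → HitsNeighbours k α → K.map α.op z ∈ M m)
    (h' : ∀ j : Fin (r + 2), j.val + 1 = k.val ∨ j.val = k.val + 1 →
        K.map (SimplexCategory.δ j).op z ∈ M r) :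
    K.map (SimplexCategory.δ k).op z ∈ M r := by
  refine hM.forced (r + 1) k (by omega) z (fun m α hα => ?_) r (SimplexCategory.δ k)
    (.inr ⟨hr, by omega⟩)
  by_cases hinj : Function.Injective α.toOrderHom
  · rcases marked_prime_cases hα with h1 | h1 | ⟨⟨j, hj, hj'⟩, h1, h2⟩
    · exact absurd hinj h1
    · exact h m α h1.1 hinj h1.2
    -- Such a horn face is the one opposite to a single `j ≠ k`. Either `j` is a neighbour of `k`,
    -- or the face still contains `k` and its neighbours.
    · have hle : m ≤ r := by
        have h1 := Fintype.card_lt_of_injective_of_notMem _ hinj hj'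
        simp at h1
        omega
      obtain rfl : m = r := by omega
      have : Mono α := SimplexCategory.mono_iff_injective.2 hinj
      obtain ⟨i, rfl⟩ := SimplexCategory.eq_δ_of_mono α
      have hrange (a : Fin (m + 2)) (ha : a ≠ i) :
          a ∈ Set.range (SimplexCategory.δ i).toOrderHom := by
        obtain ⟨b, hb⟩ := Fin.exists_succAbove_eq ha
        exact ⟨b, hb⟩
      obtain rfl : j = i := by
        by_contra hji
        exact hj' (hrange j hji)
      by_cases hn : j.val + 1 = k.val ∨ j.val = k.val + 1
      · exact h' j hn
      · refine h m _ h1 hinj fun a ha => hrange a ?_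
        rintro rfl
        have : a.val ≠ k.val := fun e => hj (Fin.ext e)
        omega
  · exact hM.degenerate_le m (degenerate_of_not_injective α z hinj)

/-- Provides a degeneracy of an `r`-simplex whose `k`-th face is that simplex again. The second
clause says that it collapses `k` with a neighbour; `i = k - 1` is used when `k` is the last vertex.
-/
theorem exists_σ_section {r : ℕ} (k : Fin (r + 2)) : ∃ i : Fin (r + 1),
    SimplexCategory.δ k ≫ SimplexCategory.σ i = 𝟙 _ ∧
      (i.val = k.val ∨ i.val + 1 = k.val) := by
  refine Fin.lastCases ⟨Fin.last r, ?_, .inr rfl⟩ (fun i => ⟨i, ?_, .inl rfl⟩) k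
  · exact SimplexCategory.δ_comp_σ_succ
  · exact SimplexCategory.δ_comp_σ_self

/-- Simplices of `K` whose pairs with given simplices of `L` are marked. -/
theorem IsPreMarking.slice {K L : SSet.{u}} {M : ∀ n : ℕ, Set ((K ⊗ L).obj (op (.mk n)))}
    (hM : IsPreMarking M) (S : ∀ n : ℕ, Set (L.obj (op (.mk n))))
    (hS : ∀ n, L.degenerate n ⊆ S n)
    (hd : ∀ (n : ℕ) (x : K.obj (op (.mk n))) (y : L.obj (op (.mk n))), x ∈ K.degenerate n →
      y ∈ S n → @Prod.mk (K.obj (op (.mk n))) (L.obj (op (.mk n))) x y ∈ M n) :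
    IsPreMarking (K := K) fun n => {x | 1 ≤ n ∧ ∀ y ∈ S n,
      @Prod.mk (K.obj (op (.mk n))) (L.obj (op (.mk n))) x y ∈ M n} where
  zero x h := absurd h.1 (by omega)
  degenerate_le n x hx := ⟨degenerate_pos hx, fun y hy => hd n x y hx hy⟩
  forced := by
    refine Forced.of_opposite_face (fun n x hx => ⟨degenerate_pos hx, fun y hy => hd n x y hx hy⟩)
      fun r k hr z hz => ⟨hr, fun y hy => ?_⟩
    obtain ⟨i, hi, hik⟩ := exists_σ_section k
    -- Pairing `z` with the degeneracy `σ_i y` gives an `(r + 1)`-simplex of the product with `k`-th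
    -- face `(δ_k z, y)`, to which the forcing for `M` can be applied.
    have e : (K ⊗ L).map (SimplexCategory.δ k).op
        (@Prod.mk (K.obj _) (L.obj _) z (L.map (SimplexCategory.σ i).op y)) =
        @Prod.mk (K.obj _) (L.obj _) (K.map (SimplexCategory.δ k).op z) y := by
      refine Prod.ext rfl ?_
      change L.map (SimplexCategory.δ k).op (L.map (SimplexCategory.σ i).op y) = y
      rw [← fmap_comp, ← op_comp, hi]
      exact fmap_id L _ y
    rw [← e]
    refine hM.forced (r + 1) k (by omega) _ (fun m α hα => ?_) r (SimplexCategory.δ k)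
      (.inr ⟨hr, by omega⟩)
    refine (hz m α hα).2 _ ?_
    change L.map α.op (L.map (SimplexCategory.σ i).op y) ∈ S m
    rw [← fmap_comp, ← op_comp]
    -- Without injectivity this component is degenerate, hence in `S`. With injectivity, `α` misses
    -- one of the two vertices collapsed by `σ i`, which are among `k` and its neighbours. Then `α`
    -- is a horn face of dimension `r` and a section of `σ i`, so the component is `y` itself. Thus
    -- `S` need not be closed under faces.
    by_cases hinj : Function.Injective (α ≫ SimplexCategory.σ i).toOrderHom
    · have hα' : Function.Injective α.toOrderHom := fun a b hab =>
        hinj (congrArg (SimplexCategory.σ i).toOrderHom hab)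
      have hm : m ≤ r := by
        have := Fintype.card_le_of_injective _ hinj
        simpa using this
      have hσ : (SimplexCategory.σ i).toOrderHom i.castSucc =
          (SimplexCategory.σ i).toOrderHom i.succ := by
        simp [SimplexCategory.σ, SimplexCategory.mkHom]
      rcases marked_prime_cases hα with h1 | h1 | ⟨-, h1, h2⟩
      · exact absurd hα' h1
      · obtain ⟨a, ha⟩ := h1.2 i.castSucc (by simp; omega)
        obtain ⟨b, hb⟩ := h1.2 i.succ (by simp; omega)
        have hab : a = b := hinj (by
          change (SimplexCategory.σ i).toOrderHom (α.toOrderHom a) =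
            (SimplexCategory.σ i).toOrderHom (α.toOrderHom b)
          rw [ha, hb, hσ])
        rw [hab, hb] at ha
        exact absurd ha (by simp [Fin.ext_iff])
      · obtain rfl : m = r := by omega
        have : Mono (α ≫ SimplexCategory.σ i) := SimplexCategory.mono_iff_injective.2 hinj
        have e1 : α ≫ SimplexCategory.σ i = 𝟙 _ := SimplexCategory.eq_id_of_mono _
        rw [e1]
        exact (fmap_id L _ y).symm ▸ hy
    · exact hS m (degenerate_of_not_injective _ y hinj)

end Forcing

/-! ### Simplices of a cube described by jump times. -/

section Chains

/-- The simplex of `[1]^n` in which the coordinate `j` becomes `true` at the vertex `t j`. -/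
def chain {n : ℕ} (t : Fin n → ℕ) (r : ℕ) : Fin (r + 1) →o Cube n where
  -- Time `0` encodes a coordinate that is constantly `true`, any time above `r` one that is
  -- constantly `false`.
  toFun p j := decide (t j ≤ p.val)
  monotone' p q h j := by
    have h' : p.val ≤ q.val := h
    by_cases hp : t j ≤ p.val
    · have hq : t j ≤ q.val := hp.trans h'
      simp [hq]
    · simp [hp]

theorem chain_eq_true_iff {r n : ℕ} (t : Fin n → ℕ) (p : Fin (r + 1)) (j : Fin n) :
    chain t r p j = true ↔ t j ≤ p.val :=
  decide_eq_true_iff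

theorem chain_eq_false_iff {r n : ℕ} (t : Fin n → ℕ) (p : Fin (r + 1)) (j : Fin n) :
    chain t r p j = false ↔ p.val < t j :=
  decide_eq_false_iff_not.trans not_le

theorem exists_chain {r n : ℕ} (φ : Fin (r + 1) →o Cube n) : ∃ t, φ = chain t r := by
  classical
  have ex (j : Fin n) : ∃ k : ℕ, ∀ p : Fin (r + 1), k ≤ p.val → φ p j = true :=
    -- Vacuous witness: a coordinate that never becomes `true` receives the time `r + 1`.
    ⟨r + 1, fun p hp => absurd p.isLt (by omega)⟩
  refine ⟨fun j => Nat.find (ex j), OrderHom.ext _ _ (funext fun p => funext fun j => ?_)⟩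
  change φ p j = decide (Nat.find (ex j) ≤ p.val)
  by_cases h : Nat.find (ex j) ≤ p.val
  · rw [Nat.find_spec (ex j) p h]
    simp [h]
  · have h1 : ¬ φ p j = true := fun hp => h (Nat.find_min' (ex j) fun q hq =>
      le_antisymm (Bool.le_true _) (hp.symm.trans_le (φ.monotone (show p ≤ q from hq) j)))
    simp [h, h1]

theorem jumps_chain_iff {r n : ℕ} (t : Fin n → ℕ) (s : Fin r → Fin n) :
    (∀ p : Fin r, chain t r p.castSucc (s p) = false ∧ chain t r p.succ (s p) = true) ↔
      ∀ p : Fin r, t (s p) = p.val + 1 := by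
  refine forall_congr' fun p => ?_
  rw [chain_eq_false_iff, chain_eq_true_iff, Fin.val_castSucc, Fin.val_succ]
  omega

/-- Deleting the vertex `k` merges the times `k` and `k + 1` and lowers all later times by one. -/
theorem chain_comp_δ {r n : ℕ} (t : Fin n → ℕ) (k : Fin (r + 2)) :
    (chain t (r + 1)).comp (SimplexCategory.δ k).toOrderHom =
      chain (fun j => if t j ≤ k.val then t j else t j - 1) r := by
  refine OrderHom.ext _ _ (funext fun p => funext fun j => ?_)
  change decide (t j ≤ (k.succAbove p).val) =
    decide ((if t j ≤ k.val then t j else t j - 1) ≤ p.val)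
  rw [val_succAbove]
  congr 1
  apply propext
  split_ifs <;> omega

open Classical in
/-- The distance of the coordinate `j` from leaving the jump sequence `s`. -/
noncomputable def jumpWeight {r n : ℕ} (s : Fin r → Fin n) (t : Fin n → ℕ) (j : Fin n) : ℕ :=
  -- For `1 ≤ t j ≤ r` the condition says `j ≤ s (t j - 1)`, where `s (t j - 1)` is the member of
  -- the sequence that jumps at the same time. A coordinate on this side can only be delayed while
  -- `s` survives, and `r + 1 - t j` counts the steps it has left. A coordinate on the other side
  -- can only be advanced, and has `t j` steps left.
  if ∀ p : Fin r, s p < j → p.val + 1 < t j then r + 1 - t j else t j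

/-- Delay until the vertex `i + 1` the coordinates below `c` which jump at the vertex `i`. -/
def delay {n : ℕ} (t : Fin n → ℕ) (i : ℕ) (c : Fin n) (j : Fin n) : ℕ :=
  if t j = i ∧ j < c then i + 1 else t j

/-- Advance to the vertex `i - 1` the coordinates from `c` on which jump at the vertex `i`. -/
def advance {n : ℕ} (t : Fin n → ℕ) (i : ℕ) (c : Fin n) (j : Fin n) : ℕ :=
  if t j = i ∧ c ≤ j then i - 1 else t j

/-! ### Delaying and advancing keep no new jump sequences and lower the weight. -/

section Weight

variable {r n : ℕ} {s : Fin r → Fin n} {t : Fin n → ℕ} {i : ℕ} {c : Fin n}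

/-- Delaying creates no jump sequences. If `s p` were delayed, then `p = i`, and the smaller
coordinate `s (i - 1)` would have to jump at time `i` although it lies below `c`; but below `c`
nothing jumps at time `i` any more. -/
theorem jumps_of_delay (hs : StrictMono s) (hi : 1 ≤ i)
    (h : ∀ p, delay t i c (s p) = p.val + 1) : ∀ p, t (s p) = p.val + 1 := by
  intro p
  have hp := h p
  unfold delay at hp
  split_ifs at hp with h1
  · have h2 := h ⟨i - 1, by omega⟩
    have h3 : s ⟨i - 1, by omega⟩ < s p := hs (Fin.lt_def.2 (by simp; omega))
    unfold delay at h2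
    have h4 := h3.trans h1.2
    split_ifs at h2 with h5
    · simp at h2; omega
    · simp at h2
      exact absurd ⟨by omega, h4⟩ h5
  · exact hp

/-- Mirror image of `jumps_of_delay`: if `s p` were advanced, the larger coordinate `s (i - 1)`
would be advanced with it, leaving nothing to jump at time `i`. -/
theorem jumps_of_advance (hs : StrictMono s) (hi : 1 ≤ i) (hir : i ≤ r)
    (h : ∀ p, advance t i c (s p) = p.val + 1) : ∀ p, t (s p) = p.val + 1 := by
  intro p
  have hp := h p
  unfold advance at hp
  split_ifs at hp with h1
  · have h2 := h ⟨i - 1, by omega⟩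
    have h3 : s p < s ⟨i - 1, by omega⟩ := hs (Fin.lt_def.2 (by simp; omega))
    unfold advance at h2
    have h4 := h1.2.trans h3.le
    split_ifs at h2 with h5
    · simp at h2
    · simp at h2
      exact absurd ⟨by omega, h4⟩ h5
  · exact hp

/-- As `s` survives, `s (i - 1)` is not delayed, so it is at least `c` and every delayed coordinate
lies below it. The first branch of `jumpWeight` then applies before and after the delay, and its
value drops by one. The weight of any other coordinate depends only on its unchanged time. -/
theorem weight_delay_lt (hs : StrictMono s) (hi : 1 ≤ i) (hir : i ≤ r)
    (h : ∀ p, delay t i c (s p) = p.val + 1) {b : Fin n} (hb : t b = i) (hbc : b < c) :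
    ∑ j, jumpWeight s (delay t i c) j < ∑ j, jumpWeight s t j := by
  have key (j : Fin n) (hj : t j = i ∧ j < c) :
      jumpWeight s (delay t i c) j < jumpWeight s t j := by
    have e : delay t i c j = i + 1 := if_pos hj
    have hp : ∀ p : Fin r, s p < j → p.val + 1 < i := by
      intro p hp
      by_contra hlt
      have h1 : s ⟨i - 1, by omega⟩ ≤ s p := hs.monotone (Fin.le_def.2 (by simp; omega))
      have h2 := h ⟨i - 1, by omega⟩
      have h3 := jumps_of_delay hs hi h ⟨i - 1, by omega⟩
      have h4 : delay t i c (s ⟨i - 1, by omega⟩) = i + 1 :=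
        if_pos ⟨by rw [h3]; exact Nat.sub_add_cancel hi, (h1.trans_lt hp).trans hj.2⟩
      rw [h4] at h2
      simp at h2
      omega
    unfold jumpWeight
    rw [e, hj.1, if_pos fun p h => by have := hp p h; omega, if_pos hp]
    omega
  refine Finset.sum_lt_sum (fun j _ => ?_) ⟨b, Finset.mem_univ _, key b ⟨hb, hbc⟩⟩
  by_cases hj : t j = i ∧ j < c
  · exact (key j hj).le
  · have e : delay t i c j = t j := if_neg hj
    unfold jumpWeight
    rw [e]

/-- Here `s (i - 1)` is not advanced, so it lies below `c` and below every advanced coordinate. The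
second branch of `jumpWeight` applies before and after, with values `i` and `i - 1`. -/
theorem weight_advance_lt (hs : StrictMono s) (hi : 1 ≤ i) (hir : i ≤ r)
    (h : ∀ p, advance t i c (s p) = p.val + 1) (hc : t c = i) :
    ∑ j, jumpWeight s (advance t i c) j < ∑ j, jumpWeight s t j := by
  have key (j : Fin n) (hj : t j = i ∧ c ≤ j) :
      jumpWeight s (advance t i c) j < jumpWeight s t j := by
    have e : advance t i c j = i - 1 := if_pos hj
    have hp : s ⟨i - 1, by omega⟩ < j := by
      by_contra hlt
      have h2 := h ⟨i - 1, by omega⟩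
      have h3 := jumps_of_advance hs hi hir h ⟨i - 1, by omega⟩
      have h4 : advance t i c (s ⟨i - 1, by omega⟩) = i - 1 :=
        if_pos ⟨by rw [h3]; exact Nat.sub_add_cancel hi, hj.2.trans (not_lt.1 hlt)⟩
      rw [h4] at h2
      simp at h2
    unfold jumpWeight
    rw [e, hj.1, if_neg fun h => by have := h _ hp; simp at this,
      if_neg fun h => by have := h _ hp; simp at this; omega]
    omega
  refine Finset.sum_lt_sum (fun j _ => ?_) ⟨c, Finset.mem_univ _, key c ⟨hc, le_rfl⟩⟩
  by_cases hj : t j = i ∧ c ≤ j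
  · exact (key j hj).le
  · have e : advance t i c j = t j := if_neg hj
    unfold jumpWeight
    rw [e]

end Weight

/-! ### Faces of a cube along a sequence of coordinates. -/

open Classical in
/-- The face of `[1]^n` with the free coordinates `s`, and the other coordinates as in `v`. -/
noncomputable def subface {r n : ℕ} (s : Fin r → Fin n) (v : Cube n) (x : Cube r) : Cube n :=
  fun j => if h : ∃ p, s p = j then x h.choose else v j

theorem subface_apply {r n : ℕ} {s : Fin r → Fin n} (hs : StrictMono s) (v : Cube n) (x : Cube r)
    (p : Fin r) : subface s v x (s p) = x p := by
  have h : ∃ q, s q = s p := ⟨p, rfl⟩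
  unfold subface
  rw [dif_pos h, hs.injective h.choose_spec]

theorem subface_of_notMem {r n : ℕ} {s : Fin r → Fin n} (v : Cube n) (x : Cube r)
    {j : Fin n} (hj : ∀ p, s p ≠ j) : subface s v x j = v j := by
  unfold subface
  rw [dif_neg fun h => hj _ h.choose_spec]

theorem face_succAbove {n : ℕ} (i : Fin (n + 1)) (ε : Bool) (x : Cube n) (j : Fin n) :
    face i ε x (i.succAbove j) = x j := by
  unfold face
  have h := val_succAbove i j
  split_ifs at h with h1
  · rw [dif_pos (by omega)]
    exact congrArg x (Fin.ext h)
  · rw [dif_neg (by omega), dif_pos (by omega)]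
    exact congrArg x (Fin.ext (by simp; omega))

theorem face_self {n : ℕ} (i : Fin (n + 1)) (ε : Bool) (x : Cube n) : face i ε x i = ε := by
  unfold face
  rw [dif_neg (by omega), dif_neg (by omega)]

/-- A coordinate `i` missed by `s` is constant, so the map factors through the elementary face that
inserts `v i`. If no coordinate is missed, `s` and the map are identities. -/
theorem isBoxMap_subface {r n : ℕ} {s : Fin r → Fin n} (hs : StrictMono s) (v : Cube n) :
    IsBoxMap (subface s v) := by
  induction n with
  | zero =>
    obtain rfl : r = 0 := by
      have := Fintype.card_le_of_injective s hs.injective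
      simpa using this
    convert IsBoxMap.id 0 using 2
  | succ n ih =>
    by_cases hsurj : Function.Surjective s
    · obtain rfl : r = n + 1 := by
        have := Fintype.card_of_bijective ⟨hs.injective, hsurj⟩
        simpa using this
      convert IsBoxMap.id (n + 1) using 2 with x
      funext j
      have e : s j = j := by
        have : s = id := StrictMono.eq_id hs
        rw [this]; rfl
      conv_lhs => rw [← e]
      exact subface_apply hs v x j
    · obtain ⟨i, hi⟩ : ∃ i, ∀ p, s p ≠ i := by
        by_contra hc
        push Not at hc
        exact hsurj hc
      choose s' hs' using fun p => Fin.exists_succAbove_eq (hi p)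
      have hmono : StrictMono s' := fun p q hpq => by
        have h := hs hpq
        rw [← hs' p, ← hs' q] at h
        exact (Fin.strictMono_succAbove i).lt_iff_lt.1 h
      convert (ih hmono fun j => v (i.succAbove j)).comp (IsBoxMap.face i (v i)) using 2 with x
      funext j
      by_cases hj : j = i
      · rw [hj, face_self]
        exact subface_of_notMem v x hi
      · obtain ⟨j, rfl⟩ := Fin.exists_succAbove_eq hj
        rw [face_succAbove]
        by_cases hp : ∃ p, s' p = j
        · obtain ⟨p, rfl⟩ := hp
          rw [subface_apply hmono, hs' p, subface_apply hs]
        · push Not at hp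
          rw [subface_of_notMem _ _ hp, subface_of_notMem]
          intro p hp'
          rw [← hs' p] at hp'
          exact hp p (Fin.succAbove_right_injective hp')

/-- The simplex of `[1]^r` in which the coordinates become `true` one after another. -/
def longChain (r : ℕ) : Fin (r + 1) →o Cube r := chain (fun q => q.val + 1) r

/-- A simplex of `[1]^n` in which the coordinates `s` become `true` one after another, and the
other coordinates are constant. -/
noncomputable def subfaceChain {r n : ℕ} {s : Fin r → Fin n} (hs : StrictMono s) (v : Cube n) :
    Fin (r + 1) →o Cube n :=
  (⟨subface s v, (isBoxMap_subface hs v).monotone⟩ : Cube r →o Cube n).comp (longChain r)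

/-- The sequence `s` already occupies each of the times `1, …, r`. If no such time is shared, every
other coordinate has time `0` or a time above `r`, hence is constant. -/
theorem chain_eq_subfaceChain {r n : ℕ} {s : Fin r → Fin n} (hs : StrictMono s) {t : Fin n → ℕ}
    (h : ∀ p, t (s p) = p.val + 1)
    (hinj : ∀ j j', 1 ≤ t j → t j ≤ r → t j = t j' → j = j') :
    chain t r = subfaceChain hs fun j => decide (t j = 0) := by
  refine OrderHom.ext _ _ (funext fun p => funext fun j => ?_)
  change decide (t j ≤ p.val) = subface s (fun j => decide (t j = 0)) (longChain r p) j
  by_cases hj : ∃ q, s q = j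
  · obtain ⟨q, rfl⟩ := hj
    rw [subface_apply hs, h]
    rfl
  · push Not at hj
    rw [subface_of_notMem _ _ hj]
    have h1 : t j = 0 ∨ r < t j := by
      by_contra hc
      push Not at hc
      have h2 := h ⟨t j - 1, by omega⟩
      change _ = t j - 1 + 1 at h2
      exact hj _ (hinj (s ⟨t j - 1, by omega⟩) j (by omega) (by omega) (by omega))
    have := p.isLt
    congr 1
    apply propext
    omega

/-! ### Separating coordinates that jump together. -/

/-- Insert a vertex before the vertex `i`, at which those of the coordinates jumping at the vertex
`i` that are not below `c` jump. -/
def insertVertex {n : ℕ} (t : Fin n → ℕ) (i : ℕ) (c : Fin n) (j : Fin n) : ℕ :=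
  if t j < i ∨ (t j = i ∧ c ≤ j) then t j else t j + 1

/-- This and the next two lemmas compute the faces around the inserted vertex. Deleting it reunites
the two groups, deleting its successor leaves the lower group at time `i + 1`, and deleting its
predecessor moves the upper group to time `i - 1`. -/
theorem insertVertex_face {n : ℕ} (t : Fin n → ℕ) (i : ℕ) (c : Fin n) :
    (fun j => if insertVertex t i c j ≤ i then insertVertex t i c j
      else insertVertex t i c j - 1) = t := by
  funext j
  unfold insertVertex
  split_ifs <;> omega

theorem insertVertex_face_succ {n : ℕ} (t : Fin n → ℕ) (i : ℕ) (c : Fin n) :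
    (fun j => if insertVertex t i c j ≤ i + 1 then insertVertex t i c j
      else insertVertex t i c j - 1) = delay t i c := by
  funext j
  unfold insertVertex delay
  rcases le_or_gt c j with h | h
  · have h' := not_lt.2 h
    simp only [h, h', and_true, and_false, if_false]
    split_ifs <;> omega
  · have h' := not_le.2 h
    simp only [h, h', and_true, and_false, or_false]
    split_ifs <;> omega

theorem insertVertex_face_pred {n : ℕ} (t : Fin n → ℕ) {i k : ℕ} (hk : k + 1 = i) (c : Fin n) :
    (fun j => if insertVertex t i c j ≤ k then insertVertex t i c j
      else insertVertex t i c j - 1) = advance t i c := by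
  funext j
  unfold insertVertex advance
  rcases le_or_gt c j with h | h
  · simp only [h, and_true]
    split_ifs <;> omega
  · have h' := not_le.2 h
    simp only [h', and_false, or_false, if_false]
    split_ifs <;> omega

/-- The vertices `i - 1`, `i`, `i + 1` remain consecutive in the face. A jump sequence would use a
coordinate from `c` on for the first of these steps and one below `c` for the second, so it could
not increase. -/
theorem not_jumps_of_hitsNeighbours {r n m : ℕ} (t : Fin n → ℕ) (i : Fin (r + 2)) (c : Fin n)
    (hi : 1 ≤ i.val) (hir : i.val ≤ r) (α : SimplexCategory.mk m ⟶ .mk (r + 1))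
    (hα : Function.Injective α.toOrderHom) (hn : HitsNeighbours i α) :
    ¬ Jumps fun p => chain (insertVertex t i.val c) (r + 1) (α.toOrderHom p) := by
  rintro ⟨s, hs, h⟩
  have hmono : StrictMono α.toOrderHom := α.toOrderHom.monotone.strictMono_of_injective hα
  obtain ⟨a, ha⟩ := hn ⟨i.val - 1, by omega⟩ (.inl (by simp; omega))
  obtain ⟨b, hb⟩ := hn i (.inr (.inl rfl))
  obtain ⟨d, hd⟩ := hn ⟨i.val + 1, by omega⟩ (.inr (.inr rfl))
  have hab : a < b := hmono.lt_iff_lt.1 (by rw [ha, hb]; exact show i.val - 1 < i.val by omega)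
  have hbd : b < d := hmono.lt_iff_lt.1 (by rw [hb, hd]; exact show i.val < i.val + 1 by omega)
  have hab' : a.val + 1 = b.val := by
    by_contra hne
    have h1 : a.val < b.val := hab
    have hlt := b.isLt
    have h2 := hmono (show a < ⟨a.val + 1, by omega⟩ from Fin.lt_def.2 (by simp))
    have h3 := hmono (show ⟨a.val + 1, by omega⟩ < b from Fin.lt_def.2 (by simp; omega))
    rw [ha, Fin.lt_def] at h2
    rw [hb, Fin.lt_def] at h3
    simp at h2
    omega
  have hbd' : b.val + 1 = d.val := by
    by_contra hne
    have h1 : b.val < d.val := hbd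
    have hlt := d.isLt
    have h2 := hmono (show b < ⟨b.val + 1, by omega⟩ from Fin.lt_def.2 (by simp))
    have h3 := hmono (show ⟨b.val + 1, by omega⟩ < d from Fin.lt_def.2 (by simp; omega))
    rw [hb, Fin.lt_def] at h2
    rw [hd, Fin.lt_def] at h3
    simp at h3
    omega
  have hdm : d.val < m + 1 := d.isLt
  obtain ⟨h1, h2⟩ := h ⟨a.val, by omega⟩
  obtain ⟨h3, h4⟩ := h ⟨b.val, by omega⟩
  have e1 : (⟨a.val, by omega⟩ : Fin m).castSucc = a := rfl
  have e2 : (⟨a.val, by omega⟩ : Fin m).succ = b := Fin.ext hab'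
  have e3 : (⟨b.val, by omega⟩ : Fin m).castSucc = b := rfl
  have e4 : (⟨b.val, by omega⟩ : Fin m).succ = d := Fin.ext hbd'
  have hlt : s ⟨a.val, by omega⟩ < s ⟨b.val, by omega⟩ := hs hab
  simp only [e1, e2, e3, e4, ha, hb, hd, chain_eq_false_iff, chain_eq_true_iff] at h1 h2 h3 h4
  unfold insertVertex at h1 h2 h3 h4
  have c1 : c ≤ s ⟨a.val, by omega⟩ := by
    by_contra hc
    simp only [hc, and_false, or_false] at h1 h2
    split_ifs at h1 h2 <;> omega
  have c2 : ¬ c ≤ s ⟨b.val, by omega⟩ := by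
    intro hc
    simp only [hc, and_true] at h3 h4
    split_ifs at h3 h4 <;> omega
  exact c2 (c1.trans hlt.le)

/-- A pre-complicial marking of the nerve of a cube that contains all simplices without jump
sequences contains a simplex as soon as it contains, for each of the jump sequences of this simplex,
the simplices that jump along the sequence and are constant in the other coordinates. -/
theorem IsPreMarking.mem_of_subfaceChain {n : ℕ}
    {M : ∀ r : ℕ, Set ((cubeNerve.{u} n).obj (op (.mk r)))} (hM : IsPreMarking M)
    (hJ : ∀ (r : ℕ) (φ : Fin (r + 1) →o Cube n), ¬ Jumps φ → (⟨φ⟩ : ULift _) ∈ M r)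
    {r : ℕ} (hr : 1 ≤ r) (φ : Fin (r + 1) →o Cube n)
    (h : ∀ (s : Fin r → Fin n) (hs : StrictMono s),
      (∀ p : Fin r, φ p.castSucc (s p) = false ∧ φ p.succ (s p) = true) →
      ∀ v, (⟨subfaceChain hs v⟩ : ULift _) ∈ M r) : (⟨φ⟩ : ULift _) ∈ M r := by
  -- Induction on a common bound for the weights with respect to all jump sequences of `t`, because
  -- several may exist and each neighbouring face may keep a different part of them. For `w = 0` the
  -- hypothesis says that there are none.
  have main (w : ℕ) : ∀ t : Fin n → ℕ,
      (∀ (s : Fin r → Fin n) (hs : StrictMono s), (∀ p, t (s p) = p.val + 1) →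
        ∑ j, jumpWeight s t j < w ∧ ∀ v, (⟨subfaceChain hs v⟩ : ULift _) ∈ M r) →
      (⟨chain t r⟩ : ULift _) ∈ M r := by
    induction w with
    | zero =>
      intro t ht
      refine hJ r _ ?_
      rintro ⟨s, hs, h'⟩
      exact absurd (ht s hs ((jumps_chain_iff t s).1 h')).1 (by omega)
    | succ w ih =>
      intro t ht
      by_cases hjump : Jumps (chain t r)
      swap
      · exact hJ r _ hjump
      obtain ⟨s, hs, hst⟩ := hjump
      replace hst := (jumps_chain_iff t s).1 hst
      by_cases hinj : ∀ j j', 1 ≤ t j → t j ≤ r → t j = t j' → j = j'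
      · rw [chain_eq_subfaceChain hs hst hinj]
        exact (ht s hs hst).2 _
      · obtain ⟨b, c, hb, hbr, hbc, hlt⟩ : ∃ b c, 1 ≤ t b ∧ t b ≤ r ∧ t b = t c ∧ b < c := by
          push Not at hinj
          obtain ⟨j, j', h1, h2, h3, h4⟩ := hinj
          rcases lt_or_gt_of_ne h4 with h5 | h5
          · exact ⟨j, j', h1, h2, h3, h5⟩
          · exact ⟨j', j, by omega, by omega, h3.symm, h5⟩
        -- Splitting at the larger coordinate `c` puts `b` into the lower and `c` into the upper
        -- group. Both are nonempty, so both moves strictly lower the weight. By `1 ≤ t b ≤ r` the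
        -- new vertex has two neighbours.
        let i : Fin (r + 2) := ⟨t b, by omega⟩
        let tz := insertVertex t (t b) c
        have hδ (k : Fin (r + 2)) : (cubeNerve.{u} n).map (SimplexCategory.δ k).op
            ⟨chain tz (r + 1)⟩ =
              ⟨chain (fun j => if tz j ≤ k.val then tz j else tz j - 1) r⟩ :=
          congrArg ULift.up (chain_comp_δ tz k)
        have key := hM.face_mem hr i (⟨chain tz (r + 1)⟩ : ULift _) (fun m α _ hα hn =>
          hJ m ((chain tz (r + 1)).comp α.toOrderHom)
            (not_jumps_of_hitsNeighbours t i c hb hbr α hα hn)) ?_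
        · rw [hδ, insertVertex_face] at key
          exact key
        · rintro k (hk | hk)
          · replace hk : k.val + 1 = t b := hk
            rw [hδ, insertVertex_face_pred t hk]
            refine ih _ fun s hs hs' => ?_
            have h1 := ht s hs (jumps_of_advance hs hb hbr hs')
            exact ⟨by have := weight_advance_lt hs hb hbr hs' hbc.symm; omega, h1.2⟩
          · rw [hδ, hk]
            change (⟨chain (fun j => if insertVertex t (t b) c j ≤ t b + 1 then
              insertVertex t (t b) c j else insertVertex t (t b) c j - 1) r⟩ : ULift _) ∈ M r
            rw [insertVertex_face_succ]
            refine ih _ fun s hs hs' => ?_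
            have h1 := ht s hs (jumps_of_delay hs hb hs')
            exact ⟨by have := weight_delay_lt hs hb hbr hs' rfl hlt; omega, h1.2⟩
  obtain ⟨t, rfl⟩ := exists_chain φ
  refine main ((Finset.univ.sup fun s : Fin r → Fin n => ∑ j, jumpWeight s t j) + 1) t
    fun s hs hst => ⟨?_, h s hs ((jumps_chain_iff t s).2 hst)⟩
  exact Nat.lt_succ_of_le
    (Finset.le_sup (f := fun s : Fin r → Fin n => ∑ j, jumpWeight s t j) (Finset.mem_univ s))

end Chains

/-! ### Simplices and marking of `T X` in terms of cubes, for any left adjoint `T`. -/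

section Generators

variable {T : MCSet.{u} ⥤ PreComp.{u}} (adj : T ⊣ triangulationRight.{u})

/-- The map `τ p ⟶ T X` that belongs to an element of `X` at the object `p` of `□⁺`. -/
noncomputable def triangInj (X : MCSet.{u}) {p : BoxPlus} (x : X.obj.obj (op p)) :
    triangObj.{u} p ⟶ T.obj X :=
  ((adj.unit.app X).hom.app (op p) x).down

theorem triangInj_map {X : MCSet.{u}} {p q : BoxPlus} (f : q ⟶ p) (x : X.obj.obj (op p)) :
    (triangInj adj X (X.obj.map f.op x)).hom.map = triangMap f ≫ (triangInj adj X x).hom.map := by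
  have h := NatTrans.naturality_apply (adj.unit.app X).hom f.op x
  exact congrArg (fun k : ULift (triangObj.{u} q ⟶ T.obj X) => k.down.hom.map) h

theorem triangInj_naturality {X Y : MCSet.{u}} (g : X ⟶ Y) {p : BoxPlus} (x : X.obj.obj (op p)) :
    triangInj adj X x ≫ T.map g = triangInj adj Y (g.hom.app (op p) x) := by
  have h := congrArg (fun k => k.hom.app (op p)) (adj.unit.naturality g)
  exact (congrArg ULift.down (ConcreteCategory.congr_hom h x)).symm

theorem triangInj_hom_ext {X : MCSet.{u}} {Z : PreComp.{u}} {f g : T.obj X ⟶ Z}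
    (h : ∀ (p : BoxPlus) (x : X.obj.obj (op p)), triangInj adj X x ≫ f = triangInj adj X x ≫ g) :
    f = g := by
  refine (adj.homEquiv X Z).injective ?_
  rw [Adjunction.homEquiv_unit, Adjunction.homEquiv_unit]
  refine ObjectProperty.hom_ext _ ?_
  ext p x
  exact ULift.ext _ _ (h p.unop x)

/-- A compatible family is a map from `X` to the right adjoint applied to `Z`, and `F` is its
transpose. -/
theorem exists_triangInj_desc {X : MCSet.{u}} {Z : PreComp.{u}}
    (k : ∀ p : BoxPlus, X.obj.obj (op p) → (triangObj.{u} p ⟶ Z))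
    (hk : ∀ {p q : BoxPlus} (f : q ⟶ p) (x : X.obj.obj (op p)),
      (k q (X.obj.map f.op x)).hom.map = triangMap f ≫ (k p x).hom.map) :
    ∃ F : T.obj X ⟶ Z, ∀ p x, triangInj adj X x ≫ F = k p x := by
  let κ : X ⟶ triangulationRight.{u}.obj Z := ObjectProperty.homMk
    { app p := ↾fun x => ULift.up (k p.unop x)
      naturality p q f := by
        ext x
        exact ULift.ext _ _ (PreComp.hom_ext (hk f.unop x)) }
  refine ⟨(adj.homEquiv X Z).symm κ, fun p x => ?_⟩
  have h := (adj.homEquiv X Z).apply_symm_apply κ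
  rw [Adjunction.homEquiv_unit] at h
  have h1 := congrArg (fun k => k.hom.app (op p)) h
  exact congrArg ULift.down (ConcreteCategory.congr_hom h1 x)

/-- The map from the nerve of a cube to the triangulation of `X` that belongs to a cube of `X`. -/
noncomputable def genMap {X : MCSet.{u}} {a : Box} (x : (MCSet.forget.obj X).functor.obj (op a)) :
    cubeNerve.{u} a.dim ⟶ (T.obj X).obj.toSSet :=
  (triangIso.{u} (BoxPlus.cube a)).hom ≫ (triangInj adj X (p := BoxPlus.cube a) x).hom.map

theorem triangIso_hom_comp_triangMap {a b : BoxPlus} (f : a ⟶ b) :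
    (triangIso.{u} a).hom ≫ triangMap f =
      cubeNerveMap f.map.map f.map.isBoxMap.monotone ≫ (triangIso b).hom := by
  simp [triangMap]

theorem genMap_map {X : MCSet.{u}} {a b : Box} (f : b ⟶ a)
    (x : (MCSet.forget.obj X).functor.obj (op a)) :
    genMap adj ((MCSet.forget.obj X).functor.map f.op x) =
      cubeNerveMap f.map f.isBoxMap.monotone ≫ genMap adj x := by
  have h1 : (triangInj adj X (p := BoxPlus.cube b)
      ((MCSet.forget.obj X).functor.map f.op x)).hom.map =
      triangMap (BoxPlus.incl.map f) ≫ (triangInj adj X (p := BoxPlus.cube a) x).hom.map :=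
    triangInj_map adj (BoxPlus.incl.map f) (p := BoxPlus.cube a) x
  have h2 := triangIso_hom_comp_triangMap.{u} (BoxPlus.incl.map f)
  unfold genMap
  rw [h1]
  exact (Category.assoc _ _ _).symm.trans ((congrArg (· ≫ _) h2).trans (Category.assoc _ _ _))

/-- As `BoxPlus.psi` is the identity on cubes, the objects `[1]^n_e` contribute no simplices beyond
those of `[1]^n`. This lets `genMap` be indexed by plain cubes only. -/
theorem genMap_psi {X : MCSet.{u}} {p : BoxPlus} (x : X.obj.obj (op p)) :
    genMap adj (a := p.box) (X.obj.map (BoxPlus.psi p).op x) =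
      (triangIso.{u} p).hom ≫ (triangInj adj X x).hom.map := by
  have h1 : (triangInj adj X (p := BoxPlus.cube p.box)
      (X.obj.map (BoxPlus.psi p).op x)).hom.map =
      triangMap (BoxPlus.psi p) ≫ (triangInj adj X x).hom.map :=
    triangInj_map adj (BoxPlus.psi p) x
  have h2 := triangIso_hom_comp_triangMap.{u} (BoxPlus.psi p)
  unfold genMap
  rw [h1]
  exact (Category.assoc _ _ _).symm.trans (congrArg (· ≫ _) h2)

theorem genMap_naturality {X Y : MCSet.{u}} (g : X ⟶ Y) {a : Box}
    (x : (MCSet.forget.obj X).functor.obj (op a)) :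
    genMap adj x ≫ (T.map g).hom.map =
      genMap adj ((MCSet.forget.map g).natTrans.app (op a) x) :=
  (Category.assoc _ _ _).trans (congrArg (fun k => (triangIso.{u} (BoxPlus.cube a)).hom ≫ k.hom.map)
    (triangInj_naturality adj g (p := BoxPlus.cube a) x))

theorem genMap_hom_ext {X : MCSet.{u}} {Z : PreComp.{u}} {f g : T.obj X ⟶ Z}
    (h : ∀ (a : Box) (x : (MCSet.forget.obj X).functor.obj (op a)),
      genMap adj x ≫ f.hom.map = genMap adj x ≫ g.hom.map) : f = g := by
  refine triangInj_hom_ext adj fun p x => PreComp.hom_ext ?_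
  have h1 := h p.box (X.obj.map (BoxPlus.psi p).op x)
  rw [genMap_psi adj] at h1
  exact (cancel_epi (triangIso.{u} p).hom).1
    ((Category.assoc _ _ _).symm.trans (h1.trans (Category.assoc _ _ _)))

/-- The universal property of `T X` in terms of the underlying cubical set: compatibility is only
required for maps of `□`, and `hm` ranges over the marked simplices of `τ [1]^n`, and of `τ [1]^n_e`
when the cube is marked. -/
theorem exists_genMap_desc {X : MCSet.{u}} {Z : PreComp.{u}}
    (k : ∀ a : Box, (MCSet.forget.obj X).functor.obj (op a) →
      (cubeNerve.{u} a.dim ⟶ Z.obj.toSSet))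
    (hk : ∀ {a b : Box} (f : b ⟶ a) (x : (MCSet.forget.obj X).functor.obj (op a)),
      k b ((MCSet.forget.obj X).functor.map f.op x) =
        cubeNerveMap f.map f.isBoxMap.monotone ≫ k a x)
    (hm : ∀ (a : Box) (x : (MCSet.forget.obj X).functor.obj (op a)) (r : ℕ)
      (φ : Fin (r + 1) →o Cube a.dim), (¬ Jumps φ ∨ (X.IsMarked x ∧ a.dim ≤ r)) →
        (k a x).app (op (.mk r)) ⟨φ⟩ ∈ Z.obj.marked r) :
    ∃ F : T.obj X ⟶ Z, ∀ a x, genMap adj x ≫ F.hom.map = k a x := by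
  obtain ⟨F, hF⟩ := exists_triangInj_desc adj (X := X) (Z := Z)
    (fun p x => PreComp.homMk ((triangIso.{u} p).inv ≫
      k p.box (X.obj.map (BoxPlus.psi p).op x)) fun r z hz => by
        obtain ⟨φ, rfl⟩ : ∃ φ, (triangIso.{u} p).hom.app (op (.mk r)) φ = z :=
          ⟨(triangIso p).inv.app _ z, by
            have h := congrArg (fun k => k.app (op (.mk r))) (triangIso.{u} p).inv_hom_id
            exact ConcreteCategory.congr_hom h z⟩
        have h1 : ((triangIso.{u} p).inv ≫ k p.box (X.obj.map (BoxPlus.psi p).op x)).app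
            (op (.mk r)) ((triangIso.{u} p).hom.app (op (.mk r)) φ) =
            (k p.box (X.obj.map (BoxPlus.psi p).op x)).app (op (.mk r)) φ := by
          have h := congrArg (fun k => k.app (op (.mk r))) ((triangIso.{u} p).hom_inv_id_assoc
            (k p.box (X.obj.map (BoxPlus.psi p).op x)))
          exact ConcreteCategory.congr_hom h φ
        refine Set.mem_of_eq_of_mem h1 (hm _ _ r φ.down ?_)
        exact ((triang_mem_marked_iff.{u} p φ.down).1 hz).imp_right
          fun h => ⟨X.isMarked_psi p h.1 x, h.2⟩)
    (fun {p q} f x => by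
      change (triangIso.{u} q).inv ≫ _ = triangMap f ≫ (triangIso.{u} p).inv ≫ _
      have e : X.obj.map (BoxPlus.psi q).op (X.obj.map f.op x) =
          (MCSet.forget.obj X).functor.map f.map.op (X.obj.map (BoxPlus.psi p).op x) :=
        fmap_square X.obj (congrArg Quiver.Hom.op (BoxPlus.psi_naturality f).symm) x
      refine (congrArg (fun y => (triangIso.{u} q).inv ≫ k q.box y) e).trans ?_
      refine (congrArg ((triangIso.{u} q).inv ≫ ·) (hk f.map _)).trans ?_
      simp [triangMap])
  refine ⟨F, fun a x => ?_⟩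
  have h := congrArg (fun l => (triangIso.{u} (BoxPlus.cube a)).hom ≫ l.hom.map)
    (hF (BoxPlus.cube a) x)
  refine (Category.assoc _ _ _).trans (h.trans ?_)
  refine ((triangIso.{u} (BoxPlus.cube a)).hom_inv_id_assoc _).trans ?_
  exact congrArg (k a) (fmap_id X.obj (op (BoxPlus.cube a)) x)

/-- The simplicial set whose `k`-simplices are the families of elements of `A` indexed by the
`r`-simplices of `Δ^k`. -/
def coinduced (r : ℕ) (A : Type u) : SSet.{u} where
  obj k := (SimplexCategory.mk r ⟶ k.unop) → A
  map f := ↾fun h α => h (α ≫ f.unop)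
  map_id k := by
    ext h α
    exact congrArg h (Category.comp_id α)
  map_comp f g := by
    ext h α
    exact congrArg h
      (Category.assoc α g.unop f.unop).symm

/-- The pre-complicial set in which all simplices of positive dimension are marked. -/
abbrev PreComp.maximal (K : SSet.{u}) : PreComp.{u} := PreComp.mk' (maxMarking K) (.max K)

/-- A simplex of the triangulation of `X`, from a cube of `X` and a simplex of this cube. -/
noncomputable def gen {X : MCSet.{u}} {a : Box} (x : (MCSet.forget.obj X).functor.obj (op a))
    {r : ℕ} (φ : Fin (r + 1) →o Cube a.dim) :
    (T.obj X).obj.toSSet.obj (op (.mk r)) :=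
  (genMap adj x).app (op (.mk r)) ⟨φ⟩

theorem gen_map {X : MCSet.{u}} {a b : Box} (f : b ⟶ a)
    (x : (MCSet.forget.obj X).functor.obj (op a)) {r : ℕ} (φ : Fin (r + 1) →o Cube b.dim) :
    gen adj ((MCSet.forget.obj X).functor.map f.op x) φ =
      gen adj x ((⟨f.map, f.isBoxMap.monotone⟩ : Cube b.dim →o Cube a.dim).comp φ) := by
  unfold gen
  rw [genMap_map adj]
  rfl

theorem gen_naturality {X Y : MCSet.{u}} (g : X ⟶ Y) {a : Box}
    (x : (MCSet.forget.obj X).functor.obj (op a)) {r : ℕ} (φ : Fin (r + 1) →o Cube a.dim) :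
    (T.map g).hom.map.app (op (.mk r)) (gen adj x φ) =
      gen adj ((MCSet.forget.map g).natTrans.app (op a) x) φ := by
  unfold gen
  rw [← genMap_naturality adj]
  rfl

theorem map_gen {X : MCSet.{u}} {a : Box} (x : (MCSet.forget.obj X).functor.obj (op a))
    {r m : ℕ} (φ : Fin (r + 1) →o Cube a.dim) (α : SimplexCategory.mk m ⟶ .mk r) :
    (T.obj X).obj.toSSet.map α.op (gen adj x φ) = gen adj x (φ.comp α.toOrderHom) :=
  (NatTrans.naturality_apply (genMap adj x) α.op ⟨φ⟩).symm

theorem gen_mem_marked {X : MCSet.{u}} {a : Box} (x : (MCSet.forget.obj X).functor.obj (op a))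
    {r : ℕ} (φ : Fin (r + 1) →o Cube a.dim) (h : ¬ Jumps φ ∨ (X.IsMarked x ∧ a.dim ≤ r)) :
    gen adj x φ ∈ (T.obj X).obj.marked r := by
  rcases h with h | ⟨⟨h0, y, rfl⟩, hr⟩
  · exact (triangInj adj X (p := BoxPlus.cube a) x).hom.preserves r _
      ((triang_mem_marked_iff.{u} (BoxPlus.cube a) φ).2 (.inl h))
  · have e := genMap_psi adj (X := X) (p := BoxPlus.mcube a h0) y
    have e1 := congrArg (fun k => k.app (op (.mk r))) e
    have e2 := ConcreteCategory.congr_hom e1 ⟨φ⟩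
    refine Set.mem_of_eq_of_mem e2 ?_
    exact (triangInj adj X (p := BoxPlus.mcube a h0) y).hom.preserves r _
      ((triang_mem_marked_iff.{u} (BoxPlus.mcube a h0) φ).2 (.inr ⟨rfl, hr⟩))

/-- A map of simplicial sets to `coinduced r A` from a function on `r`-simplices. -/
def toCoinduced {K : SSet.{u}} {r : ℕ} {A : Type u} (D : K.obj (op (.mk r)) → A) :
    K ⟶ coinduced r A where
  app k := ↾fun z α => D (K.map α.op z)
  naturality k l f := by
    ext z
    refine funext fun α => congrArg D ?_
    change K.map α.op (K.map f z) = K.map (α ≫ f.unop).op z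
    rw [op_comp, fmap_comp]
    rfl

/-- Functions on `r`-simplices are maps to `coinduced r A` with maximal marking. The indicator
function of the simplices of the form `gen adj x φ` and the constant function `True` agree on every
cube, hence agree. -/
theorem exists_gen {X : MCSet.{u}} {r : ℕ}
    (z : (T.obj X).obj.toSSet.obj (op (.mk r))) :
    ∃ (a : Box) (x : (MCSet.forget.obj X).functor.obj (op a)) (φ : Fin (r + 1) →o Cube a.dim),
      z = gen adj x φ := by
  let D₁ (z : (T.obj X).obj.toSSet.obj (op (.mk r))) : ULift.{u} Prop :=
    ⟨∃ (a : Box) (x : (MCSet.forget.obj X).functor.obj (op a)) (φ : Fin (r + 1) →o Cube a.dim),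
      z = gen adj x φ⟩
  let D₂ (z : (T.obj X).obj.toSSet.obj (op (.mk r))) : ULift.{u} Prop := ⟨True⟩
  let F (D : (T.obj X).obj.toSSet.obj (op (.mk r)) → ULift.{u} Prop) :
      T.obj X ⟶ PreComp.maximal (coinduced r (ULift.{u} Prop)) :=
    PreComp.homMk (toCoinduced D) fun _ _ h => MSSet.pos h
  have e : F D₁ = F D₂ := genMap_hom_ext adj fun a x => by
    ext k φ
    refine funext fun α => ?_
    refine ULift.ext _ _ (propext ⟨fun _ => trivial, fun _ => ⟨a, x, ?_⟩⟩)
    exact ⟨φ.down.comp α.toOrderHom, map_gen adj (m := r) x φ.down α⟩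
  have e1 := congrArg (fun k => k.hom.map.app (op (.mk r))) e
  have e2 := congrFun (ConcreteCategory.congr_hom e1 z) (𝟙 _)
  have e3 : D₁ z = D₂ z := by
    have h (D : (T.obj X).obj.toSSet.obj (op (.mk r)) → ULift.{u} Prop) :
        (F D).hom.map.app (op (.mk r)) z (𝟙 _) = D z := congrArg D (fmap_id _ _ z)
    exact (h D₁).symm.trans (e2.trans (h D₂))
  have e4 := congrArg ULift.down e3
  exact e4.mpr trivial

/-- With `exists_gen`, this describes the `r`-simplices of `T X` as the quotient of the pairs `(x,
φ)` by the action of maps of cubes. The function is recovered from a map to `coinduced r A` by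
evaluation at the identity of `[r]`. -/
theorem exists_gen_desc {X : MCSet.{u}} {r : ℕ} {A : Type u}
    (d : ∀ a : Box, (MCSet.forget.obj X).functor.obj (op a) → (Fin (r + 1) →o Cube a.dim) → A)
    (hd : ∀ {a b : Box} (f : b ⟶ a) (x : (MCSet.forget.obj X).functor.obj (op a))
      (φ : Fin (r + 1) →o Cube b.dim), d b ((MCSet.forget.obj X).functor.map f.op x) φ =
        d a x ((⟨f.map, f.isBoxMap.monotone⟩ : Cube b.dim →o Cube a.dim).comp φ)) :
    ∃ D : (T.obj X).obj.toSSet.obj (op (.mk r)) → A,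
      ∀ a x φ, D (gen adj x φ) = d a x φ := by
  obtain ⟨F, hF⟩ := exists_genMap_desc adj (X := X) (Z := PreComp.maximal (coinduced r A))
    (fun a x => toCoinduced fun φ => d a x φ.down)
    (fun f x => by
      ext k φ
      exact funext fun α => hd f x _)
    (fun a x m φ h => by
      change 1 ≤ m
      rcases h with h | h
      -- A `0`-simplex has the empty jump sequence, so a simplex without jump sequence has positive
      -- dimension.
      · rcases m with _ | m
        · exact absurd ⟨fun i => i.elim0, fun i => i.elim0, fun i => i.elim0⟩ h
        · omega
      · exact h.1.pos.trans h.2)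
  refine ⟨fun z => F.hom.map.app (op (.mk r)) z (𝟙 _), fun a x φ => ?_⟩
  have e1 := congrArg (fun k => k.app (op (.mk r))) (hF a x)
  exact congrFun (ConcreteCategory.congr_hom e1 ⟨φ⟩) (𝟙 _)

/-- The generators induce a map from `T X` to the same simplicial set marked by `M`. It is the
identity on simplices, as one sees on generators after passing to the maximal marking, so its
preservation of marked simplices is the inclusion. -/
theorem marked_triangulation_le {X : MCSet.{u}}
    {M : ∀ n : ℕ, Set ((T.obj X).obj.toSSet.obj (op (.mk n)))}
    (hM : IsPreMarking M)
    (h : ∀ (a : Box) (x : (MCSet.forget.obj X).functor.obj (op a)) (r : ℕ)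
      (φ : Fin (r + 1) →o Cube a.dim), (¬ Jumps φ ∨ (X.IsMarked x ∧ a.dim ≤ r)) → gen adj x φ ∈ M r)
    (n : ℕ) : (T.obj X).obj.marked n ⊆ M n := by
  obtain ⟨F, hF⟩ := exists_genMap_desc adj (X := X) (Z := PreComp.mk' M hM) (fun a x => genMap adj x)
    (fun f x => genMap_map adj f x) h
  let i : PreComp.mk' M hM ⟶ PreComp.maximal (T.obj X).obj.toSSet :=
    PreComp.homMk (𝟙 _) fun _ _ h => MSSet.pos (X := (PreComp.mk' M hM).obj) h
  let j : T.obj X ⟶ PreComp.maximal (T.obj X).obj.toSSet :=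
    PreComp.homMk (𝟙 _) fun _ _ h => MSSet.pos h
  have e : F ≫ i = j := genMap_hom_ext adj fun a x => hF a x
  intro z hz
  have h1 := F.hom.preserves n z hz
  have e1 := congrArg (fun k => k.hom.map.app (op (.mk n))) e
  have e2 : F.hom.map.app (op (.mk n)) z = z := ConcreteCategory.congr_hom e1 z
  exact Set.mem_of_eq_of_mem (s := M n) e2.symm h1

end Generators

/-! ### Oplax monoidal structures from a terminal unit. -/

section Oplax

open CartesianMonoidalCategory

variable {C D : Type*} [Category* C] [Category* D] [MonoidalCategory C]
  [CartesianMonoidalCategory D] (t : IsTerminal (𝟙_ C))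

/-- The projection `X ⊗ Y ⟶ X` in a monoidal category with terminal unit. -/
def projLeft (X Y : C) : X ⊗ Y ⟶ X := X ◁ t.from Y ≫ (ρ_ X).hom

/-- The projection `X ⊗ Y ⟶ Y` in a monoidal category with terminal unit. -/
def projRight (X Y : C) : X ⊗ Y ⟶ Y := t.from X ▷ Y ≫ (λ_ Y).hom

theorem whiskerRight_projLeft {X X' : C} (f : X ⟶ X') (Y : C) :
    f ▷ Y ≫ projLeft t X' Y = projLeft t X Y ≫ f := by
  unfold projLeft
  rw [← whisker_exchange_assoc]
  simp

theorem whiskerRight_projRight {X X' : C} (f : X ⟶ X') (Y : C) :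
    f ▷ Y ≫ projRight t X' Y = projRight t X Y := by
  unfold projRight
  rw [← comp_whiskerRight_assoc, t.hom_ext (f ≫ t.from X') (t.from X)]

theorem whiskerLeft_projRight (X : C) {Y Y' : C} (f : Y ⟶ Y') :
    X ◁ f ≫ projRight t X Y' = projRight t X Y ≫ f := by
  unfold projRight
  rw [whisker_exchange_assoc]
  simp

theorem whiskerLeft_projLeft (X : C) {Y Y' : C} (f : Y ⟶ Y') :
    X ◁ f ≫ projLeft t X Y' = projLeft t X Y := by
  unfold projLeft
  rw [← whiskerLeft_comp_assoc, t.hom_ext (f ≫ t.from Y') (t.from Y)]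

theorem unit_projRight (Y : C) : projRight t (𝟙_ C) Y = (λ_ Y).hom := by
  unfold projRight
  rw [t.hom_ext (t.from (𝟙_ C)) (𝟙 _)]
  simp

theorem projLeft_unit (X : C) : projLeft t X (𝟙_ C) = (ρ_ X).hom := by
  unfold projLeft
  rw [t.hom_ext (t.from (𝟙_ C)) (𝟙 _)]
  simp

theorem associator_projLeft (X Y Z : C) :
    (α_ X Y Z).hom ≫ projLeft t X (Y ⊗ Z) = projLeft t (X ⊗ Y) Z ≫ projLeft t X Y := by
  have h : t.from (Y ⊗ Z) = Y ◁ t.from Z ≫ (ρ_ Y).hom ≫ t.from Y := t.hom_ext _ _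
  simp [projLeft, h, -IsTerminal.comp_from]

theorem associator_projRight_projLeft (X Y Z : C) :
    (α_ X Y Z).hom ≫ projRight t X (Y ⊗ Z) ≫ projLeft t Y Z =
      projLeft t (X ⊗ Y) Z ≫ projRight t X Y := by
  rw [← whiskerLeft_projRight]
  simp [projLeft, projRight]

theorem associator_projRight_projRight (X Y Z : C) :
    (α_ X Y Z).hom ≫ projRight t X (Y ⊗ Z) ≫ projRight t Y Z = projRight t (X ⊗ Y) Z := by
  have h : t.from (X ⊗ Y) = t.from X ▷ Y ≫ (λ_ Y).hom ≫ t.from Y := t.hom_ext _ _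
  simp [projRight, h, -IsTerminal.comp_from]

/-- A functor from a monoidal category with terminal unit to a cartesian monoidal category is
oplax monoidal. -/
@[reducible]
def oplaxMonoidalOfIsTerminal (F : C ⥤ D) : F.OplaxMonoidal where
  η := toUnit _
  δ X Y := lift (F.map (projLeft t X Y)) (F.map (projRight t X Y))
  δ_natural_left f Y := by
    ext <;> simp [← Functor.map_comp, whiskerRight_projLeft, whiskerRight_projRight]
  δ_natural_right X f := by
    ext <;> simp [← Functor.map_comp, whiskerLeft_projLeft, whiskerLeft_projRight]
  oplax_associativity X Y Z := by
    ext
    · simp [← Functor.map_comp, associator_projLeft]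
    · simp [← Functor.map_comp, associator_projRight_projLeft]
    · simp [← Functor.map_comp, associator_projRight_projRight]
  oplax_left_unitality X := by
    ext
    simp [unit_projRight]
  oplax_right_unitality X := by
    ext
    simp [projLeft_unit]

end Oplax

/-! ### Terminality of the cubical unit, and the projections on cubes. -/

section Unit

instance Box.subsingleton_hom_unit (a : Box) : Subsingleton (a ⟶ 𝟙_ Box) where
  allEq _ _ := Box.hom_ext fun _ => funext fun i => i.elim0

/-- The map from a cube to the point. -/
def Box.toPoint (a : Box) : a ⟶ 𝟙_ Box := ⟨fun _ => Fin.elim0, .const _⟩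

/-- Maps of cubes to `[1]^0` are unique, so the unit has exactly one cube in each dimension; hence
it is terminal. -/
theorem MCSet.eq_map_pt {a : Box} (w : (MCSet.forget.obj MCSet.unit.{u}).functor.obj (op a)) :
    w = (MCSet.forget.obj MCSet.unit).functor.map a.toPoint.op MCSet.pt := by
  obtain ⟨p, hp⟩ := MCSet.exists_pt w
  rw [hp, Subsingleton.elim p a.toPoint]

/-- The map to the unit of the pseudo Gray tensor product. -/
noncomputable def MCSet.toUnit (X : MCSet.{u}) : X ⟶ MCSet.unit :=
  MCSet.lift ⟨{ app a := ↾fun _ =>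
                  (MCSet.forget.obj MCSet.unit).functor.map a.unop.toPoint.op MCSet.pt
                naturality a b f := by
                  ext x
                  exact (MCSet.eq_map_pt (a := b.unop) _).symm }⟩
    -- A marked cube has positive dimension, so its image factors through the point along a
    -- degenerate map.
    fun a z hz => .deg ⟨𝟙_ Box, a.toPoint, MCSet.pt, .const _ hz.pos, rfl⟩

/-- The unit of the pseudo Gray tensor product is terminal. -/
noncomputable def MCSet.isTerminalUnit : IsTerminal (𝟙_ MCSet.{u}) :=
  IsTerminal.ofUniqueHom MCSet.toUnit fun X f => MCSet.forget.map_injective (by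
    apply DayFunctor.hom_ext
    ext a x
    exact (MCSet.eq_map_pt (a := a.unop) _).trans (MCSet.eq_map_pt (a := a.unop) _).symm)

theorem MCSet.pseudoMap_ptens {X X' Y Y' : MCSet.{u}} (f : X ⟶ X') (g : Y ⟶ Y') {a b : Box}
    (x : (MCSet.forget.obj X).functor.obj (op a)) (y : (MCSet.forget.obj Y).functor.obj (op b)) :
    (MCSet.forget.map (MCSet.pseudoMap f g)).natTrans.app _ (MCSet.ptens x y) =
      MCSet.ptens ((MCSet.forget.map f).natTrans.app _ x)
        ((MCSet.forget.map g).natTrans.app _ y) := by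
  rw [MCSet.forget_map_pseudoMap]
  exact congrArg ((MCSet.pseudoIso X' Y').hom.natTrans.app _) (tens_hom _ _ x y)

/-- The projection of a product of cubes to the first factor. -/
def Box.fst (a b : Box) : a ⊗ b ⟶ a := (𝟙 a ⊗ₘ b.toPoint) ≫ (ρ_ a).hom

/-- The projection of a product of cubes to the second factor. -/
def Box.snd (a b : Box) : a ⊗ b ⟶ b := (a.toPoint ⊗ₘ 𝟙 b) ≫ (λ_ b).hom

/-- The projection replaces `y` by the unique cube of the unit of its dimension, and the right
unitor then restricts `x` along the projection of cubes. -/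
theorem MCSet.projLeft_ptens {X Y : MCSet.{u}} {a b : Box}
    (x : (MCSet.forget.obj X).functor.obj (op a)) (y : (MCSet.forget.obj Y).functor.obj (op b)) :
    (MCSet.forget.map (projLeft MCSet.isTerminalUnit X Y)).natTrans.app (op (a ⊗ b))
      (MCSet.ptens x y) = (MCSet.forget.obj X).functor.map (Box.fst a b).op x := by
  have h1 := MCSet.pseudoMap_ptens (𝟙 X) (MCSet.isTerminalUnit.from Y) x y
  have h2 : MCSet.forget.map (ρ_ X).hom = (MCSet.rightIso X).hom :=
    MCSet.forget_map_liftIso _ _ _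
  have h3 := congrArg (fun k => k.natTrans.app (op (a ⊗ b))) h2
  have h4 := MCSet.eq_map_pt ((MCSet.forget.map (MCSet.isTerminalUnit.from Y)).natTrans.app _ y)
  refine (congrArg ((MCSet.forget.map (ρ_ X).hom).natTrans.app (op (a ⊗ b))) h1).trans ?_
  refine (ConcreteCategory.congr_hom h3 _).trans ?_
  refine (congrArg (fun w => (MCSet.rightIso X).hom.natTrans.app (op (a ⊗ b))
    (MCSet.ptens x w)) h4).trans ?_
  exact MCSet.rightIso_hom _ x

theorem MCSet.projRight_ptens {X Y : MCSet.{u}} {a b : Box}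
    (x : (MCSet.forget.obj X).functor.obj (op a)) (y : (MCSet.forget.obj Y).functor.obj (op b)) :
    (MCSet.forget.map (projRight MCSet.isTerminalUnit X Y)).natTrans.app (op (a ⊗ b))
      (MCSet.ptens x y) = (MCSet.forget.obj Y).functor.map (Box.snd a b).op y := by
  have h1 := MCSet.pseudoMap_ptens (MCSet.isTerminalUnit.from X) (𝟙 Y) x y
  have h2 : MCSet.forget.map (λ_ Y).hom = (MCSet.leftIso Y).hom :=
    MCSet.forget_map_liftIso _ _ _
  have h3 := congrArg (fun k => k.natTrans.app (op (a ⊗ b))) h2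
  have h4 := MCSet.eq_map_pt ((MCSet.forget.map (MCSet.isTerminalUnit.from X)).natTrans.app _ x)
  refine (congrArg ((MCSet.forget.map (λ_ Y).hom).natTrans.app (op (a ⊗ b))) h1).trans ?_
  refine (ConcreteCategory.congr_hom h3 _).trans ?_
  refine (congrArg (fun w => (MCSet.leftIso Y).hom.natTrans.app (op (a ⊗ b))
    (MCSet.ptens w y)) h4).trans ?_
  exact MCSet.leftIso_hom _ y

end Unit

/-! ### Simplices of a product of cubes as pairs. -/

section Pairing

/-- The simplex of a product of cubes with given components. -/
def pairHom {r : ℕ} {a b : Box} (φ : Fin (r + 1) →o Cube a.dim) (ψ : Fin (r + 1) →o Cube b.dim) :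
    Fin (r + 1) →o Cube (a ⊗ b).dim where
  toFun p := Fin.append (φ p) (ψ p)
  monotone' p q h := fun i => Fin.addCases
    (fun i => by simpa only [Fin.append_left] using φ.monotone h i)
    (fun i => by simpa only [Fin.append_right] using ψ.monotone h i) i

/-- A map of cubes as a monotone map. -/
def Box.Hom.orderHom {a b : Box} (f : Box.Hom a b) : Cube a.dim →o Cube b.dim :=
  ⟨f.map, f.isBoxMap.monotone⟩

theorem Box.fst_map (a b : Box) (x : Cube (a ⊗ b).dim) (i : Fin a.dim) :
    (Box.fst a b).map x i = x (Fin.castAdd b.dim i) :=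
  tensorMap_castAdd (fun x : Cube a.dim => x) b.toPoint.map x i

theorem Box.snd_map (a b : Box) (x : Cube (a ⊗ b).dim) (i : Fin b.dim) :
    (Box.snd a b).map x i = x (Fin.natAdd a.dim i) := by
  change tensorMap a.toPoint.map (fun x => x) x (Fin.cast (Nat.zero_add b.dim).symm i) = _
  have e : Fin.cast (Nat.zero_add b.dim).symm i = Fin.natAdd 0 i := by ext; simp
  rw [e]
  exact tensorMap_natAdd a.toPoint.map (fun x : Cube b.dim => x) x i

theorem pairHom_fst_snd {r : ℕ} {a b : Box} (χ : Fin (r + 1) →o Cube (a ⊗ b).dim) :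
    pairHom ((Box.fst a b).orderHom.comp χ) ((Box.snd a b).orderHom.comp χ) = χ := by
  refine OrderHom.ext _ _ (funext fun p => cube_add_ext (fun i => ?_) fun i => ?_)
  · exact (Fin.append_left _ _ i).trans (Box.fst_map a b (χ p) i)
  · exact (Fin.append_right _ _ i).trans (Box.snd_map a b (χ p) i)

theorem fst_pairHom {r : ℕ} {a b : Box} (φ : Fin (r + 1) →o Cube a.dim)
    (ψ : Fin (r + 1) →o Cube b.dim) : (Box.fst a b).orderHom.comp (pairHom φ ψ) = φ :=
  OrderHom.ext _ _ (funext fun _ => funext fun i =>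
    (Box.fst_map a b _ i).trans (Fin.append_left _ _ i))

theorem snd_pairHom {r : ℕ} {a b : Box} (φ : Fin (r + 1) →o Cube a.dim)
    (ψ : Fin (r + 1) →o Cube b.dim) : (Box.snd a b).orderHom.comp (pairHom φ ψ) = ψ :=
  OrderHom.ext _ _ (funext fun _ => funext fun i =>
    (Box.snd_map a b _ i).trans (Fin.append_right _ _ i))

theorem tensor_comp_pairHom {r : ℕ} {a a' b b' : Box} (f : a' ⟶ a) (g : b' ⟶ b)
    (φ : Fin (r + 1) →o Cube a'.dim) (ψ : Fin (r + 1) →o Cube b'.dim) :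
    (f ⊗ₘ g).orderHom.comp (pairHom φ ψ) = pairHom (f.orderHom.comp φ) (g.orderHom.comp ψ) := by
  refine OrderHom.ext _ _ (funext fun p => cube_add_ext (fun i => ?_) fun i => ?_)
  · refine (tensorMap_castAdd f.map g.map _ i).trans ?_
    refine Eq.trans ?_ (Fin.append_left _ _ i).symm
    exact congrArg (fun x => f.map x i) (funext fun j => Fin.append_left (φ p) (ψ p) j)
  · refine (tensorMap_natAdd f.map g.map _ i).trans ?_
    refine Eq.trans ?_ (Fin.append_right _ _ i).symm
    exact congrArg (fun x => g.map x i) (funext fun j => Fin.append_right (φ p) (ψ p) j)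

end Pairing

/-- For `p < q`, the coordinate `s p` is `false` at `p` and `true` at `p + 1`, hence by monotonicity
also at `q`. -/
theorem Jumps.injective {r n : ℕ} {φ : Fin (r + 1) →o Cube n} (h : Jumps φ) :
    Function.Injective φ := by
  obtain ⟨s, -, h⟩ := h
  have key {p q : Fin (r + 1)} (hpq : p < q) : φ p ≠ φ q := by
    intro e
    have h1 : p.val < q.val := hpq
    have hq := q.isLt
    obtain ⟨h2, h3⟩ := h ⟨p.val, by omega⟩
    have h4 : φ ⟨p.val + 1, by omega⟩ ≤ φ q := φ.monotone (Fin.le_def.2 h1)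
    have h5 : φ p (s ⟨p.val, by omega⟩) = false := h2
    have h6 : φ ⟨p.val + 1, by omega⟩ (s ⟨p.val, by omega⟩) = true := h3
    have h7 := h4 (s ⟨p.val, by omega⟩)
    rw [h6, ← e, h5] at h7
    exact absurd (h7 rfl) Bool.false_ne_true
  intro p q e
  rcases lt_trichotomy p q with h | h | h
  · exact absurd e (key h)
  · exact h
  · exact absurd e.symm (key h)

theorem PreComp.isIso_of_bijective {X Y : PreComp.{u}} (f : X ⟶ Y)
    (hf : ∀ r : ℕ, Function.Bijective (f.hom.map.app (op (.mk r))))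
    (hm : ∀ (r : ℕ) (z : X.obj.toSSet.obj (op (.mk r))),
      f.hom.map.app (op (.mk r)) z ∈ Y.obj.marked r → z ∈ X.obj.marked r) : IsIso f := by
  have h1 (k : SimplexCategoryᵒᵖ) : IsIso (f.hom.map.app k) := (isIso_iff_bijective _).2 (hf _)
  have h2 : IsIso f.hom.map := NatIso.isIso_of_isIso_app _
  refine ⟨PreComp.homMk (inv f.hom.map) fun r y hy => hm r _ ?_, ?_, ?_⟩
  · have e := congrArg (fun k => k.app (op (.mk r))) (IsIso.inv_hom_id f.hom.map)
    exact Set.mem_of_eq_of_mem (ConcreteCategory.congr_hom e y) hy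
  · exact PreComp.hom_ext (IsIso.hom_inv_id f.hom.map)
  · exact PreComp.hom_ext (IsIso.inv_hom_id f.hom.map)

/-! ### The comparison maps are isomorphisms. -/

section Comparison

variable {T : MCSet.{u} ⥤ PreComp.{u}} (adj : T ⊣ triangulationRight.{u})

/-- The simplices of the triangulation that are marked because of a cube containing them. -/
def generatingMarked (X : MCSet.{u}) (r : ℕ) : Set ((T.obj X).obj.toSSet.obj (op (.mk r))) :=
  {z | ∃ (a : Box) (x : (MCSet.forget.obj X).functor.obj (op a)) (φ : Fin (r + 1) →o Cube a.dim),
    z = gen adj x φ ∧ (¬ Jumps φ ∨ (X.IsMarked x ∧ a.dim ≤ r))}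

/-- A degenerate simplex is `gen adj x` of a non-injective simplex, which has no jump sequence. This
is what allows `generatingMarked` to serve as the set `S` in `IsPreMarking.slice`. -/
theorem degenerate_le_generatingMarked (X : MCSet.{u}) (r : ℕ) :
    (T.obj X).obj.toSSet.degenerate r ⊆ generatingMarked adj X r := by
  rintro z ⟨m, hm, α, w, rfl⟩
  obtain ⟨a, x, φ, rfl⟩ := exists_gen adj w
  refine ⟨a, x, φ.comp α.toOrderHom, map_gen adj x φ α, .inl fun h => ?_⟩
  have h1 : Function.Injective α.toOrderHom := fun i j hij =>
    h.injective (congrArg φ hij)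
  have := Fintype.card_le_of_injective _ h1
  simp at this
  omega

theorem generatingMarked_pos {X : MCSet.{u}} {r : ℕ} {z : (T.obj X).obj.toSSet.obj (op (.mk r))}
    (h : z ∈ generatingMarked adj X r) : 1 ≤ r := by
  obtain ⟨a, x, φ, rfl, h⟩ := h
  exact MSSet.pos (gen_mem_marked adj x φ h)

/-- Every simplex comes from the `0`-cube `MCSet.pt`, so there is one in each dimension. In positive
dimension it has no jump sequence in `[1]^0`, so it is marked, as in the terminal object. -/
theorem isIso_unit_comparison (adj : T ⊣ triangulationRight.{u}) :
    IsIso (CartesianMonoidalCategory.toUnit (T.obj (𝟙_ MCSet.{u}))) := by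
  have key (r : ℕ) (z : (T.obj (𝟙_ MCSet.{u})).obj.toSSet.obj (op (.mk r))) :
      z = gen adj MCSet.pt (OrderHom.const _ (Fin.elim0 : Cube 0)) := by
    obtain ⟨a, w, φ, rfl⟩ := exists_gen adj z
    have h := MCSet.eq_map_pt w
    refine (congrArg (fun w => gen adj w φ) h).trans ?_
    refine (gen_map adj (X := 𝟙_ MCSet.{u}) a.toPoint MCSet.pt φ).trans ?_
    refine congrArg (gen adj (X := 𝟙_ MCSet.{u}) MCSet.pt) ?_
    exact OrderHom.ext _ _ (funext fun p => funext fun i => i.elim0)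
  refine PreComp.isIso_of_bijective _ (fun r => ⟨fun y z _ => (key r y).trans (key r z).symm,
    fun y => ⟨gen adj (X := 𝟙_ MCSet.{u}) MCSet.pt (OrderHom.const _ (Fin.elim0 : Cube 0)),
      ?_⟩⟩) fun r z hz => ?_
  · exact (Subsingleton.elim (α := PUnit) _ _)
  · rw [key r z]
    refine gen_mem_marked adj (X := 𝟙_ MCSet.{u}) _ _ (.inl fun h => ?_)
    have h1 := h.le
    have h2 := MSSet.pos hz
    change r ≤ 0 at h1
    omega

/-- The comparison map from the triangulation of a pseudo Gray tensor product to the product of the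
triangulations. -/
noncomputable def comparison (T : MCSet.{u} ⥤ PreComp.{u}) (X Y : MCSet.{u}) :
    T.obj (X ⊗ Y) ⟶ (T.obj X).prod (T.obj Y) :=
  PreComp.homMk (CartesianMonoidalCategory.lift
    (T.map (projLeft MCSet.isTerminalUnit X Y)).hom.map
    (T.map (projRight MCSet.isTerminalUnit X Y)).hom.map) fun n x h =>
      ⟨(T.map (projLeft MCSet.isTerminalUnit X Y)).hom.preserves n x h,
        (T.map (projRight MCSet.isTerminalUnit X Y)).hom.preserves n x h⟩

/-- Replaces the abstract pairing of the oplax structure by a map whose simplices and markings are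
explicit. -/
theorem lift_eq_comparison (X Y : MCSet.{u}) :
    CartesianMonoidalCategory.lift (T.map (projLeft MCSet.isTerminalUnit X Y))
      (T.map (projRight MCSet.isTerminalUnit X Y)) = comparison T X Y := by
  refine CartesianMonoidalCategory.hom_ext _ _ ?_ ?_
  · rw [CartesianMonoidalCategory.lift_fst]
    exact PreComp.hom_ext (CartesianMonoidalCategory.lift_fst _ _).symm
  · rw [CartesianMonoidalCategory.lift_snd]
    exact PreComp.hom_ext (CartesianMonoidalCategory.lift_snd _ _).symm

theorem gen_ptens_map {X Y : MCSet.{u}} {a a' b b' : Box} (f : a' ⟶ a) (g : b' ⟶ b)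
    (x : (MCSet.forget.obj X).functor.obj (op a)) (y : (MCSet.forget.obj Y).functor.obj (op b))
    {r : ℕ} (φ : Fin (r + 1) →o Cube a'.dim) (ψ : Fin (r + 1) →o Cube b'.dim) :
    gen adj (MCSet.ptens ((MCSet.forget.obj X).functor.map f.op x)
      ((MCSet.forget.obj Y).functor.map g.op y)) (pairHom φ ψ) =
      gen adj (MCSet.ptens x y)
        (pairHom ((Box.Hom.orderHom f).comp φ) ((Box.Hom.orderHom g).comp ψ)) := by
  rw [← MCSet.ptens_map, gen_map, ← tensor_comp_pairHom]
  rfl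

/-- A pair of simplices of triangulations. -/
abbrev simplexPair {X Y : MCSet.{u}} {r : ℕ} (x : (T.obj X).obj.toSSet.obj (op (.mk r)))
    (y : (T.obj Y).obj.toSSet.obj (op (.mk r))) :
    ((T.obj X).obj.toSSet ⊗ (T.obj Y).obj.toSSet).obj (op (.mk r)) :=
  @Prod.mk ((T.obj X).obj.toSSet.obj (op (.mk r))) ((T.obj Y).obj.toSSet.obj (op (.mk r))) x y

theorem comparison_gen {X Y : MCSet.{u}} {a b : Box}
    (x : (MCSet.forget.obj X).functor.obj (op a)) (y : (MCSet.forget.obj Y).functor.obj (op b))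
    {r : ℕ} (φ : Fin (r + 1) →o Cube a.dim) (ψ : Fin (r + 1) →o Cube b.dim) :
    (comparison T X Y).hom.map.app (op (.mk r))
      (gen adj (X := X ⊗ Y) (MCSet.ptens x y) (pairHom φ ψ)) =
        simplexPair (gen adj x φ) (gen adj y ψ) := by
  refine Prod.ext ?_ ?_
  · refine (gen_naturality adj (projLeft MCSet.isTerminalUnit X Y) (MCSet.ptens x y) _).trans ?_
    refine (congrArg (fun w => gen adj w (pairHom φ ψ)) (MCSet.projLeft_ptens x y)).trans ?_
    refine (gen_map adj (Box.fst a b) x _).trans ?_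
    exact congrArg (gen adj x) (fst_pairHom φ ψ)
  · refine (gen_naturality adj (projRight MCSet.isTerminalUnit X Y) (MCSet.ptens x y) _).trans ?_
    refine (congrArg (fun w => gen adj w (pairHom φ ψ)) (MCSet.projRight_ptens x y)).trans ?_
    refine (gen_map adj (Box.snd a b) y _).trans ?_
    exact congrArg (gen adj y) (snd_pairHom φ ψ)

theorem exists_gen_ptens {X Y : MCSet.{u}} {r : ℕ}
    (z : (T.obj (X ⊗ Y)).obj.toSSet.obj (op (.mk r))) :
    ∃ (a b : Box) (x : (MCSet.forget.obj X).functor.obj (op a))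
      (y : (MCSet.forget.obj Y).functor.obj (op b)) (φ : Fin (r + 1) →o Cube a.dim)
      (ψ : Fin (r + 1) →o Cube b.dim),
      z = gen adj (X := X ⊗ Y) (MCSet.ptens x y) (pairHom φ ψ) := by
  obtain ⟨c, w, χ, rfl⟩ := exists_gen adj z
  revert c w χ
  refine MCSet.forall_ptens fun a b x y χ => ⟨a, b, x, y, (Box.Hom.orderHom (Box.fst a b)).comp χ,
    (Box.Hom.orderHom (Box.snd a b)).comp χ, ?_⟩
  exact congrArg (gen adj (X := X ⊗ Y) (MCSet.ptens x y)) (pairHom_fst_snd χ).symm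

/-- Descent in two variables: first in `(y, ψ)` for fixed `(x, φ)`, then in `(x, φ)` with values in
functions on the simplices of `T Y`. Compatibility for the second descent is checked on generators
of `T Y` and is `gen_ptens_map`. -/
theorem exists_comparison_inverse (X Y : MCSet.{u}) (r : ℕ) :
    ∃ D : (T.obj X).obj.toSSet.obj (op (.mk r)) → (T.obj Y).obj.toSSet.obj (op (.mk r)) →
      (T.obj (X ⊗ Y)).obj.toSSet.obj (op (.mk r)),
      ∀ (a b : Box) (x : (MCSet.forget.obj X).functor.obj (op a))
        (y : (MCSet.forget.obj Y).functor.obj (op b)) (φ : Fin (r + 1) →o Cube a.dim)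
        (ψ : Fin (r + 1) →o Cube b.dim), D (gen adj x φ) (gen adj y ψ) =
          gen adj (X := X ⊗ Y) (MCSet.ptens x y) (pairHom φ ψ) := by
  have h (a : Box) (x : (MCSet.forget.obj X).functor.obj (op a)) (φ : Fin (r + 1) →o Cube a.dim) :
      ∃ D : (T.obj Y).obj.toSSet.obj (op (.mk r)) → (T.obj (X ⊗ Y)).obj.toSSet.obj (op (.mk r)),
        ∀ b y ψ, D (gen adj (a := b) y ψ) =
          gen adj (X := X ⊗ Y) (MCSet.ptens x y) (pairHom φ ψ) :=
    exists_gen_desc adj (fun b y ψ => gen adj (X := X ⊗ Y) (MCSet.ptens x y) (pairHom φ ψ))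
      fun g y ψ => by
        have e := gen_ptens_map adj (𝟙 a) g x y φ ψ
        rw [show (MCSet.forget.obj X).functor.map (𝟙 a).op x = x from fmap_id _ _ x] at e
        exact e
  choose d hd using h
  obtain ⟨D, hD⟩ := exists_gen_desc adj d fun {a a'} f x φ => funext fun z => by
    obtain ⟨b, y, ψ, rfl⟩ := exists_gen adj z
    rw [hd, hd]
    have e := gen_ptens_map adj f (𝟙 b) x y φ ψ
    rw [show (MCSet.forget.obj Y).functor.map (𝟙 b).op y = y from fmap_id _ _ y] at e
    exact e
  exact ⟨D, fun a b x y φ ψ => (congrFun (hD a x φ) _).trans (hd a x φ b y ψ)⟩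

theorem comparison_bijective (adj : T ⊣ triangulationRight.{u}) (X Y : MCSet.{u}) (r : ℕ) :
    Function.Bijective ((comparison T X Y).hom.map.app (op (.mk r))) := by
  obtain ⟨D, hD⟩ := exists_comparison_inverse adj X Y r
  refine ⟨Function.LeftInverse.injective
    (g := fun z : (T.obj X).obj.toSSet.obj (op (.mk r)) × (T.obj Y).obj.toSSet.obj (op (.mk r)) =>
      D z.1 z.2) fun z => ?_, fun z => ?_⟩
  · obtain ⟨a, b, x, y, φ, ψ, rfl⟩ := exists_gen_ptens adj z
    have e := comparison_gen adj x y φ ψ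
    refine (congrArg (fun z : (T.obj X).obj.toSSet.obj (op (.mk r)) ×
      (T.obj Y).obj.toSSet.obj (op (.mk r)) => D z.1 z.2) e).trans ?_
    exact hD a b x y φ ψ
  · obtain ⟨z₁, z₂⟩ := z
    obtain ⟨a, x, φ, rfl⟩ := exists_gen adj z₁
    obtain ⟨b, y, ψ, rfl⟩ := exists_gen adj z₂
    exact ⟨_, comparison_gen adj x y φ ψ⟩

/-- The face map splits as a tensor product of maps with sources `[1]^k` and `[1]^l`, where `k + l =
r`. If `k` and `l` are positive, the resulting cube is marked by definition of the pseudo Gray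
product. Otherwise `s` lies in a single factor, whose cube is marked of dimension at most `r` by
hypothesis. Then `s` exhausts that factor and the map there is the identity. -/
theorem isMarked_subface {X Y : MCSet.{u}} {a b : Box} {r : ℕ}
    (x : (MCSet.forget.obj X).functor.obj (op a)) (y : (MCSet.forget.obj Y).functor.obj (op b))
    {s : Fin r → Fin (a ⊗ b).dim} (hs : StrictMono s) (v : Cube (a ⊗ b).dim)
    (hx : ∀ s' : Fin r → Fin a.dim, StrictMono s' → (∀ p, s p = Fin.castAdd b.dim (s' p)) →
      X.IsMarked x ∧ a.dim ≤ r)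
    (hy : ∀ s' : Fin r → Fin b.dim, StrictMono s' → (∀ p, s p = Fin.natAdd a.dim (s' p)) →
      Y.IsMarked y ∧ b.dim ≤ r) :
    (X.pseudo Y).IsMarked ((MCSet.forget.obj (X.pseudo Y)).functor.map
      (Quiver.Hom.op (⟨subface s v, isBoxMap_subface hs v⟩ : Box.mk r ⟶ a ⊗ b))
      (MCSet.ptens x y)) := by
  obtain ⟨k, l, hkl, f₁, f₂, hf₁, hf₂, hf⟩ :=
    (isBoxMap_subface hs v).split a.dim b.dim rfl
  let g₁ : Box.mk k ⟶ a := ⟨f₁, hf₁⟩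
  let g₂ : Box.mk l ⟶ b := ⟨f₂, hf₂⟩
  have e : (⟨subface s v, isBoxMap_subface hs v⟩ : Box.mk r ⟶ a ⊗ b) =
      (Box.addIso (a := ⟨r⟩) (b := ⟨k⟩) (c := ⟨l⟩) hkl).hom ≫ (g₁ ⊗ₘ g₂) := Box.hom_ext hf
  rw [e, op_comp, fmap_comp, MCSet.ptens_map]
  refine MCSet.IsMarked.cast (a := ⟨r⟩) (b := Box.mk k ⊗ Box.mk l) hkl (MCSet.isMarked_ptens ?_)
  have hs' (w : Cube r) (p : Fin r) : tensorMap f₁ f₂ (recast hkl w) (s p) = w p := by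
    rw [← hf w]
    exact subface_apply hs v w p
  by_cases hk : 1 ≤ k
  · by_cases hl : 1 ≤ l
    · exact .inr (.inr ⟨hk, hl⟩)
    · obtain rfl : l = 0 := by omega
      obtain rfl : r = k := hkl.trans (Nat.add_zero k)
      have h1 (p : Fin r) : ∃ i, s p = Fin.castAdd b.dim i := by
        refine Fin.addCases (motive := fun j => s p = j → ∃ i, s p = Fin.castAdd b.dim i)
          (fun i h => ⟨i, h⟩) (fun i h => ?_) (s p) rfl
        -- A free coordinate in the second block would be computed by `f₂` from the only point of
        -- `[1]^0`, so it could not vary with `w`.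
        have h2 (w : Cube r) : f₂ (fun j => recast hkl w (Fin.natAdd r j)) i = w p := by
          rw [← hs' w p, h, tensorMap_natAdd]
        have h3 := (h2 fun _ => true).symm.trans
          ((congrArg (fun c => f₂ c i) (Subsingleton.elim _ _)).trans (h2 fun _ => false))
        exact absurd h3 (by decide)
      choose s' h1 using h1
      have hmono : StrictMono s' := fun p q hpq => by
        have := hs hpq
        rw [h1, h1] at this
        exact this
      obtain ⟨hX, hle⟩ := hx s' hmono h1
      obtain rfl : a = ⟨r⟩ := by
        have := Fintype.card_le_of_injective _ hmono.injective
        simp at this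
        obtain ⟨a⟩ := a
        exact congrArg Box.mk (le_antisymm hle this)
      have e1 : g₁ = 𝟙 _ := Box.hom_ext fun w => funext fun p => by
        have h2 := hs' w p
        have h4 : s' p = p := by
          have : s' = id := StrictMono.eq_id hmono
          rw [this]; rfl
        rw [h1, h4, tensorMap_castAdd] at h2
        exact h2
      rw [e1]
      left
      exact (fmap_id (MCSet.forget.obj X).functor _ x).symm ▸ hX
  · obtain rfl : k = 0 := by omega
    obtain rfl : r = l := hkl.trans (Nat.zero_add l)
    have h1 (p : Fin r) : ∃ i, s p = Fin.natAdd a.dim i := by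
      refine Fin.addCases (motive := fun j => s p = j → ∃ i, s p = Fin.natAdd a.dim i)
        (fun i h => ?_) (fun i h => ⟨i, h⟩) (s p) rfl
      have h2 (w : Cube r) : f₁ (fun j => recast hkl w (Fin.castAdd r j)) i = w p := by
        rw [← hs' w p, h, tensorMap_castAdd]
      have h3 := (h2 fun _ => true).symm.trans
        ((congrArg (fun c => f₁ c i) (Subsingleton.elim _ _)).trans (h2 fun _ => false))
      exact absurd h3 (by decide)
    choose s' h1 using h1
    have hmono : StrictMono s' := fun p q hpq => by
      have := hs hpq
      rw [h1, h1] at this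
      have h : a.dim + (s' p).val < a.dim + (s' q).val := this
      exact Fin.lt_def.2 (by omega)
    obtain ⟨hY, hle⟩ := hy s' hmono h1
    obtain rfl : b = ⟨r⟩ := by
      have := Fintype.card_le_of_injective _ hmono.injective
      simp at this
      obtain ⟨b⟩ := b
      exact congrArg Box.mk (le_antisymm hle this)
    have e1 : g₂ = 𝟙 _ := Box.hom_ext fun w => funext fun p => by
      have h2 := hs' w p
      have h4 : s' p = p := by
        have : s' = id := StrictMono.eq_id hmono
        rw [this]; rfl
      rw [h1, h4, tensorMap_natAdd] at h2
      refine Eq.trans (congrArg (fun c => f₂ c p) (funext fun j => ?_)) h2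
      exact congrArg w (Fin.ext (by simp))
    rw [e1]
    right
    left
    exact (fmap_id (MCSet.forget.obj Y).functor _ y).symm ▸ hY

/-- The marking is pulled back to the nerve of the cube `x ⊗ y`, where
`IsPreMarking.mem_of_subfaceChain` leaves the chains along the jump sequences `s` of the pair. If
`s` lies in one block, it is a jump sequence of `φ` or `ψ`, which excludes the first alternative in
`hx` or `hy`; so `isMarked_subface` applies to the face along `s`. -/
theorem gen_ptens_mem_marked {X Y : MCSet.{u}} {a b : Box} {r : ℕ} (hr : 1 ≤ r)
    (x : (MCSet.forget.obj X).functor.obj (op a)) (y : (MCSet.forget.obj Y).functor.obj (op b))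
    (φ : Fin (r + 1) →o Cube a.dim) (ψ : Fin (r + 1) →o Cube b.dim)
    (hx : ¬ Jumps φ ∨ (X.IsMarked x ∧ a.dim ≤ r)) (hy : ¬ Jumps ψ ∨ (Y.IsMarked y ∧ b.dim ≤ r)) :
    gen adj (X := X ⊗ Y) (MCSet.ptens x y) (pairHom φ ψ) ∈ (T.obj (X ⊗ Y)).obj.marked r := by
  have hM := (IsPreMarking.of (T.obj (X ⊗ Y))).preimage
    (genMap adj (X := X ⊗ Y) (MCSet.ptens x y))
  refine hM.mem_of_subfaceChain
    (fun m χ hχ => gen_mem_marked adj (X := X ⊗ Y) (MCSet.ptens x y) χ (.inl hχ)) hr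
    (pairHom φ ψ) fun s hs hjump v => ?_
  have key := isMarked_subface x y hs v
    (fun s' hs' h => hx.resolve_left (not_not.2 ⟨s', hs', fun p => ?_⟩))
    (fun s' hs' h => hy.resolve_left (not_not.2 ⟨s', hs', fun p => ?_⟩))
  · have e := gen_map adj (X := X ⊗ Y)
      (⟨subface s v, isBoxMap_subface hs v⟩ : Box.mk r ⟶ a ⊗ b) (MCSet.ptens x y) (longChain r)
    refine Set.mem_of_eq_of_mem (s := (T.obj (X ⊗ Y)).obj.marked r) e.symm ?_
    exact gen_mem_marked adj (X := X ⊗ Y) _ (longChain r) (.inr ⟨key, le_rfl⟩)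
  · have h1 := hjump p
    rw [h] at h1
    exact ⟨(Fin.append_left _ _ _).symm.trans h1.1, (Fin.append_left _ _ _).symm.trans h1.2⟩
  · have h1 := hjump p
    rw [h] at h1
    exact ⟨(Fin.append_right _ _ _).symm.trans h1.1, (Fin.append_right _ _ _).symm.trans h1.2⟩

/-- A pre-complicial marking of a product of triangulations that contains the pairs of generating
marked simplices contains all pairs of marked simplices. -/
theorem IsPreMarking.mem_of_generatingMarked {X Y : MCSet.{u}}
    {M : ∀ r : ℕ, Set (((T.obj X).obj.toSSet ⊗ (T.obj Y).obj.toSSet).obj (op (.mk r)))}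
    (hM : IsPreMarking M)
    (h : ∀ r, ∀ x ∈ generatingMarked adj X r, ∀ y ∈ generatingMarked adj Y r,
      simplexPair x y ∈ M r) (r : ℕ) :
    ∀ x ∈ (T.obj X).obj.marked r, ∀ y ∈ (T.obj Y).obj.marked r, simplexPair x y ∈ M r := by
  -- One variable at a time: against generators `y`, the admissible `x` form a pre-complicial
  -- marking that contains the generators, hence all marked simplices of `T X`.
  have h1 (r : ℕ) : ∀ x ∈ (T.obj X).obj.marked r, ∀ y ∈ generatingMarked adj Y r,
      simplexPair x y ∈ M r := by
    have hN := hM.slice (generatingMarked adj Y) (degenerate_le_generatingMarked adj Y)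
      fun n x y hx hy => h n x (degenerate_le_generatingMarked adj X n hx) y hy
    intro x hx
    refine (marked_triangulation_le adj hN (fun a x m φ hφ => ?_) r hx).2
    have hx' : gen adj x φ ∈ generatingMarked adj X m := ⟨a, x, φ, rfl, hφ⟩
    exact ⟨generatingMarked_pos adj hx', fun y hy => h m _ hx' y hy⟩
  -- The braiding exchanges the factors, so that the other variable can be sliced, now against all
  -- marked simplices of `T X`.
  have hM' := hM.preimage (β_ (T.obj Y).obj.toSSet (T.obj X).obj.toSSet).hom
  have hN := hM'.slice (T.obj X).obj.marked (T.obj X).obj.degenerate_le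
    fun n y x hy hx => h1 n x hx y (degenerate_le_generatingMarked adj Y n hy)
  intro x hx y hy
  refine (marked_triangulation_le adj hN (fun b y m ψ hψ => ?_) r hy).2 x hx
  have hy' : gen adj y ψ ∈ generatingMarked adj Y m := ⟨b, y, ψ, rfl, hψ⟩
  exact ⟨generatingMarked_pos adj hy', fun x hx => h1 m x hx _ hy'⟩

theorem isIso_comparison (adj : T ⊣ triangulationRight.{u}) (X Y : MCSet.{u}) :
    IsIso (comparison T X Y) := by
  have hb := comparison_bijective adj X Y
  refine PreComp.isIso_of_bijective _ hb fun r z hz => ?_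
  have h1 (k : SimplexCategoryᵒᵖ) : IsIso ((comparison T X Y).hom.map.app k) :=
    (isIso_iff_bijective _).2 (hb _)
  have h2 : IsIso (comparison T X Y).hom.map := NatIso.isIso_of_isIso_app _
  have hinv (m : ℕ) (w : (T.obj (X ⊗ Y)).obj.toSSet.obj (op (.mk m))) :
      (inv (comparison T X Y).hom.map).app (op (.mk m))
        ((comparison T X Y).hom.map.app (op (.mk m)) w) = w := by
    have e := congrArg (fun k => k.app (op (.mk m)))
      (IsIso.hom_inv_id (comparison T X Y).hom.map)
    exact ConcreteCategory.congr_hom e w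
  -- The marking of `T (X ⊗ Y)` is transported to the product of the underlying simplicial sets,
  -- where it has to contain all pairs of marked simplices.
  have hM := (IsPreMarking.of (T.obj (X ⊗ Y))).preimage (inv (comparison T X Y).hom.map)
  have key := IsPreMarking.mem_of_generatingMarked adj (X := X) (Y := Y) hM (by
    rintro m _ ⟨a, x, φ, rfl, hx⟩ _ ⟨b, y, ψ, rfl, hy⟩
    have hm : 1 ≤ m := MSSet.pos (gen_mem_marked adj x φ hx)
    have e := hinv m (gen adj (X := X ⊗ Y) (MCSet.ptens x y) (pairHom φ ψ))
    rw [comparison_gen adj x y φ ψ] at e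
    exact Set.mem_of_eq_of_mem (s := (T.obj (X ⊗ Y)).obj.marked m) e
      (gen_ptens_mem_marked adj hm x y φ ψ hx hy)) r _ hz.1 _ hz.2
  exact Set.mem_of_eq_of_mem (hinv r z).symm key

/-- With invertible structure maps the oplax structure of `T` is strong. The right adjoint carries
the lax structure transposed from it, for which the compatibility with the adjunction holds by
definition. -/
theorem exists_isMonoidal (adj : T ⊣ triangulationRight.{u}) :
    ∃ (_ : T.Monoidal) (_ : triangulationRight.{u}.LaxMonoidal), adj.IsMonoidal := by
  let _ : T.OplaxMonoidal := oplaxMonoidalOfIsTerminal MCSet.isTerminalUnit T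
  have h1 : IsIso (Functor.OplaxMonoidal.η T) := isIso_unit_comparison adj
  have h2 (X Y : MCSet.{u}) : IsIso (Functor.OplaxMonoidal.δ T X Y) := by
    change IsIso (CartesianMonoidalCategory.lift _ _)
    rw [lift_eq_comparison]
    exact isIso_comparison adj X Y
  let hT : T.Monoidal := Functor.Monoidal.ofOplaxMonoidal T
  let hU : triangulationRight.{u}.LaxMonoidal :=
    @Adjunction.rightAdjointLaxMonoidal _ _ _ _ _ _ _ _ adj hT.toOplaxMonoidal
  refine ⟨hT, hU, ?_⟩
  exact @Adjunction.IsMonoidal.mk _ _ _ _ _ _ _ _ adj hT.toOplaxMonoidal hU rfl fun _ _ => rfl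

end Comparison

end Comical

theorem mainTheorem5 :
    ∃ (_ : Comical.triangulation.{u}.Monoidal)
      (_ : Comical.triangulationRight.{u}.LaxMonoidal),
      Comical.triangulationAdjunction.{u}.IsMonoidal :=
  Comical.exists_isMonoidal Comical.triangulationAdjunction.{u}
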